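/- \textbf{Setting.} Let $\mathcal A$ be a set of particles and $\mathcal C$ a finite set of channels. A channel $\sigma\in\mathcal C$ is a sequence of particles $\sigma(0),\sigma(1),\dots$; the particles $\sigma(k)$ ($\sigma\in\mathcal C$, $k\ge 0$) are pairwise distinct, and the central part $\mathcal A_1=\mathcal A\setminus\{\sigma(k):\sigma\in\mathcal C,\ k\ge1\}$ is finite. Let $\mathcal L=(L(\alpha,\beta))_{\alpha,\beta\in\mathcal A}$ be a real symmetric matrix with finitely many nonzero entries in each row and $\langle\mathcal L\xi,\xi\rangle>0$ for all $0\ne\xi\in\ell^2(\mathcal A)$. For $k\ge1$ suppose $L(\sigma(k),\beta)=0$ unless $\beta\in\{\sigma(k-1),\sigma(k),\sigma(k+1)\}$. Put $\mathfrak a_\sigma(k)=L(\sigma(k),\sigma(k))$ and $\mathfrak b_\sigma(k)=-L(\sigma(k),\sigma(k+1))$, and suppose that $\mathfrak b_\sigma(k)>0$ for all $k\ge 0$. Suppose there are $a_\sigma\in\mathbb R$, $b_\sigma>0$ and $\epsilon>0$ with $\sum_{k\ge1}(1+\epsilon)^k\big(|\mathfrak a_\sigma(k)-a_\sigma|+|\mathfrak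 b_\sigma(k)-b_\sigma|\big)<\infty$. Suppose that $\bigcup_\sigma(a_\sigma-2b_\sigma,a_\sigma+2b_\sigma)$ is connected and choose $a,b\in\mathbb R$ with $\bigcup_\sigma[a_\sigma-2b_\sigma,a_\sigma+2b_\sigma]=[a-2b,a+2b]$. Let $\mathbb D$ be the open unit disk, $W(\omega)=a-b(\omega+\omega^{-1})$, $W_\sigma(\theta)=a_\sigma-b_\sigma(\theta+\theta^{-1})$, and let $\theta_\sigma=W_\sigma^{-1}\circ W:\mathbb D\to\mathbb D$, extended continuously to $\overline{\mathbb D}$. For $0<|\theta|\le1$ let $e_\sigma(k,\theta)$, $k\ge0$, be the Jost solution, i.e. the unique solution of $$-\mathfrak b_\sigma(k-1)x(k-1)+\mathfrak a_\sigma(k)x(k)-\mathfrak b_\sigma(k)x(k+1)=z\,x(k),\qquad k\ge1,\tag{1}$$ with $z=W_\sigma(\theta)$ and $x(k)=\theta^k(1+o(1))$ as $k\to\infty$. Let $p_\sigma(k,\omega)$ be the solution of (1) with $z=W(\omega)$, $p_\sigma(0,\omega)=1$, $p_\sigma(1,\omega)=0$. Put $\mathcal E(k,\omega)=\mathrm{diag}\{e_\sigma(k,\theta_\sigma(\omega))\}$,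 $P(k,\omega)=\mathrm{diag}\{p_\sigma(k,\omega)\}$, $B=\mathrm{diag}\{b_\sigma\}$, $B(0)=\mathrm{diag}\{\mathfrak b_\sigma(0)\}$, $D(\omega)=\mathrm{diag}\{\theta_\sigma(\omega)^{-1}-\theta_\sigma(\omega)\}$. Let $\mathcal R(\lambda)$ be the $\mathcal C\times\mathcal C$ matrix whose $(\sigma,\nu)$ entry is the $(\sigma(0),\nu(0))$ entry of $(\mathcal L_1-\lambda)^{-1}$, where $\mathcal L_1=(L(\alpha,\beta))_{\alpha,\beta\in\mathcal A_1}$, and put $$T(\omega)=\mathcal E(0,\omega)-\mathcal R(W(\omega))B(0)\mathcal E(1,\omega),\qquad U(k,\omega)=\big[-P(k,\omega)+\mathcal E(k,\omega)T(\omega)^{-1}\big]BB(0)^{-1}D(\omega)\mathcal E(1,\omega)^{-1}.$$ Let $\Omega$ be the set of all $\omega\in\overline{\mathbb D}\setminus\{0\}$ that are poles of some entry of some $U(k,\cdot)$, $k\ge0$ (that is, the modulus of the entry tends to $\infty$ along the points of $\overline{\mathbb D}\setminus\{0\}$ near $\omega$ at which every inverse in the formula exists). Removable singularities of $U$ are removed,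 that is, $U$ is extended by its limits. For $\sigma\in\mathcal C$ and $\omega\in\overline{\mathbb D}\setminus(\Omega\cup\{0\})$ the special solution for the wave incoming along $\sigma$ is a function $\psi^\sigma(\cdot,\omega)$ on $\mathcal A$ with $\psi^\sigma(\gamma(k),\omega)=U(k,\omega)_{\gamma\sigma}$ for all $\gamma\in\mathcal C$, $k\ge0$, such that $\mathcal L\psi^\sigma=W(\omega)\psi^\sigma$ and such that for some numbers $s_{\gamma\sigma}(\omega)$, the scattering coefficients, (i) $\psi^\sigma(\gamma(k),\omega)=s_{\gamma\sigma}(\omega)e_\gamma(k,\theta_\gamma(\omega))$ for $\gamma\ne\sigma$, $k\ge 0$; (ii) if $|\theta_\sigma(\omega)|=1$, then $\psi^\sigma(\sigma(k),\omega)=e_\sigma(k,\theta_\sigma(\omega)^{-1})+s_{\sigma\sigma}(\omega)e_\sigma(k,\theta_\sigma(\omega))$ for $k\ge 0$; (iii) if $|\theta_\sigma(\omega)|<1$, then $\psi^\sigma(\sigma(k),\omega)=\theta_\sigma(\omega)^{-k}(1+o(1))$ as $k\to\infty$. \textbf{Statement.} Such special solutions exist for all $\sigma\in\mathcal C$ and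 all $\omega\in\overline{\mathbb D}\setminus(\Omega\cup\{0\})$, so that the coefficients $s_{\gamma\sigma}(\omega)$, $\gamma\neq\sigma$, are well defined there. For all $\sigma\ne\gamma$ in $\mathcal C$, $$b_\gamma\big(\theta_\gamma(\omega)^{-1}-\theta_\gamma(\omega)\big)s_{\gamma\sigma}(\omega)=b_\sigma\big(\theta_\sigma(\omega)^{-1}-\theta_\sigma(\omega)\big)s_{\sigma\gamma}(\omega),\qquad \omega\in\overline{\mathbb D}\setminus\Omega,$$ where at $\omega=0$ both sides are understood as limits as $\omega\to0$, which exist. Moreover $s_{\gamma\sigma}$ and $s_{\sigma\gamma}$ are continuous on $\overline{\mathbb D}\setminus(\Omega\cup\{0\})$, in particular up to $\mathbb T\setminus\Omega$, and they have limits at $\omega=0$. -/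

import Mathlib

open Filter Topology

noncomputable section

/-- A web-like system of particles with particle set `𝒜` and finitely many semi-infinite channels
indexed by `C`, together with the standing assumptions: real symmetric interaction matrix `L` which
is positive as an operator on `ℓ²(𝒜)`, channels with pairwise distinct particles (in particular
pairwise distinct attachment points `chan σ 0`), nearest neighbour interaction along the channels,
a finite central part, and coefficients converging exponentially fast along every channel. -/
structure WebSystem (𝒜 : Type*) (C : Type*) where
  /-- the interaction matrix -/
  L : 𝒜 → 𝒜 → ℝ
  /-- `chan σ k` is the `k`-th particle of the channel `σ` -/
  chan : C → ℕ → 𝒜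
  /-- the limit of the diagonal coefficients along a channel -/
  aLim : C → ℝ
  /-- the limit of the off-diagonal coefficients along a channel -/
  bLim : C → ℝ
  /-- the centre of the interval `I` covered by the bands of all the channels -/
  a : ℝ
  /-- a quarter of the length of the interval `I` -/
  b : ℝ
  L_symm : ∀ α β, L α β = L β α
  L_finite : ∀ α, {β | L α β ≠ 0}.Finite
  L_pos : ∀ ξ : lp (fun _ : 𝒜 => ℝ) 2, ξ ≠ 0 → 0 < ∑' α, ξ α * ∑ᶠ β, L α β * ξ β
  chan_injective : Function.Injective fun p : C × ℕ => chan p.1 p.2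
  chan_interaction : ∀ σ k β, L (chan σ (k + 1)) β ≠ 0 →
    β = chan σ k ∨ β = chan σ (k + 1) ∨ β = chan σ (k + 2)
  chan_neg : ∀ σ k, L (chan σ k) (chan σ (k + 1)) < 0
  core_finite : {α | ∀ σ k, α ≠ chan σ (k + 1)}.Finite
  bLim_pos : ∀ σ, 0 < bLim σ
  decay : ∀ σ, ∃ ε : ℝ, 0 < ε ∧ Summable fun k : ℕ => (1 + ε) ^ k *
    (|L (chan σ k) (chan σ k) - aLim σ| + |-L (chan σ k) (chan σ (k + 1)) - bLim σ|)
  bands_connected :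
    IsPreconnected (⋃ σ, Set.Ioo (aLim σ - 2 * bLim σ) (aLim σ + 2 * bLim σ))
  bands_eq : (⋃ σ, Set.Icc (aLim σ - 2 * bLim σ) (aLim σ + 2 * bLim σ)) =
    Set.Icc (a - 2 * b) (a + 2 * b)

namespace WebSystem

variable {𝒜 C : Type*} (S : WebSystem 𝒜 C)

/-- The diagonal coefficient `𝔞_σ(k)`, used for `k ≥ 1`. -/
def aC (σ : C) (k : ℕ) : ℝ := S.L (S.chan σ k) (S.chan σ k)

/-- The off-diagonal coefficient `𝔟_σ(k)`, `k ≥ 0`. -/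
def bC (σ : C) (k : ℕ) : ℝ := -S.L (S.chan σ k) (S.chan σ (k + 1))

/-- The central part `𝒜₁`: all particles except the `σ(k)` with `k ≥ 1`. -/
def core : Set 𝒜 := {α | ∀ σ k, α ≠ S.chan σ (k + 1)}

instance : Fintype S.core := S.core_finite.fintype

/-- The attachment point `σ(0)` as an element of the central part. -/
def attach (σ : C) : S.core :=
  ⟨S.chan σ 0, fun ν k h => by
    have := @S.chan_injective (σ, 0) (ν, k + 1) h
    simp at this⟩

/-- `x` solves the channel equation of `σ` at the spectral parameter `z` (at all `k ≥ 1`). -/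
def SolvesChannel (σ : C) (z : ℂ) (x : ℕ → ℂ) : Prop :=
  ∀ k : ℕ, -(S.bC σ k : ℂ) * x k + (S.aC σ (k + 1) : ℂ) * x (k + 1)
    - (S.bC σ (k + 1) : ℂ) * x (k + 2) = z * x (k + 1)

/-- The Zhukovskii map `W`. -/
def W (ω : ℂ) : ℂ := S.a - S.b * (ω + ω⁻¹)

/-- The Zhukovskii map `W_σ` of a channel. -/
def Wc (σ : C) (θ : ℂ) : ℂ := S.aLim σ - S.bLim σ * (θ + θ⁻¹)

/-- The map `θ_σ = W_σ⁻¹ ∘ W` on the closed unit disk, with `θ_σ(0) = 0`. For `0 < |ω| < 1` the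
equation `W_σ(θ) = W(ω)` has exactly one solution in the closed disk, and the sign condition holds
automatically. For `|ω| = 1` the sign condition selects, among two complex conjugate solutions on
the unit circle, the boundary value of `θ_σ` from inside the disk. -/
def theta (σ : C) (ω : ℂ) : ℂ :=
  open Classical in
  if ω = 0 then 0 else
    Classical.epsilon fun θ : ℂ =>
      θ ≠ 0 ∧ ‖θ‖ ≤ 1 ∧ S.Wc σ θ = S.W ω ∧ 0 ≤ θ.im * ω.im

/-- The Jost solution `k ↦ e_σ(k, θ)` for `0 < |θ| ≤ 1`: the unique solution of the channel equation
at `W_σ(θ)` with `e_σ(k, θ) = θ ^ k (1 + o(1))` as `k → ∞`. -/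
def jost (σ : C) (θ : ℂ) : ℕ → ℂ :=
  Classical.epsilon fun x : ℕ → ℂ =>
    S.SolvesChannel σ (S.Wc σ θ) x ∧ Tendsto (fun k => x k / θ ^ k) atTop (𝓝 1)

/-- The solution `p_σ(k)` of the channel equation with `p_σ(0) = 1`, `p_σ(1) = 0`. -/
def pSol (σ : C) (z : ℂ) : ℕ → ℂ
  | 0 => 1
  | 1 => 0
  | k + 2 => (((S.aC σ (k + 1) : ℂ) - z) * pSol σ z (k + 1) - (S.bC σ k : ℂ) * pSol σ z k) /
      (S.bC σ (k + 1) : ℂ)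

/-- The matrix `ℒ₁ - z` on the central part. -/
def coreMat (z : ℂ) : Matrix S.core S.core ℂ :=
  open Classical in
  Matrix.of (fun α β : S.core => (S.L α β : ℂ)) - z • (1 : Matrix S.core S.core ℂ)

/-- The matrix `(r(σ(0), ν(0); z))` where `r` is the kernel of `(ℒ₁ - z)⁻¹`. -/
def resolvent (z : ℂ) : Matrix C C ℂ :=
  open Classical in
  Matrix.of fun σ ν => (S.coreMat z)⁻¹ (S.attach σ) (S.attach ν)

/-- `ψ` is, at the point `ω` (nonzero, in the closed disk), a special solution for a wave incoming
along `σ`, with scattering coefficients `s γ = s_{γσ}(ω)`. The coefficient `s σ` has a meaning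
only if `|θ_σ(ω)| = 1`, i.e. `ω ∈ T_σ⁺`. -/
structure IsSpecialSolutionAt (σ : C) (ω : ℂ) (ψ : 𝒜 → ℂ) (s : C → ℂ) : Prop where
  equation : ∀ α, ∑ᶠ β, (S.L α β : ℂ) * ψ β = S.W ω * ψ α
  transmitted : ∀ γ, γ ≠ σ → ∀ k, ψ (S.chan γ k) = s γ * S.jost γ (S.theta γ ω) k
  reflected : ‖S.theta σ ω‖ = 1 → ∀ k, ψ (S.chan σ k) =
    S.jost σ (S.theta σ ω)⁻¹ k + s σ * S.jost σ (S.theta σ ω) k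
  incoming : ‖S.theta σ ω‖ < 1 →
    Tendsto (fun k => ψ (S.chan σ k) / (S.theta σ ω)⁻¹ ^ k) atTop (𝓝 1)

variable [DecidableEq C]

/-- The diagonal matrix `ℰ(k, ω)` of Jost solutions. -/
def E (k : ℕ) (ω : ℂ) : Matrix C C ℂ :=
  Matrix.diagonal fun σ => S.jost σ (S.theta σ ω) k

/-- The diagonal matrix `P(k, ω)`. -/
def P (k : ℕ) (ω : ℂ) : Matrix C C ℂ :=
  Matrix.diagonal fun σ => S.pSol σ (S.W ω) k

/-- The diagonal matrix `B` of the limits `b_σ`. -/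
def B : Matrix C C ℂ := Matrix.diagonal fun σ => (S.bLim σ : ℂ)

/-- The diagonal matrix `B(0)` of the coefficients `𝔟_σ(0)`. -/
def B0 : Matrix C C ℂ := Matrix.diagonal fun σ => (S.bC σ 0 : ℂ)

/-- The diagonal matrix `D(ω)` with entries `θ_σ(ω)⁻¹ - θ_σ(ω)`. -/
def D (ω : ℂ) : Matrix C C ℂ :=
  Matrix.diagonal fun σ => (S.theta σ ω)⁻¹ - S.theta σ ω

variable [Fintype C]

/-- The matrix `T(ω)`. -/
def T (ω : ℂ) : Matrix C C ℂ := S.E 0 ω - S.resolvent (S.W ω) * S.B0 * S.E 1 ω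

/-- The formula for the matrix function `U(k, ω)`, meaningful on `S.generic`. -/
def Uformula (k : ℕ) (ω : ℂ) : Matrix C C ℂ :=
  (-S.P k ω + S.E k ω * (S.T ω)⁻¹) * S.B * (S.B0)⁻¹ * S.D ω * (S.E 1 ω)⁻¹

/-- The points of the closed disk at which every inverse in the formula for `U` exists. -/
def generic : Set ℂ :=
  open Classical in
  {ω | ‖ω‖ ≤ 1 ∧ ω ≠ 0 ∧ IsUnit (S.coreMat (S.W ω)).det ∧ IsUnit (S.T ω).det ∧
    ∀ σ, S.jost σ (S.theta σ ω) 1 ≠ 0}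

/-- The entries of `U(k, ω)`, with removable singularities removed. -/
def U (k : ℕ) (ω : ℂ) : Matrix C C ℂ :=
  Matrix.of fun γ σ => limUnder (𝓝[S.generic] ω) fun z => S.Uformula k z γ σ

/-- The set `Ω` of the nonzero poles of the matrix functions `U(k, ·)` in the closed disk. -/
def Omega : Set ℂ :=
  {ω | ‖ω‖ ≤ 1 ∧ ω ≠ 0 ∧
    ∃ k γ σ, Tendsto (fun z => ‖S.Uformula k z γ σ‖) (𝓝[S.generic] ω) atTop}

/-- `s` is the vector of scattering coefficients at `ω` of the special solution
`ψ^σ(γ(k), ω) = U(k, ω)_{γσ}`. -/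
def HasScattering (σ : C) (ω : ℂ) (s : C → ℂ) : Prop :=
  ∃ ψ : 𝒜 → ℂ, S.IsSpecialSolutionAt σ ω ψ s ∧ ∀ γ k, ψ (S.chan γ k) = S.U k ω γ σ

/-- The scattering coefficient `s_{γσ}(ω)`, for `γ ≠ σ`, `ω ≠ 0`. -/
def scat (γ σ : C) (ω : ℂ) : ℂ :=
  Classical.epsilon (S.HasScattering σ ω) γ

end WebSystem

end

/-! Everything is reduced to meromorphic functions of one local parameter. Exponential decay of the
coefficients makes the normalised Jost solution `u_k(θ) = θ^(-k) e_σ(k, θ)` analytic in a disk of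
radius greater than one (`JacobiTail.exists_normalized_jost`), hence across the unit circle. The
functions `θ_σ` are continuous on the closed disk, but may have square-root branch points on the
circle, at the band edges of the channels. Near such a point `θ_τ - θ_τ⁻¹`, for a channel `τ` with
an edge there, serves as a parameter in which `W` and all the `θ_σ` are analytic; elsewhere `ω - ω₀`
does (`exists_uniformizer`). So every entry of `U` is a meromorphic germ composed with a parameter,
and has either a limit or a pole (`Uformula_dichotomy`).

The determinants in the formula do not vanish identically, because they are nonzero wherever `W(ω)`
is nonreal: a kernel vector of `T` would give a decaying solution on the whole system at a nonreal
spectral parameter, which the flux balance excludes (`isUnit_det_T`). Hence generic points fill a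
punctured neighbourhood of each nonzero point of the closed disk (`eventually_mem_generic`).

At generic points the special solution is explicit. Off `Ω` its defining properties survive in the
limit: the channel equation, the Wronskian with the Jost solution, which fixes the incoming wave,
and proportionality to the Jost solution on the other channels. Only the central part needs an
argument, since `W(ω₀)` may be an eigenvalue of `ℒ₁`; `exists_core_solution_of_tendsto` handles this
by discarding the eigenvectors that no channel sees.

Reciprocity is linear algebra: `B(0) ℰ(1) T` is symmetric because `ℒ₁`, and with it the resolvent,
is (`symmetry_generic`); limits give the rest. At the origin orders of vanishing are counted: off
the diagonal the resolvent is `O(ω²)`, so `T` and `T⁻¹` are `O(ω³)`, while the incoming factor is of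
order `ω⁻²`. Thus `s_{γσ} = O(ω)`, and the weight of order `ω⁻¹` leaves a finite limit. -/

noncomputable section

open scoped Matrix

/-! ### Analytic Jost solutions of exponentially small perturbations. -/

namespace JacobiTail

/-- The perturbation term in the backward recursion for the normalised Jost solution. -/
def pert (α β : ℕ → ℝ) (a b : ℝ) (θ : ℂ) (k : ℕ) : ℂ :=
  ((α (k + 1) : ℂ) - a) * θ + ((b : ℂ) - β (k + 1)) * θ ^ 2 + ((b : ℂ) - β k)

/-- The state at level `k` of the backward recursion started with the free solution at level
`k + m`. -/
def approx (α β : ℕ → ℝ) (a b : ℝ) (θ : ℂ) : ℕ → ℕ → ℂ × ℂ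
  | 0, _ => (1, 0)
  | m + 1, k =>
    let X := approx α β a b θ m (k + 1)
    let v := θ ^ 2 * X.2 + pert α β a b θ k * X.1
    (X.1 + v / β k, v)

variable {α β : ℕ → ℝ} {a b : ℝ}

lemma approx_succ_snd (θ : ℂ) (m k : ℕ) :
    (approx α β a b θ (m + 1) k).2 = θ ^ 2 * (approx α β a b θ m (k + 1)).2 +
      pert α β a b θ k * (approx α β a b θ m (k + 1)).1 := rfl

lemma approx_succ_fst (θ : ℂ) (m k : ℕ) :
    (approx α β a b θ (m + 1) k).1 = (approx α β a b θ m (k + 1)).1 +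
      (approx α β a b θ (m + 1) k).2 / β k := rfl

/-- The second component of the state is `β k` times the drop of the first component from level `k`
to `k + 1`. Eliminating it turns the first-order system into the three-term recurrence that `θ ^
(-k) x(k)` satisfies when `x` solves the channel equation at `a - b (θ + θ⁻¹)`. -/
lemma approx_recurrence (hβ : ∀ k, 0 < β k) (θ : ℂ) (m k : ℕ) :
    (β k : ℂ) * (approx α β a b θ (m + 2) k).1 =
      (((α (k + 1) : ℂ) - a) * θ + b * θ ^ 2 + b) * (approx α β a b θ (m + 1) (k + 1)).1 -
        (β (k + 1) : ℂ) * θ ^ 2 * (approx α β a b θ m (k + 2)).1 := by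
  have h0 : (β k : ℂ) ≠ 0 := by exact_mod_cast (hβ k).ne'
  have h1 : (β (k + 1) : ℂ) ≠ 0 := by exact_mod_cast (hβ (k + 1)).ne'
  have e1 := approx_succ_fst (α := α) (β := β) (a := a) (b := b) θ (m + 1) k
  have e2 := approx_succ_snd (α := α) (β := β) (a := a) (b := b) θ (m + 1) k
  have e3 := approx_succ_fst (α := α) (β := β) (a := a) (b := b) θ m (k + 1)
  have e4 : (approx α β a b θ (m + 1) (k + 1)).2 = β (k + 1) *
      ((approx α β a b θ (m + 1) (k + 1)).1 - (approx α β a b θ m (k + 2)).1) := by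
    rw [e3]; field_simp; ring
  rw [e1, e2, e4, pert]
  field_simp
  ring

lemma differentiable_approx (m k : ℕ) :
    Differentiable ℂ (fun θ => (approx α β a b θ m k).1) ∧
      Differentiable ℂ (fun θ => (approx α β a b θ m k).2) := by
  induction m generalizing k with
  | zero => exact ⟨differentiable_const _, differentiable_const _⟩
  | succ m ih =>
    obtain ⟨h1, h2⟩ := ih (k + 1)
    have h3 : Differentiable ℂ (fun θ => (approx α β a b θ (m + 1) k).2) := by
      simp only [approx_succ_snd, pert]
      fun_prop
    refine ⟨?_, h3⟩
    simp only [approx_succ_fst (m := m)]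
    fun_prop

/-- Propagation of the difference of two consecutive approximations in the weighted norm. -/
lemma norm_approx_sub_le {r K : ℝ} {η : ℕ → ℝ} {θ : ℂ} (hr : 0 < r) (hK : 0 ≤ K)
    (hη : ∀ k, 0 ≤ η k) (hθ : ‖θ‖ ^ 2 ≤ r) (hβ : ∀ k, 0 < β k) (hβK : ∀ k, (β k)⁻¹ ≤ K)
    (hp : ∀ k, ‖pert α β a b θ k‖ ≤ η k) (m k : ℕ) :
    ‖(approx α β a b θ (m + 1) k).1 - (approx α β a b θ m k).1‖ +
      r ^ k * ‖(approx α β a b θ (m + 1) k).2 - (approx α β a b θ m k).2‖ ≤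
      Real.exp (∑ i ∈ Finset.range m, (K * (r ^ (k + i))⁻¹ + r ^ (k + i) * η (k + i))) *
        (K * η (k + m) + r ^ (k + m) * η (k + m)) := by
  induction m generalizing k with
  | zero =>
    have h2 : (approx α β a b θ 1 k).2 = pert α β a b θ k := by
      rw [approx_succ_snd]; simp [approx]
    have h1 : (approx α β a b θ 1 k).1 = 1 + pert α β a b θ k / β k := by
      rw [approx_succ_fst, h2]; simp [approx]
    rw [zero_add, h1, h2]
    simp only [approx, Finset.range_zero, Finset.sum_empty, Real.exp_zero, one_mul, add_zero,
      add_sub_cancel_left, sub_zero]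
    have hb : ‖(β k : ℂ)‖ = β k := by simp [abs_of_pos (hβ k)]
    rw [norm_div, hb, div_eq_inv_mul]
    have := hp k
    have := hη k
    gcongr
    exact hβK k
  | succ m ih =>
    set du := (approx α β a b θ (m + 1) (k + 1)).1 - (approx α β a b θ m (k + 1)).1 with hdu
    set dv := (approx α β a b θ (m + 1) (k + 1)).2 - (approx α β a b θ m (k + 1)).2 with hdv
    have hv : (approx α β a b θ (m + 1 + 1) k).2 - (approx α β a b θ (m + 1) k).2 =
        θ ^ 2 * dv + pert α β a b θ k * du := by
      rw [approx_succ_snd θ (m + 1) k, approx_succ_snd θ m k, hdu, hdv]; ring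
    have hu : (approx α β a b θ (m + 1 + 1) k).1 - (approx α β a b θ (m + 1) k).1 =
        du + (θ ^ 2 * dv + pert α β a b θ k * du) / β k := by
      rw [← hv, approx_succ_fst, approx_succ_fst θ m k, hdu]; ring
    rw [hu, hv]
    have hb : ‖(β k : ℂ)‖ = β k := by simp [abs_of_pos (hβ k)]
    have hrk : 0 < r ^ k := pow_pos hr k
    set V := ‖θ ^ 2 * dv + pert α β a b θ k * du‖ with hV
    have hVle : V ≤ r * ‖dv‖ + η k * ‖du‖ := by
      refine (norm_add_le _ _).trans ?_
      rw [norm_mul, norm_mul, norm_pow]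
      gcongr
      exact hp k
    have hule : ‖du + (θ ^ 2 * dv + pert α β a b θ k * du) / β k‖ ≤ ‖du‖ + K * V := by
      refine (norm_add_le _ _).trans ?_
      rw [norm_div, hb, div_eq_inv_mul]
      gcongr
      exact hβK k
    set x := K * (r ^ k)⁻¹ with hx
    set y := r ^ k * η k with hy
    have hx0 : 0 ≤ x := by positivity
    have hy0 : 0 ≤ y := mul_nonneg hrk.le (hη k)
    set N := ‖du‖ + r ^ (k + 1) * ‖dv‖ with hN
    have hN0 : 0 ≤ N := by positivity
    have hrV : r ^ k * V ≤ r ^ (k + 1) * ‖dv‖ + y * ‖du‖ := by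
      calc r ^ k * V ≤ r ^ k * (r * ‖dv‖ + η k * ‖du‖) := by gcongr
        _ = _ := by rw [hy]; ring
    have hdvn : 0 ≤ r ^ (k + 1) * ‖dv‖ := by positivity
    have hKV : K * V = x * (r ^ k * V) := by rw [hx]; field_simp
    -- One backward step costs the factor `(1 + x) (1 + y)`. The weight `r ^ k` on the second
    -- component absorbs the growth from `θ ^ 2`, so `x` and `y` contain only `K r^(-k)` and `r ^ k
    -- η k`; both are summable when the lemma is applied, and the accumulated factor stays bounded.
    have hstep : ‖du + (θ ^ 2 * dv + pert α β a b θ k * du) / β k‖ + r ^ k * V ≤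
        Real.exp (x + y) * N := by
      have h1 : r ^ k * V ≤ r ^ (k + 1) * ‖dv‖ + y * ‖du‖ := hrV
      have h2 : ‖du‖ + K * V + r ^ k * V ≤ (1 + x) * (1 + y) * N := by
        rw [hKV]
        have : ‖du‖ + x * (r ^ k * V) + r ^ k * V = ‖du‖ + (1 + x) * (r ^ k * V) := by ring
        rw [this]
        have h3 : (1 + x) * (r ^ k * V) ≤ (1 + x) * (r ^ (k + 1) * ‖dv‖ + y * ‖du‖) := by
          gcongr
        have : (1 + x) * (1 + y) * N = ‖du‖ + (1 + x) * (r ^ (k + 1) * ‖dv‖ + y * ‖du‖) +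
          (x * ‖du‖ + (1 + x) * y * (r ^ (k + 1) * ‖dv‖)) := by rw [hN]; ring
        rw [this]
        have : 0 ≤ x * ‖du‖ + (1 + x) * y * (r ^ (k + 1) * ‖dv‖) := by positivity
        linarith
      have h4 : (1 + x) * (1 + y) ≤ Real.exp (x + y) := by
        rw [Real.exp_add]
        gcongr
        · linarith [Real.add_one_le_exp x]
        · linarith [Real.add_one_le_exp y]
      calc _ ≤ ‖du‖ + K * V + r ^ k * V := by gcongr
        _ ≤ _ := h2
        _ ≤ _ := by gcongr
    refine hstep.trans ?_
    rw [Finset.sum_range_succ', add_comm (Finset.sum _ _), add_zero, ← hx, ← hy,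
      Real.exp_add (x + y)]
    have e1 : ∀ i, k + (i + 1) = k + 1 + i := fun i => by ring
    rw [mul_assoc, Finset.sum_congr rfl fun i _ => by rw [e1 i], e1 m]
    gcongr
    exact ih (k + 1)

/-- Existence and analyticity in a disk of radius greater than `1` of the normalised Jost solution
`u_k(θ) = θ ^ (-k) e(k, θ)` for exponentially decaying perturbations. -/
theorem exists_normalized_jost (hβ : ∀ k, 0 < β k) (hb : 0 < b) {ε : ℝ} (hε : 0 < ε)
    (hs : Summable fun k : ℕ => (1 + ε) ^ k * (|α k - a| + |β k - b|)) :
    ∃ ρ : ℝ, 1 < ρ ∧ ∃ u : ℕ → ℂ → ℂ,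
      (∀ k, DifferentiableOn ℂ (u k) (Metric.ball 0 ρ)) ∧
      (∀ θ ∈ Metric.ball (0 : ℂ) ρ, Tendsto (fun k => u k θ) atTop (𝓝 1)) ∧
      ∀ θ ∈ Metric.ball (0 : ℂ) ρ, ∀ k, (β k : ℂ) * u k θ =
        (((α (k + 1) : ℂ) - a) * θ + b * θ ^ 2 + b) * u (k + 1) θ -
          (β (k + 1) : ℂ) * θ ^ 2 * u (k + 2) θ := by
  set r := 1 + ε with hr
  have hr1 : 1 < r := by linarith
  have hr0 : 0 < r := by linarith
  set w : ℕ → ℝ := fun k => r ^ k * (|α k - a| + |β k - b|) with hw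
  have hw0 : ∀ k, 0 ≤ w k := fun k => by positivity
  -- The factor `r` bounds both `|θ|` and `|θ|²` on the disk of radius `√r`, and it makes `r ^ k * η
  -- k` equal to `w (k + 1) + w k`, hence summable.
  set η : ℕ → ℝ := fun k => r * (|α (k + 1) - a| + |β (k + 1) - b|) + (|α k - a| + |β k - b|)
    with hηdef
  have hη : ∀ k, 0 ≤ η k := fun k => by positivity
  have hrη : ∀ k, r ^ k * η k = w (k + 1) + w k := fun k => by
    change r ^ k * (r * (|α (k + 1) - a| + |β (k + 1) - b|) + (|α k - a| + |β k - b|)) =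
      r ^ (k + 1) * (|α (k + 1) - a| + |β (k + 1) - b|) + r ^ k * (|α k - a| + |β k - b|)
    ring
  have hsη : Summable fun k => r ^ k * η k := by
    simp only [hrη]
    exact ((summable_nat_add_iff 1).2 hs).add hs
  have hpow1 : ∀ k, 1 ≤ r ^ k := fun k => one_le_pow₀ hr1.le
  have hβlim : Tendsto β atTop (𝓝 b) := by
    rw [tendsto_iff_norm_sub_tendsto_zero]
    refine squeeze_zero (fun _ => norm_nonneg _) (fun k => ?_) hs.tendsto_atTop_zero
    rw [Real.norm_eq_abs]
    have := mul_le_mul_of_nonneg_right (hpow1 k) (by positivity : 0 ≤ |α k - a| + |β k - b|)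
    have := abs_nonneg (α k - a)
    linarith
  obtain ⟨K, hK⟩ : ∃ K, ∀ k, (β k)⁻¹ ≤ K := by
    obtain ⟨K, hK⟩ := (hβlim.inv₀ hb.ne').bddAbove_range
    exact ⟨K, fun k => hK ⟨k, rfl⟩⟩
  have hK0 : 0 ≤ K := (inv_nonneg.2 (hβ 0).le).trans (hK 0)
  have hsh : Summable fun k => K * (r ^ k)⁻¹ + r ^ k * η k := by
    refine Summable.add (Summable.mul_left _ ?_) hsη
    simpa using summable_geometric_of_lt_one (inv_nonneg.2 hr0.le) (inv_lt_one_of_one_lt₀ hr1)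
  have hsh0 : ∀ k, 0 ≤ K * (r ^ k)⁻¹ + r ^ k * η k := fun k => by
    have := hη k; positivity
  set M := Real.exp (∑' k, (K * (r ^ k)⁻¹ + r ^ k * η k)) * (K + 1) with hM
  have hM0 : 0 ≤ M := by positivity
  set ρ := Real.sqrt r with hρ
  have hρ1 : 1 < ρ := by rw [hρ]; exact Real.lt_sqrt_of_sq_lt (by simpa using hr1)
  have hball : ∀ θ ∈ Metric.ball (0 : ℂ) ρ, ‖θ‖ ^ 2 ≤ r := fun θ hθ => by
    rw [mem_ball_zero_iff] at hθ
    calc ‖θ‖ ^ 2 ≤ ρ ^ 2 := by gcongr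
      _ = r := Real.sq_sqrt hr0.le
  have hpert : ∀ θ ∈ Metric.ball (0 : ℂ) ρ, ∀ k, ‖pert α β a b θ k‖ ≤ η k := fun θ hθ k => by
    have h2 := hball θ hθ
    have h1 : ‖θ‖ ≤ r := by nlinarith [sq_nonneg (‖θ‖ - 1), norm_nonneg θ]
    have e1 : ‖(α (k + 1) : ℂ) - a‖ = |α (k + 1) - a| := by
      rw [← Complex.ofReal_sub, Complex.norm_real, Real.norm_eq_abs]
    have e2 : ∀ j, ‖(b : ℂ) - β j‖ = |β j - b| := fun j => by
      rw [← Complex.ofReal_sub, Complex.norm_real, Real.norm_eq_abs, abs_sub_comm]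
    calc ‖pert α β a b θ k‖ ≤ ‖((α (k + 1) : ℂ) - a) * θ‖ + ‖((b : ℂ) - β (k + 1)) * θ ^ 2‖ +
          ‖(b : ℂ) - β k‖ := norm_add₃_le
      _ ≤ |α (k + 1) - a| * r + |β (k + 1) - b| * r + |β k - b| := by
        rw [norm_mul, norm_mul, norm_pow, e1, e2, e2]; gcongr
      _ ≤ η k := by
        have := abs_nonneg (α k - a)
        simp only [hηdef]; linarith
  have hbound : ∀ θ ∈ Metric.ball (0 : ℂ) ρ, ∀ m k,
      ‖(approx α β a b θ (m + 1) k).1 - (approx α β a b θ m k).1‖ ≤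
        M * (r ^ (m + k) * η (m + k)) := fun θ hθ m k => by
    have h := norm_approx_sub_le hr0 hK0 hη (hball θ hθ) hβ hK (hpert θ hθ) m k
    have hnn : 0 ≤ r ^ k * ‖(approx α β a b θ (m + 1) k).2 - (approx α β a b θ m k).2‖ := by
      positivity
    refine (le_trans (by linarith) h).trans ?_
    rw [hM, add_comm k m, mul_assoc]
    have h1 : ∑ i ∈ Finset.range m, (K * (r ^ (k + i))⁻¹ + r ^ (k + i) * η (k + i)) ≤
        ∑' k, (K * (r ^ k)⁻¹ + r ^ k * η k) := by
      have := hsh.sum_le_tsum (Finset.image (fun i => k + i) (Finset.range m))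
        (fun i _ => hsh0 i)
      rwa [Finset.sum_image (fun x _ y _ h => by simpa using h)] at this
    have h2 := hη (m + k)
    have h3 : K * η (m + k) + r ^ (m + k) * η (m + k) ≤ (K + 1) * (r ^ (m + k) * η (m + k)) := by
      have : η (m + k) ≤ r ^ (m + k) * η (m + k) := le_mul_of_one_le_left h2 (hpow1 _)
      nlinarith
    gcongr
  have hsum : ∀ k, Summable fun m => M * (r ^ (m + k) * η (m + k)) := fun k =>
    ((summable_nat_add_iff k).2 hsη).mul_left M
  -- A telescoping series for the limit of the approximations. Its majorant is independent of `θ`,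
  -- which gives analyticity; for level `k` it is the tail from index `k` of one fixed convergent
  -- series, which gives the limit 1.
  set u : ℕ → ℂ → ℂ := fun k θ =>
    1 + ∑' m, ((approx α β a b θ (m + 1) k).1 - (approx α β a b θ m k).1) with hu
  have hulim : ∀ θ ∈ Metric.ball (0 : ℂ) ρ, ∀ k,
      Tendsto (fun m => (approx α β a b θ m k).1) atTop (𝓝 (u k θ)) := fun θ hθ k => by
    have h := (Summable.of_norm_bounded (hsum k) (hbound θ hθ · k)).hasSum.tendsto_sum_nat
    have h' := h.const_add (1 : ℂ)
    refine h'.congr fun m => ?_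
    rw [Finset.sum_range_sub (fun m => (approx α β a b θ m k).1)]
    simp [approx]
  refine ⟨ρ, hρ1, u, fun k => ?_, fun θ hθ => ?_, fun θ hθ k => ?_⟩
  · refine (differentiableOn_const _).add ?_
    exact Complex.differentiableOn_tsum_of_summable_norm (hsum k)
      (fun m => ((differentiable_approx (m + 1) k).1.sub
        (differentiable_approx m k).1).differentiableOn)
      Metric.isOpen_ball (fun m θ hθ => hbound θ hθ m k)
  · have ht : Tendsto (fun k => ∑' m, M * (r ^ (m + k) * η (m + k))) atTop (𝓝 0) :=
      tendsto_sum_nat_add fun j => M * (r ^ j * η j)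
    rw [tendsto_iff_norm_sub_tendsto_zero]
    refine squeeze_zero (fun _ => norm_nonneg _) (fun k => ?_) ht
    simp only [hu, add_sub_cancel_left]
    exact tsum_of_norm_bounded (hsum k).hasSum (hbound θ hθ · k)
  · have h0 := ((hulim θ hθ k).comp (tendsto_add_atTop_nat 2)).const_mul (β k : ℂ)
    have h1 := ((hulim θ hθ (k + 1)).comp (tendsto_add_atTop_nat 1)).const_mul
      (((α (k + 1) : ℂ) - a) * θ + b * θ ^ 2 + b)
    have h2 := (hulim θ hθ (k + 2)).const_mul ((β (k + 1) : ℂ) * θ ^ 2)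
    exact tendsto_nhds_unique h0
      ((h1.sub h2).congr fun m => (approx_recurrence hβ θ m k).symm)

end JacobiTail

/-! ### The branch `θ_σ` and its continuity on the closed disk. -/

namespace WebSystem

variable {𝒜 C : Type*} (S : WebSystem 𝒜 C)

lemma band_bounds (σ : C) :
    S.a - 2 * S.b ≤ S.aLim σ - 2 * S.bLim σ ∧ S.aLim σ + 2 * S.bLim σ ≤ S.a + 2 * S.b := by
  have h := S.bLim_pos σ
  refine (Set.Icc_subset_Icc_iff (by linarith)).1 ?_
  rw [← S.bands_eq]
  exact Set.subset_iUnion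
    (fun σ => Set.Icc (S.aLim σ - 2 * S.bLim σ) (S.aLim σ + 2 * S.bLim σ)) σ

lemma b_pos (σ : C) : 0 < S.b := by
  have h := S.bLim_pos σ
  have := S.band_bounds σ
  linarith [this.1, this.2]

lemma bC_pos (σ : C) (k : ℕ) : 0 < S.bC σ k := by
  have := S.chan_neg σ k
  rw [bC]; linarith

lemma add_inv_im (θ : ℂ) : (θ + θ⁻¹).im = -(θ.im * ((‖θ‖ ^ 2)⁻¹ - 1)) := by
  rw [Complex.add_im, Complex.inv_im, Complex.normSq_eq_norm_sq]
  ring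

lemma W_im (ω : ℂ) : (S.W ω).im = S.b * (ω.im * ((‖ω‖ ^ 2)⁻¹ - 1)) := by
  rw [W, Complex.sub_im, Complex.im_ofReal_mul, add_inv_im]; simp

lemma Wc_im (σ : C) (θ : ℂ) : (S.Wc σ θ).im = S.bLim σ * (θ.im * ((‖θ‖ ^ 2)⁻¹ - 1)) := by
  rw [Wc, Complex.sub_im, Complex.im_ofReal_mul, add_inv_im]; simp

lemma eq_or_mul_eq_one_of_add_inv_eq {x y : ℂ} (hx : x ≠ 0) (hy : y ≠ 0)
    (h : x + x⁻¹ = y + y⁻¹) : x = y ∨ x * y = 1 := by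
  have : (x - y) * (x * y - 1) = 0 := by
    field_simp at h
    linear_combination h
  rcases mul_eq_zero.1 this with h | h
  · exact Or.inl (sub_eq_zero.1 h)
  · exact Or.inr (sub_eq_zero.1 h)

lemma inv_eq_conj_of_norm_eq_one {θ : ℂ} (h : ‖θ‖ = 1) : θ⁻¹ = (starRingEnd ℂ) θ := by
  rw [Complex.inv_def, Complex.normSq_eq_norm_sq, h]; simp

lemma inv_norm_sq_sub_one_pos {θ : ℂ} (h0 : θ ≠ 0) (h : ‖θ‖ < 1) : 0 < (‖θ‖ ^ 2)⁻¹ - 1 := by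
  have h1 : 0 < ‖θ‖ := norm_pos_iff.2 h0
  have h2 : ‖θ‖ ^ 2 < 1 := by nlinarith
  have := (one_lt_inv₀ (by positivity)).2 h2
  linarith

lemma inv_norm_sq_sub_one_nonneg {θ : ℂ} (h0 : θ ≠ 0) (h : ‖θ‖ ≤ 1) :
    0 ≤ (‖θ‖ ^ 2)⁻¹ - 1 := by
  have h1 : 0 < ‖θ‖ := norm_pos_iff.2 h0
  have h2 : ‖θ‖ ^ 2 ≤ 1 := by nlinarith
  have := (one_le_inv₀ (by positivity)).2 h2
  linarith

lemma Wc_inj_iff (σ : C) (θ θ' : ℂ) : S.Wc σ θ = S.Wc σ θ' ↔ θ + θ⁻¹ = θ' + θ'⁻¹ := by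
  have h : (S.bLim σ : ℂ) ≠ 0 := by exact_mod_cast (S.bLim_pos σ).ne'
  simp [Wc, h]

lemma Wc_inv (σ : C) (θ : ℂ) : S.Wc σ θ⁻¹ = S.Wc σ θ := by
  rw [Wc_inj_iff, inv_inv, add_comm]

/-- On the real part of the closed disk the map `W` takes values outside the interior of `I`. -/
lemma not_mem_interior_of_im_eq_zero {ω : ℂ} (h0 : ω ≠ 0) (h : ω.im = 0) (hb : 0 < S.b) :
    (S.W ω).re ≤ S.a - 2 * S.b ∨ S.a + 2 * S.b ≤ (S.W ω).re := by
  obtain ⟨x, rfl⟩ : ∃ x : ℝ, ω = x := ⟨ω.re, Complex.ext rfl (by simpa using h)⟩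
  have hx : x ≠ 0 := by exact_mod_cast h0
  have : (S.W x).re = S.a - S.b * (x + x⁻¹) := by
    rw [W, ← Complex.ofReal_inv, ← Complex.ofReal_add, ← Complex.ofReal_mul,
      ← Complex.ofReal_sub, Complex.ofReal_re]
  rw [this]
  rcases lt_or_gt_of_ne hx with hx | hx
  · right
    have : x + x⁻¹ ≤ -2 := by
      have h1 : x + x⁻¹ + 2 = (x + 1) ^ 2 * x⁻¹ := by field_simp; ring
      have h2 : (x + 1) ^ 2 * x⁻¹ ≤ 0 :=
        mul_nonpos_of_nonneg_of_nonpos (sq_nonneg _) (inv_nonpos.2 hx.le)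
      linarith
    nlinarith
  · left
    have : 2 ≤ x + x⁻¹ := by
      have h1 : x + x⁻¹ - 2 = (x - 1) ^ 2 * x⁻¹ := by field_simp; ring
      have h2 : 0 ≤ (x - 1) ^ 2 * x⁻¹ := by positivity
      linarith
    nlinarith

/-- Uniqueness of the value of `θ_σ`. -/
lemma theta_unique (σ : C) {ω θ θ' : ℂ} (hω : ω ≠ 0)
    (h0 : θ ≠ 0) (h1 : ‖θ‖ ≤ 1) (hW : S.Wc σ θ = S.W ω) (hs : 0 ≤ θ.im * ω.im)
    (h0' : θ' ≠ 0) (h1' : ‖θ'‖ ≤ 1) (hW' : S.Wc σ θ' = S.W ω) (hs' : 0 ≤ θ'.im * ω.im) :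
    θ = θ' := by
  rcases eq_or_mul_eq_one_of_add_inv_eq h0 h0' ((S.Wc_inj_iff σ _ _).1 (hW.trans hW'.symm)) with
    h | h
  · exact h
  have hn : ‖θ‖ * ‖θ'‖ = 1 := by rw [← norm_mul, h, norm_one]
  have hn1 : ‖θ‖ = 1 := by nlinarith [norm_nonneg θ, norm_nonneg θ']
  have hθ' : θ' = (starRingEnd ℂ) θ := by
    rw [← inv_eq_conj_of_norm_eq_one hn1]
    exact eq_inv_of_mul_eq_one_right h
  by_cases him : θ.im = 0
  · rw [hθ', Complex.conj_eq_iff_im.2 him]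
  -- The remaining case is a nonreal conjugate pair on the circle. The two sign conditions force `ω`
  -- to be real, so `W(ω)` avoids the interior of `I`; but a nonreal `θ` on the circle puts `W_σ(θ)`
  -- strictly inside the band of `σ`.
  exfalso
  rw [hθ', Complex.conj_im] at hs'
  have hωim : ω.im = 0 := by
    have : θ.im * ω.im = 0 := by linarith
    exact (mul_eq_zero.1 this).resolve_left him
  have hre : (S.W ω).re = S.aLim σ - 2 * S.bLim σ * θ.re := by
    rw [← hW, Wc, inv_eq_conj_of_norm_eq_one hn1, Complex.add_conj]
    simp; ring
  have hsq : θ.re ^ 2 + θ.im ^ 2 = 1 := by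
    have := Complex.sq_norm θ
    rw [hn1, Complex.normSq_apply] at this
    nlinarith
  have him2 : 0 < θ.im ^ 2 := by positivity
  have hb := S.bLim_pos σ
  obtain ⟨h3, h4⟩ := S.band_bounds σ
  have h5 : θ.re < 1 := by nlinarith
  have h6 : -1 < θ.re := by nlinarith
  rcases S.not_mem_interior_of_im_eq_zero hω hωim (S.b_pos σ) with h | h <;> nlinarith

/-- The two solutions are the roots of `x² - t x + 1`; their product is one, so one of them lies in
the closed disk. Strictly inside, comparing imaginary parts of `W_σ(θ)` and `W(ω)` yields the sign
condition; on the circle it is arranged by passing to the conjugate root if necessary. -/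
lemma exists_theta (σ : C) {ω : ℂ} (hω : ω ≠ 0) (hω1 : ‖ω‖ ≤ 1) :
    ∃ θ : ℂ, θ ≠ 0 ∧ ‖θ‖ ≤ 1 ∧ S.Wc σ θ = S.W ω ∧ 0 ≤ θ.im * ω.im := by
  have hb : (S.bLim σ : ℂ) ≠ 0 := by exact_mod_cast (S.bLim_pos σ).ne'
  set t : ℂ := ((S.aLim σ : ℂ) - S.W ω) / S.bLim σ with ht
  obtain ⟨d, hd⟩ := IsAlgClosed.exists_pow_nat_eq (t ^ 2 - 4) two_pos
  have hprod : (t + d) / 2 * ((t - d) / 2) = 1 := by linear_combination -hd / 4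
  have key : ∀ x y : ℂ, x * y = 1 → x + y = t → x ≠ 0 ∧ S.Wc σ x = S.W ω := by
    intro x y hxy hs
    have hx : x ≠ 0 := left_ne_zero_of_mul_eq_one hxy
    refine ⟨hx, ?_⟩
    rw [Wc, ← eq_inv_of_mul_eq_one_right hxy, hs, ht]
    field_simp
    ring
  have h1 : ∃ θ : ℂ, θ ≠ 0 ∧ ‖θ‖ ≤ 1 ∧ S.Wc σ θ = S.W ω := by
    have hn : ‖(t + d) / 2‖ * ‖(t - d) / 2‖ = 1 := by rw [← norm_mul, hprod, norm_one]
    rcases le_total ‖(t + d) / 2‖ 1 with h | h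
    · obtain ⟨h3, h4⟩ := key _ _ hprod (by ring)
      exact ⟨_, h3, h, h4⟩
    · obtain ⟨h3, h4⟩ := key _ _ ((mul_comm _ _).trans hprod) (by ring)
      exact ⟨_, h3, by nlinarith [norm_nonneg ((t - d) / 2)], h4⟩
  obtain ⟨θ, h0, hle, hW⟩ := h1
  rcases hle.lt_or_eq with hlt | heq
  · refine ⟨θ, h0, hle, hW, ?_⟩
    have him := congrArg Complex.im hW
    rw [Wc_im, W_im] at him
    have p1 := inv_norm_sq_sub_one_pos h0 hlt
    have p2 := inv_norm_sq_sub_one_nonneg hω hω1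
    have p3 := S.bLim_pos σ
    have p4 := S.b_pos σ
    by_contra! hneg
    have h5 : 0 < S.bLim σ * ((‖θ‖ ^ 2)⁻¹ - 1) := by positivity
    have h6 : 0 ≤ S.b * ((‖ω‖ ^ 2)⁻¹ - 1) := by positivity
    have h7 : S.bLim σ * ((‖θ‖ ^ 2)⁻¹ - 1) * (θ.im * ω.im) =
        S.b * ((‖ω‖ ^ 2)⁻¹ - 1) * ω.im ^ 2 := by linear_combination ω.im * him
    have h8 : 0 ≤ S.b * ((‖ω‖ ^ 2)⁻¹ - 1) * ω.im ^ 2 := by positivity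
    have h9 := mul_neg_of_pos_of_neg h5 hneg
    linarith
  · rcases le_total 0 (θ.im * ω.im) with h | h
    · exact ⟨θ, h0, hle, hW, h⟩
    · refine ⟨θ⁻¹, inv_ne_zero h0, by simp [heq], by rw [Wc_inv, hW], ?_⟩
      rw [inv_eq_conj_of_norm_eq_one heq, Complex.conj_im]
      linarith

lemma theta_spec (σ : C) {ω : ℂ} (hω : ω ≠ 0) (hω1 : ‖ω‖ ≤ 1) :
    S.theta σ ω ≠ 0 ∧ ‖S.theta σ ω‖ ≤ 1 ∧ S.Wc σ (S.theta σ ω) = S.W ω ∧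
      0 ≤ (S.theta σ ω).im * ω.im := by
  rw [theta, if_neg hω]
  exact Classical.epsilon_spec (S.exists_theta σ hω hω1)

@[simp] lemma theta_zero (σ : C) : S.theta σ 0 = 0 := by simp [theta]

/-- The polynomial form of the equation `W_σ(θ) = W(ω)`. -/
lemma theta_poly (σ : C) {ω : ℂ} (hω1 : ‖ω‖ ≤ 1) :
    ((S.aLim σ : ℂ) * S.theta σ ω - S.bLim σ * (S.theta σ ω ^ 2 + 1)) * ω =
      ((S.a : ℂ) * ω - S.b * (ω ^ 2 + 1)) * S.theta σ ω := by
  by_cases hω : ω = 0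
  · subst hω; simp
  obtain ⟨h0, -, hW, -⟩ := S.theta_spec σ hω hω1
  rw [Wc, W] at hW
  field_simp at hW
  linear_combination hW

/-- A closed-graph argument in a compact disk: every cluster value satisfies the polynomial relation
and the sign condition, and these determine it. The polynomial form also covers the origin, where it
degenerates to `b y = 0`. -/
lemma continuousOn_theta (σ : C) : ContinuousOn (S.theta σ) (Metric.closedBall 0 1) := by
  intro ω₀ hω₀
  have hω₀' : ‖ω₀‖ ≤ 1 := by simpa using hω₀
  have hmem : ∀ ω ∈ Metric.closedBall (0 : ℂ) 1, ‖S.theta σ ω‖ ≤ 1 ∧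
      0 ≤ (S.theta σ ω).im * ω.im := by
    intro ω hω
    by_cases h : ω = 0
    · subst h; simp
    · have := S.theta_spec σ h (by simpa using hω)
      exact ⟨this.2.1, this.2.2.2⟩
  refine (isCompact_closedBall (0 : ℂ) 1).tendsto_nhds_of_unique_mapClusterPt ?_ ?_
  · filter_upwards [self_mem_nhdsWithin] with ω hω
    simpa using (hmem ω hω).1
  · intro y hy hcl
    have hy1 : ‖y‖ ≤ 1 := by simpa using hy
    set R : Set (ℂ × ℂ) := {p | ((S.aLim σ : ℂ) * p.2 - S.bLim σ * (p.2 ^ 2 + 1)) * p.1 =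
      ((S.a : ℂ) * p.1 - S.b * (p.1 ^ 2 + 1)) * p.2 ∧ 0 ≤ p.2.im * p.1.im} with hR
    have hRc : IsClosed R :=
      (isClosed_eq (by fun_prop) (by fun_prop)).inter
        (isClosed_le continuous_const ((Complex.continuous_im.comp continuous_snd).mul
          (Complex.continuous_im.comp continuous_fst)))
    have hyR : (ω₀, y) ∈ R := by
      refine hRc.mem_of_mapClusterPt (f := fun ω => (ω, S.theta σ ω))
        (b := 𝓝[Metric.closedBall 0 1] ω₀) ?_ ?_
      · rw [mapClusterPt_iff_ultrafilter] at hcl ⊢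
        obtain ⟨U, hU, hUt⟩ := hcl
        have hU' : Tendsto (fun ω : ℂ => ω) U (𝓝 ω₀) := tendsto_id'.2 (hU.trans inf_le_left)
        exact ⟨U, hU, hU'.prodMk_nhds hUt⟩
      · filter_upwards [self_mem_nhdsWithin] with ω hω
        exact ⟨S.theta_poly σ (by simpa using hω), (hmem ω hω).2⟩
    obtain ⟨hpoly, hsign⟩ := hyR
    simp only at hpoly hsign
    have hb : (S.bLim σ : ℂ) ≠ 0 := by exact_mod_cast (S.bLim_pos σ).ne'
    have hb' : (S.b : ℂ) ≠ 0 := by exact_mod_cast (S.b_pos σ).ne'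
    by_cases hω : ω₀ = 0
    · subst hω
      simpa [hb'] using hpoly
    · have hy0 : y ≠ 0 := by
        rintro rfl
        simp [hb, hω] at hpoly
      obtain ⟨h0, h1, hW, hs⟩ := S.theta_spec σ hω hω₀'
      refine S.theta_unique σ hω hy0 hy1 ?_ hsign h0 h1 hW hs
      rw [Wc, W]
      field_simp
      linear_combination hpoly

lemma W_im_ne_zero (σ : C) {ω : ℂ} (hω1 : ‖ω‖ < 1) (him : ω.im ≠ 0) : (S.W ω).im ≠ 0 := by
  have h0 : ω ≠ 0 := by rintro rfl; simp at him
  rw [W_im]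
  exact mul_ne_zero (S.b_pos σ).ne' (mul_ne_zero him (inv_norm_sq_sub_one_pos h0 hω1).ne')

lemma norm_theta_lt_one_of_W_im_ne_zero (σ : C) {ω : ℂ} (h0 : ω ≠ 0) (hω1 : ‖ω‖ ≤ 1)
    (him : (S.W ω).im ≠ 0) : ‖S.theta σ ω‖ < 1 := by
  obtain ⟨-, h1, hW, -⟩ := S.theta_spec σ h0 hω1
  refine lt_of_le_of_ne h1 fun h => him ?_
  rw [← hW, Wc_im, h]; simp

lemma continuousAt_W {ω : ℂ} (h : ω ≠ 0) : ContinuousAt S.W ω := by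
  unfold W
  exact continuousAt_const.sub (continuousAt_const.mul (continuousAt_id.add (continuousAt_inv₀ h)))

end WebSystem

/-! ### Solutions of the channel equation: Wronskians, Jost solutions, growth. -/

lemma tendsto_zero_of_eventually_le_mul_add {x d : ℕ → ℝ} {q : ℝ} (hq0 : 0 ≤ q) (hq1 : q < 1)
    (hx : ∀ k, 0 ≤ x k) (hd : Tendsto d atTop (𝓝 0))
    (h : ∀ᶠ k in atTop, x (k + 1) ≤ q * x k + d k) : Tendsto x atTop (𝓝 0) := by
  rw [Metric.tendsto_atTop]
  intro ε hε
  have hd' : ∀ᶠ k in atTop, d k < (1 - q) * (ε / 2) :=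
    hd.eventually_lt_const (mul_pos (by linarith) (by linarith))
  obtain ⟨N, hN⟩ := eventually_atTop.1 (h.and hd')
  have hstep : ∀ n, x (N + n) - ε / 2 ≤ q ^ n * x N := by
    intro n
    induction n with
    | zero => simp; linarith
    | succ n ih =>
      obtain ⟨h1, h2⟩ := hN (N + n) (by omega)
      have := mul_le_mul_of_nonneg_left ih hq0
      rw [← add_assoc, pow_succ]
      nlinarith
  have hpow : Tendsto (fun n => q ^ n * x N) atTop (𝓝 0) := by
    simpa using (tendsto_pow_atTop_nhds_zero_of_lt_one hq0 hq1).mul_const (x N)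
  obtain ⟨n₀, hn₀⟩ := eventually_atTop.1 (hpow.eventually_lt_const (half_pos hε))
  refine ⟨N + n₀, fun k hk => ?_⟩
  have h1 := hstep (k - N)
  have h2 := hn₀ (k - N) (by omega)
  rw [show N + (k - N) = k by omega] at h1
  rw [Real.dist_eq, sub_zero, abs_of_nonneg (hx k)]
  linarith

/-- Solutions of a first order recursion with contracting limit coefficient converge. -/
lemma tendsto_one_of_recursion {y p d : ℕ → ℂ} {q : ℂ} (hq : ‖q‖ < 1)
    (hp : Tendsto p atTop (𝓝 q)) (hd : Tendsto d atTop (𝓝 (1 - q)))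
    (h : ∀ᶠ k in atTop, y (k + 1) = p k * y k + d k) : Tendsto y atTop (𝓝 1) := by
  obtain ⟨r, hr1, hr2⟩ := exists_between hq
  rw [tendsto_iff_norm_sub_tendsto_zero]
  have hd' : Tendsto (fun k => ‖p k - 1 + d k‖) atTop (𝓝 0) := by
    have := ((hp.sub_const 1).add hd).norm
    simpa using this
  refine tendsto_zero_of_eventually_le_mul_add ((norm_nonneg q).trans hr1.le) hr2
    (fun _ => norm_nonneg _) hd' ?_
  filter_upwards [h, hp.norm.eventually_le_const hr1] with k hk hpk
  calc ‖y (k + 1) - 1‖ = ‖p k * (y k - 1) + (p k - 1 + d k)‖ := by rw [hk]; congr 1; ring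
    _ ≤ ‖p k‖ * ‖y k - 1‖ + ‖p k - 1 + d k‖ := by
      rw [← norm_mul]; exact norm_add_le _ _
    _ ≤ _ := by gcongr

namespace WebSystem

variable {𝒜 C : Type*} (S : WebSystem 𝒜 C)

lemma bC_ne_zero (σ : C) (k : ℕ) : (S.bC σ k : ℂ) ≠ 0 := by
  exact_mod_cast (S.bC_pos σ k).ne'

lemma bLim_ne_zero (σ : C) : (S.bLim σ : ℂ) ≠ 0 := by
  exact_mod_cast (S.bLim_pos σ).ne'

lemma tendsto_bC (σ : C) : Tendsto (fun k => (S.bC σ k : ℂ)) atTop (𝓝 (S.bLim σ : ℂ)) := by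
  obtain ⟨ε, hε, hs⟩ := S.decay σ
  refine (Complex.continuous_ofReal.tendsto _).comp ?_
  rw [tendsto_iff_norm_sub_tendsto_zero]
  refine squeeze_zero (fun _ => norm_nonneg _) (fun k => ?_) hs.tendsto_atTop_zero
  rw [Real.norm_eq_abs]
  have h1 : 1 ≤ (1 + ε) ^ k := one_le_pow₀ (by linarith)
  have := mul_le_mul_of_nonneg_right h1 (by positivity :
    0 ≤ |S.L (S.chan σ k) (S.chan σ k) - S.aLim σ| +
      |-S.L (S.chan σ k) (S.chan σ (k + 1)) - S.bLim σ|)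
  have := abs_nonneg (S.L (S.chan σ k) (S.chan σ k) - S.aLim σ)
  rw [bC]
  linarith

namespace SolvesChannel

variable {S} {σ : C} {z : ℂ} {x y : ℕ → ℂ}

lemma sub_mul (hx : S.SolvesChannel σ z x) (hy : S.SolvesChannel σ z y) (c : ℂ) :
    S.SolvesChannel σ z (fun k => x k - c * y k) := fun k => by
  linear_combination hx k - c * hy k

lemma eq_zero (hx : S.SolvesChannel σ z x) (h0 : x 0 = 0) (h1 : x 1 = 0) (k : ℕ) : x k = 0 := by
  have : ∀ k, x k = 0 ∧ x (k + 1) = 0 := by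
    intro k
    induction k with
    | zero => exact ⟨h0, h1⟩
    | succ k ih =>
      refine ⟨ih.2, ?_⟩
      have := hx k
      rw [ih.1, ih.2] at this
      simpa [S.bC_ne_zero] using this
  exact (this k).1

lemma tendsto_of_eventually {l : Filter ℂ} [l.NeBot] {X : ℂ → ℕ → ℂ} {Z : ℂ → ℂ}
    (hX : ∀ᶠ ω in l, S.SolvesChannel σ (Z ω) (X ω)) (hZ : Tendsto Z l (𝓝 z))
    (hx : ∀ k, Tendsto (fun ω => X ω k) l (𝓝 (x k))) : S.SolvesChannel σ z x := by
  intro k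
  have h1 := (((hx k).const_mul (-(S.bC σ k : ℂ))).add
    ((hx (k + 1)).const_mul (S.aC σ (k + 1) : ℂ))).sub
      ((hx (k + 2)).const_mul (S.bC σ (k + 1) : ℂ))
  refine tendsto_nhds_unique_of_eventuallyEq h1 (hZ.mul (hx (k + 1))) ?_
  filter_upwards [hX] with ω hω using hω k

/-- The Wronskian of two solutions is constant. -/
lemma wronskian (hx : S.SolvesChannel σ z x) (hy : S.SolvesChannel σ z y) (k : ℕ) :
    (S.bC σ k : ℂ) * (x k * y (k + 1) - x (k + 1) * y k) =
      (S.bC σ 0 : ℂ) * (x 0 * y 1 - x 1 * y 0) := by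
  induction k with
  | zero => rfl
  | succ k ih =>
    rw [← ih]
    linear_combination y (k + 1) * hx k - x (k + 1) * hy k

lemma exists_eq_mul (hx : S.SolvesChannel σ z x) (hy : S.SolvesChannel σ z y)
    (hne : x 0 ≠ 0 ∨ x 1 ≠ 0) (h : x 0 * y 1 - x 1 * y 0 = 0) : ∃ c, ∀ k, y k = c * x k := by
  obtain ⟨c, h0, h1⟩ : ∃ c, y 0 - c * x 0 = 0 ∧ y 1 - c * x 1 = 0 := by
    rcases hne with h' | h'
    · refine ⟨y 0 / x 0, by field_simp; ring, ?_⟩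
      field_simp
      linear_combination h
    · refine ⟨y 1 / x 1, ?_, by field_simp; ring⟩
      field_simp
      linear_combination -h
  exact ⟨c, fun k => sub_eq_zero.1 ((hy.sub_mul hx c).eq_zero h0 h1 k)⟩

lemma ne_zero_of_tendsto {θ : ℂ} (hx : S.SolvesChannel σ z x)
    (h : Tendsto (fun k => x k / θ ^ k) atTop (𝓝 1)) : x 0 ≠ 0 ∨ x 1 ≠ 0 := by
  by_contra! hc
  have : (fun k => x k / θ ^ k) = fun _ => 0 := by
    ext k; rw [hx.eq_zero hc.1 hc.2 k, zero_div]
  rw [this] at h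
  exact zero_ne_one (tendsto_nhds_unique tendsto_const_nhds h)

end SolvesChannel

lemma exists_jostRadius (σ : C) :
    ∃ ρ : ℝ, 1 < ρ ∧ ∃ u : ℕ → ℂ → ℂ,
      (∀ k, DifferentiableOn ℂ (u k) (Metric.ball 0 ρ)) ∧
      (∀ θ ∈ Metric.ball (0 : ℂ) ρ, Tendsto (fun k => u k θ) atTop (𝓝 1)) ∧
      ∀ θ ∈ Metric.ball (0 : ℂ) ρ, ∀ k, (S.bC σ k : ℂ) * u k θ =
        (((S.aC σ (k + 1) : ℂ) - S.aLim σ) * θ + S.bLim σ * θ ^ 2 + S.bLim σ) * u (k + 1) θ -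
          (S.bC σ (k + 1) : ℂ) * θ ^ 2 * u (k + 2) θ := by
  obtain ⟨ε, hε, hs⟩ := S.decay σ
  exact JacobiTail.exists_normalized_jost (α := S.aC σ) (β := S.bC σ) (S.bC_pos σ)
    (S.bLim_pos σ) hε hs

/-- The radius of a disk, larger than the unit disk, in which the normalised Jost solution is
analytic. -/
def jostRadius (σ : C) : ℝ := (S.exists_jostRadius σ).choose

lemma one_lt_jostRadius (σ : C) : 1 < S.jostRadius σ := (S.exists_jostRadius σ).choose_spec.1

/-- The normalised Jost solution `θ ^ (-k) e_σ(k, θ)`, as an analytic function of `θ`. -/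
def jostU (σ : C) : ℕ → ℂ → ℂ := (S.exists_jostRadius σ).choose_spec.2.choose

lemma differentiableOn_jostU (σ : C) (k : ℕ) :
    DifferentiableOn ℂ (S.jostU σ k) (Metric.ball 0 (S.jostRadius σ)) :=
  (S.exists_jostRadius σ).choose_spec.2.choose_spec.1 k

lemma tendsto_jostU (σ : C) {θ : ℂ} (hθ : θ ∈ Metric.ball (0 : ℂ) (S.jostRadius σ)) :
    Tendsto (fun k => S.jostU σ k θ) atTop (𝓝 1) :=
  (S.exists_jostRadius σ).choose_spec.2.choose_spec.2.1 θ hθ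

lemma jostU_recurrence (σ : C) {θ : ℂ} (hθ : θ ∈ Metric.ball (0 : ℂ) (S.jostRadius σ)) (k : ℕ) :
    (S.bC σ k : ℂ) * S.jostU σ k θ =
      (((S.aC σ (k + 1) : ℂ) - S.aLim σ) * θ + S.bLim σ * θ ^ 2 + S.bLim σ) * S.jostU σ (k + 1) θ -
        (S.bC σ (k + 1) : ℂ) * θ ^ 2 * S.jostU σ (k + 2) θ :=
  (S.exists_jostRadius σ).choose_spec.2.choose_spec.2.2 θ hθ k

lemma mem_ball_jostRadius (σ : C) {θ : ℂ} (hθ : ‖θ‖ ≤ 1) :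
    θ ∈ Metric.ball (0 : ℂ) (S.jostRadius σ) := by
  simpa using hθ.trans_lt (S.one_lt_jostRadius σ)

lemma analyticAt_jostU (σ : C) (k : ℕ) {θ : ℂ} (hθ : ‖θ‖ ≤ 1) : AnalyticAt ℂ (S.jostU σ k) θ :=
  (S.differentiableOn_jostU σ k).analyticAt
    (Metric.isOpen_ball.mem_nhds (S.mem_ball_jostRadius σ hθ))

/-- At `θ = 0` the recurrence has only two terms, so a zero would propagate to all higher levels and
contradict the limit 1. This nonvanishing drives all the asymptotics at the origin. -/
lemma jostU_zero_ne_zero (σ : C) (k : ℕ) : S.jostU σ k 0 ≠ 0 := by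
  intro h
  have h0 : (0 : ℂ) ∈ Metric.ball (0 : ℂ) (S.jostRadius σ) := S.mem_ball_jostRadius σ (by simp)
  have hz : ∀ n, S.jostU σ (n + k) 0 = 0 := by
    intro n
    induction n with
    | zero => simpa using h
    | succ n ih =>
      have := S.jostU_recurrence σ h0 (n + k)
      rw [ih] at this
      have h1 : S.jostU σ (n + k + 1) 0 = 0 := by simpa [S.bLim_ne_zero] using this
      rwa [show n + 1 + k = n + k + 1 by ring]
  have := (S.tendsto_jostU σ h0).comp (tendsto_add_atTop_nat k)
  rw [show ((fun k => S.jostU σ k 0) ∘ fun a => a + k) = fun _ => 0 from funext hz] at this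
  exact zero_ne_one (tendsto_nhds_unique tendsto_const_nhds this)

lemma solvesChannel_jostU (σ : C) {θ : ℂ} (h0 : θ ≠ 0) (hθ : ‖θ‖ ≤ 1) :
    S.SolvesChannel σ (S.Wc σ θ) (fun k => θ ^ k * S.jostU σ k θ) := by
  intro k
  have := S.jostU_recurrence σ (S.mem_ball_jostRadius σ hθ) k
  rw [Wc]
  field_simp
  linear_combination -θ ^ (k + 1) * this

lemma tendsto_jostU_div (σ : C) {θ : ℂ} (h0 : θ ≠ 0) (hθ : ‖θ‖ ≤ 1) :
    Tendsto (fun k => θ ^ k * S.jostU σ k θ / θ ^ k) atTop (𝓝 1) := by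
  refine (S.tendsto_jostU σ (S.mem_ball_jostRadius σ hθ)).congr fun k => ?_
  rw [mul_div_cancel_left₀ _ (pow_ne_zero k h0)]

/-- The Wronskian of the two solutions is constant and tends to zero, because the normalised
sequences have the same limit and the powers of `θ` stay bounded. The solutions are therefore
proportional, and the normalisation fixes the factor; this covers the whole unit circle, including
`θ = ±1`. -/
lemma jost_unique {σ : C} {θ z : ℂ} {x y : ℕ → ℂ} (h0 : θ ≠ 0) (hθ : ‖θ‖ ≤ 1)
    (hx : S.SolvesChannel σ z x) (hy : S.SolvesChannel σ z y)
    (hxl : Tendsto (fun k => x k / θ ^ k) atTop (𝓝 1))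
    (hyl : Tendsto (fun k => y k / θ ^ k) atTop (𝓝 1)) : x = y := by
  set f : ℕ → ℂ := fun k => x k / θ ^ k with hf
  set g : ℕ → ℂ := fun k => y k / θ ^ k with hg
  have hxf : ∀ k, x k = f k * θ ^ k := fun k => (div_mul_cancel₀ _ (pow_ne_zero k h0)).symm
  have hyg : ∀ k, y k = g k * θ ^ k := fun k => (div_mul_cancel₀ _ (pow_ne_zero k h0)).symm
  have hw : Tendsto (fun k => (S.bC σ k : ℂ) * (x k * y (k + 1) - x (k + 1) * y k)) atTop
      (𝓝 0) := by
    have h1 : Tendsto (fun k => (S.bC σ k : ℂ) * (f k * g (k + 1) - f (k + 1) * g k)) atTop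
        (𝓝 0) := by
      have := (S.tendsto_bC σ).mul ((hxl.mul (hyl.comp (tendsto_add_atTop_nat 1))).sub
        ((hxl.comp (tendsto_add_atTop_nat 1)).mul hyl))
      simpa using this
    rw [tendsto_zero_iff_norm_tendsto_zero] at h1 ⊢
    refine squeeze_zero (fun _ => norm_nonneg _) (fun k => ?_) h1
    have : (S.bC σ k : ℂ) * (x k * y (k + 1) - x (k + 1) * y k) =
        (S.bC σ k : ℂ) * (f k * g (k + 1) - f (k + 1) * g k) * (θ ^ k * θ ^ (k + 1)) := by
      rw [hxf, hxf, hyg, hyg]; ring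
    rw [this, norm_mul]
    refine mul_le_of_le_one_right (norm_nonneg _) ?_
    rw [← pow_add, norm_pow]
    exact pow_le_one₀ (norm_nonneg _) hθ
  have hconst : x 0 * y 1 - x 1 * y 0 = 0 := by
    have h2 : (S.bC σ 0 : ℂ) * (x 0 * y 1 - x 1 * y 0) = 0 := by
      refine tendsto_nhds_unique ?_ hw
      exact tendsto_const_nhds.congr fun k => (hx.wronskian hy k).symm
    exact (mul_eq_zero.1 h2).resolve_left (S.bC_ne_zero σ 0)
  obtain ⟨c, hc⟩ := hx.exists_eq_mul hy (hx.ne_zero_of_tendsto hxl) hconst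
  have hc1 : c = 1 := by
    refine tendsto_nhds_unique (f := g) ?_ hyl
    have := hxl.const_mul c
    rw [mul_one] at this
    refine this.congr fun k => ?_
    simp only [hf, hg, hc k, mul_div_assoc]
  ext k
  rw [hc k, hc1, one_mul]

lemma jost_eq (σ : C) {θ : ℂ} (h0 : θ ≠ 0) (hθ : ‖θ‖ ≤ 1) (k : ℕ) :
    S.jost σ θ k = θ ^ k * S.jostU σ k θ := by
  have hex : ∃ x : ℕ → ℂ,
      S.SolvesChannel σ (S.Wc σ θ) x ∧ Tendsto (fun k => x k / θ ^ k) atTop (𝓝 1) :=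
    ⟨_, S.solvesChannel_jostU σ h0 hθ, S.tendsto_jostU_div σ h0 hθ⟩
  have h := Classical.epsilon_spec hex
  exact congrFun (S.jost_unique h0 hθ h.1 (S.solvesChannel_jostU σ h0 hθ) h.2
    (S.tendsto_jostU_div σ h0 hθ)) k

lemma jost_solves (σ : C) {θ : ℂ} (h0 : θ ≠ 0) (hθ : ‖θ‖ ≤ 1) :
    S.SolvesChannel σ (S.Wc σ θ) (S.jost σ θ) := by
  rw [show S.jost σ θ = _ from funext (S.jost_eq σ h0 hθ)]
  exact S.solvesChannel_jostU σ h0 hθ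

lemma tendsto_jost (σ : C) {θ : ℂ} (h0 : θ ≠ 0) (hθ : ‖θ‖ ≤ 1) :
    Tendsto (fun k => S.jost σ θ k / θ ^ k) atTop (𝓝 1) := by
  rw [show S.jost σ θ = _ from funext (S.jost_eq σ h0 hθ)]
  exact S.tendsto_jostU_div σ h0 hθ

lemma jost_ne_zero (σ : C) {θ : ℂ} (h0 : θ ≠ 0) (hθ : ‖θ‖ ≤ 1) :
    S.jost σ θ 0 ≠ 0 ∨ S.jost σ θ 1 ≠ 0 :=
  (S.jost_solves σ h0 hθ).ne_zero_of_tendsto (S.tendsto_jost σ h0 hθ)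

/-- On the unit circle a solution is determined up to a multiple of the Jost solution by its
Wronskian with the Jost solution. -/
lemma exists_eq_jost_inv_add {σ : C} {θ : ℂ} {x : ℕ → ℂ} (hθ : ‖θ‖ = 1)
    (hx : S.SolvesChannel σ (S.Wc σ θ) x)
    (hw : (S.bC σ 0 : ℂ) * (S.jost σ θ 0 * x 1 - S.jost σ θ 1 * x 0) =
      S.bLim σ * (θ⁻¹ - θ)) :
    ∃ s : ℂ, ∀ k, x k = S.jost σ θ⁻¹ k + s * S.jost σ θ k := by
  have h0 : θ ≠ 0 := by rintro rfl; simp at hθ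
  have hi : ‖θ⁻¹‖ ≤ 1 := by simp [hθ]
  have hy := S.jost_solves σ (inv_ne_zero h0) hi
  rw [Wc_inv] at hy
  have he := S.jost_solves σ h0 hθ.le
  -- The Wronskian of the Jost solutions for `θ` and `θ⁻¹` is evaluated at infinity. It agrees with
  -- the one prescribed for `x`, so `x` minus the Jost solution for `θ⁻¹` has zero Wronskian with
  -- that for `θ`.
  have hyl := S.tendsto_jost σ (inv_ne_zero h0) hi
  have hel := S.tendsto_jost σ h0 hθ.le
  have hwy : (S.bC σ 0 : ℂ) * (S.jost σ θ 0 * S.jost σ θ⁻¹ 1 - S.jost σ θ 1 * S.jost σ θ⁻¹ 0) =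
      S.bLim σ * (θ⁻¹ - θ) := by
    have h1 := (S.tendsto_bC σ).mul (((hel.mul
      (hyl.comp (tendsto_add_atTop_nat 1))).mul_const θ⁻¹).sub
        (((hel.comp (tendsto_add_atTop_nat 1)).mul hyl).mul_const θ))
    simp only [one_mul] at h1
    refine tendsto_nhds_unique ?_ h1
    refine tendsto_const_nhds.congr fun k => ?_
    rw [← he.wronskian hy k]
    simp only [Function.comp_apply, inv_pow, div_inv_eq_mul]
    congr 1
    field_simp
    ring
  have hd := hx.sub_mul hy 1
  obtain ⟨s, hs⟩ := he.exists_eq_mul hd (S.jost_ne_zero σ h0 hθ.le) (by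
    refine (mul_eq_zero.1 (?_ : (S.bC σ 0 : ℂ) * _ = 0)).resolve_left (S.bC_ne_zero σ 0)
    linear_combination hw - hwy)
  exact ⟨s, fun k => by linear_combination hs k⟩

/-- Inside the unit disk the Wronskian with the Jost solution determines the growth of a
solution. -/
lemma tendsto_div_of_wronskian {σ : C} {θ : ℂ} {x : ℕ → ℂ} (h0 : θ ≠ 0) (hθ : ‖θ‖ < 1)
    (hx : S.SolvesChannel σ (S.Wc σ θ) x)
    (hw : (S.bC σ 0 : ℂ) * (S.jost σ θ 0 * x 1 - S.jost σ θ 1 * x 0) =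
      S.bLim σ * (θ⁻¹ - θ)) :
    Tendsto (fun k => x k / θ⁻¹ ^ k) atTop (𝓝 1) := by
  have hu := S.tendsto_jostU σ (S.mem_ball_jostRadius σ hθ.le)
  have hu1 := hu.comp (tendsto_add_atTop_nat 1)
  have hq : ‖θ ^ 2‖ < 1 := by
    rw [norm_pow]
    exact pow_lt_one₀ (norm_nonneg _) hθ two_ne_zero
  -- In terms of `y k = θ ^ k * x k` the Wronskian identity is a first-order recursion. Its
  -- multiplier tends to `θ ^ 2`, a contraction, and its inhomogeneous term to `1 - θ ^ 2`, so the
  -- limiting fixed point is 1.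
  have hp : Tendsto (fun k => θ ^ 2 * (S.jostU σ (k + 1) θ / S.jostU σ k θ)) atTop
      (𝓝 (θ ^ 2)) := by
    have := (hu1.div hu one_ne_zero).const_mul (θ ^ 2)
    simpa using this
  have hd : Tendsto (fun k => θ * (S.bLim σ * (θ⁻¹ - θ)) / (S.bC σ k * S.jostU σ k θ)) atTop
      (𝓝 (1 - θ ^ 2)) := by
    have hb := S.bLim_ne_zero σ
    have := (((S.tendsto_bC σ).mul hu).inv₀ (by simpa using hb)).const_mul
      (θ * (S.bLim σ * (θ⁻¹ - θ)))
    rw [show 1 - θ ^ 2 = θ * (S.bLim σ * (θ⁻¹ - θ)) * ((S.bLim σ : ℂ) * 1)⁻¹ by field_simp]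
    simpa only [div_eq_mul_inv] using this
  refine tendsto_one_of_recursion hq hp hd ?_
  filter_upwards [hu.eventually_ne one_ne_zero] with k hk
  have h1 := (S.jost_solves σ h0 hθ.le).wronskian hx k
  rw [hw, S.jost_eq σ h0 hθ.le, S.jost_eq σ h0 hθ.le] at h1
  have hb := S.bC_ne_zero σ k
  rw [← h1]
  simp only [inv_pow, div_inv_eq_mul]
  field_simp
  ring

end WebSystem

/-! ### Local uniformisation in the closed disk. -/

/-- The punctured neighbourhood filter of a point in the closed unit disk. -/
abbrev diskPunctured (ω₀ : ℂ) : Filter ℂ := 𝓝[Metric.closedBall 0 1 \ {ω₀}] ω₀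

/-- Interior nonreal points are those where `W` is visibly nonreal and genericity can be proved
directly. That they accumulate everywhere is what later excludes identically vanishing determinants.
-/
lemma frequently_diskPunctured {ω₀ : ℂ} (h : ‖ω₀‖ ≤ 1) :
    ∃ᶠ ω in diskPunctured ω₀, ‖ω‖ < 1 ∧ ω.im ≠ 0 := by
  have hd : Dense ((Complex.im ⁻¹' {0}ᶜ) \ {ω₀}) :=
    ((dense_compl_singleton (0 : ℝ)).preimage Complex.isOpenMap_im).sdiff_singleton ω₀
  have hcl : ω₀ ∈ closure (Metric.ball (0 : ℂ) 1 ∩ ((Complex.im ⁻¹' {0}ᶜ) \ {ω₀})) := by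
    have h1 := closure_mono (hd.open_subset_closure_inter (Metric.isOpen_ball (x := (0 : ℂ))
      (ε := 1)))
    rw [closure_ball _ one_ne_zero, closure_closure] at h1
    exact h1 (by simpa using h)
  rw [mem_closure_iff_frequently] at hcl
  rw [diskPunctured, frequently_nhdsWithin_iff]
  refine hcl.mono fun ω hω => ?_
  obtain ⟨h1, h2, h3⟩ := hω
  have h1' : ‖ω‖ < 1 := by simpa using h1
  exact ⟨⟨h1', h2⟩, by simpa using h1'.le, h3⟩

lemma diskPunctured_neBot {ω₀ : ℂ} (h : ‖ω₀‖ ≤ 1) : (diskPunctured ω₀).NeBot :=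
  ⟨fun hb => by have := frequently_diskPunctured h; rw [hb] at this; simp at this⟩

lemma eventually_mem_diskPunctured (ω₀ : ℂ) :
    ∀ᶠ ω in diskPunctured ω₀, ‖ω‖ ≤ 1 ∧ ω ≠ ω₀ := by
  filter_upwards [self_mem_nhdsWithin] with ω hω
  exact ⟨by simpa using hω.1, hω.2⟩

lemma diskPunctured_le_nhds (ω₀ : ℂ) : diskPunctured ω₀ ≤ 𝓝 ω₀ := nhdsWithin_le_nhds

lemma exists_analytic_sqrt {g : ℂ → ℂ} {z₀ c : ℂ} (hg : AnalyticAt ℂ g z₀) (hc : c ^ 2 = g z₀)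
    (h0 : g z₀ ≠ 0) : ∃ r : ℂ → ℂ, AnalyticAt ℂ r z₀ ∧ r z₀ = c ∧ ∀ z, r z ^ 2 = g z := by
  refine ⟨fun z => c * (g z / g z₀) ^ ((2 : ℕ)⁻¹ : ℂ), ?_, ?_, fun z => ?_⟩
  · refine analyticAt_const.mul ((hg.div analyticAt_const h0).cpow analyticAt_const ?_)
    simp [div_self h0, Complex.one_mem_slitPlane]
  · simp [div_self h0]
  · rw [mul_pow, Complex.cpow_nat_inv_pow _ two_ne_zero, hc, mul_div_cancel₀ _ h0]

/-- A nonzero common limit of the two functions excludes the opposite sign. In this way continuous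
branches are identified with analytic square roots. -/
lemma eventually_eq_of_sq_eq {X : Type*} {l : Filter X} {f g : X → ℂ} {c : ℂ} (hc : c ≠ 0)
    (hf : Tendsto f l (𝓝 c)) (hg : Tendsto g l (𝓝 c)) (h : ∀ᶠ x in l, f x ^ 2 = g x ^ 2) :
    ∀ᶠ x in l, f x = g x := by
  have hne : ∀ᶠ x in l, f x + g x ≠ 0 :=
    (hf.add hg).eventually_ne (by rw [← two_mul]; exact mul_ne_zero two_ne_zero hc)
  filter_upwards [h, hne] with x hx hx'
  have : (f x - g x) * (f x + g x) = 0 := by linear_combination hx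
  exact sub_eq_zero.1 ((mul_eq_zero.1 this).resolve_right hx')

namespace WebSystem

variable {𝒜 C : Type*} (S : WebSystem 𝒜 C)

/-- The sum `θ + θ⁻¹` as a function of the spectral parameter `W_σ(θ)`. -/
def trC (σ : C) (z : ℂ) : ℂ := ((S.aLim σ : ℂ) - z) / S.bLim σ

/-- The difference `θ_σ(ω) - θ_σ(ω)⁻¹`. -/
def diffC (σ : C) (ω : ℂ) : ℂ := S.theta σ ω - (S.theta σ ω)⁻¹

lemma trC_W (σ : C) {ω : ℂ} (h0 : ω ≠ 0) (h1 : ‖ω‖ ≤ 1) :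
    S.trC σ (S.W ω) = S.theta σ ω + (S.theta σ ω)⁻¹ := by
  have hb := S.bLim_ne_zero σ
  rw [← (S.theta_spec σ h0 h1).2.2.1, trC, Wc]
  field_simp
  ring

lemma theta_eq_half (σ : C) {ω : ℂ} (h0 : ω ≠ 0) (h1 : ‖ω‖ ≤ 1) :
    S.theta σ ω = (S.trC σ (S.W ω) + S.diffC σ ω) / 2 := by
  rw [S.trC_W σ h0 h1, diffC]; ring

lemma diffC_sq (σ : C) {ω : ℂ} (h0 : ω ≠ 0) (h1 : ‖ω‖ ≤ 1) :
    S.diffC σ ω ^ 2 = S.trC σ (S.W ω) ^ 2 - 4 := by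
  have h := (S.theta_spec σ h0 h1).1
  rw [S.trC_W σ h0 h1, diffC]
  field_simp
  ring

lemma W_eq_of_trC (σ : C) (z : ℂ) : z = S.aLim σ - S.bLim σ * S.trC σ z := by
  have hb := S.bLim_ne_zero σ
  rw [trC]; field_simp; ring

lemma analyticAt_trC (σ : C) (z : ℂ) : AnalyticAt ℂ (S.trC σ) z := by
  unfold trC
  fun_prop

lemma analyticAt_W {ω : ℂ} (h : ω ≠ 0) : AnalyticAt ℂ S.W ω := by
  unfold W
  exact analyticAt_const.sub (analyticAt_const.mul (analyticAt_id.add (analyticAt_inv h)))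

lemma continuousOn_diffC (σ : C) :
    ContinuousOn (S.diffC σ) (Metric.closedBall 0 1 \ {0}) := by
  have h := (S.continuousOn_theta σ).mono (Set.sdiff_subset (t := {0}))
  exact h.sub (h.inv₀ fun ω hω => (S.theta_spec σ hω.2 (by simpa using hω.1)).1)

section local_uniformizer

variable {S} {ω₀ : ℂ} (h0 : ω₀ ≠ 0) (h1 : ‖ω₀‖ ≤ 1)

include h0 in
lemma eventually_ne_zero_diskPunctured : ∀ᶠ ω in diskPunctured ω₀, ω ≠ 0 :=
  diskPunctured_le_nhds ω₀ (isOpen_ne.mem_nhds h0)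

include h1 in
lemma tendsto_theta_diskPunctured (σ : C) :
    Tendsto (S.theta σ) (diskPunctured ω₀) (𝓝 (S.theta σ ω₀)) :=
  (S.continuousOn_theta σ ω₀ (by simpa using h1)).mono_left
    (nhdsWithin_mono _ Set.sdiff_subset)

include h0 h1 in
lemma tendsto_diffC_diskPunctured (σ : C) :
    Tendsto (S.diffC σ) (diskPunctured ω₀) (𝓝 (S.diffC σ ω₀)) :=
  (tendsto_theta_diskPunctured h1 σ).sub
    ((tendsto_theta_diskPunctured h1 σ).inv₀ (S.theta_spec σ h0 h1).1)

include h0 in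
lemma tendsto_W_diskPunctured : Tendsto S.W (diskPunctured ω₀) (𝓝 (S.W ω₀)) :=
  (S.continuousAt_W h0).tendsto.mono_left (diskPunctured_le_nhds ω₀)

include h0 in
-- The only other point with the same value of `W` is `ω₀⁻¹`, which either coincides with `ω₀` or
-- stays away from it.
lemma eventually_W_ne (hb : S.b ≠ 0) : ∀ᶠ ω in diskPunctured ω₀, S.W ω ≠ S.W ω₀ := by
  have hb' : (S.b : ℂ) ≠ 0 := by exact_mod_cast hb
  have hinv : ∀ᶠ ω in diskPunctured ω₀, ω * ω₀ ≠ 1 := by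
    by_cases h : ω₀ * ω₀ = 1
    · filter_upwards [eventually_mem_diskPunctured ω₀] with ω hω h'
      exact hω.2 (mul_right_cancel₀ h0 (h'.trans h.symm))
    · exact ((tendsto_id.mul_const ω₀).mono_left (diskPunctured_le_nhds ω₀)).eventually_ne h
  filter_upwards [hinv, eventually_mem_diskPunctured ω₀, eventually_ne_zero_diskPunctured h0]
    with ω h1 h2 h3 h4
  have : ω + ω⁻¹ = ω₀ + ω₀⁻¹ := by simpa [W, hb'] using h4
  exact (eq_or_mul_eq_one_of_add_inv_eq h3 h0 this).elim h2.2 h1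

include h0 h1 in
/-- Away from the band edges of a channel, `θ_σ` is an analytic function of the spectral
parameter. -/
lemma exists_analytic_theta_of_diffC_ne_zero (σ : C) (hd : S.diffC σ ω₀ ≠ 0) :
    ∃ r : ℂ → ℂ, AnalyticAt ℂ r (S.W ω₀) ∧
      ∀ᶠ ω in diskPunctured ω₀, S.theta σ ω = (S.trC σ (S.W ω) + r (S.W ω)) / 2 := by
  have hsq := S.diffC_sq σ h0 h1
  obtain ⟨r, hr, hr0, hr2⟩ := exists_analytic_sqrt (g := fun z => S.trC σ z ^ 2 - 4)
    (((S.analyticAt_trC σ (S.W ω₀)).pow 2).sub analyticAt_const) hsq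
    (by rw [← hsq]; exact pow_ne_zero 2 hd)
  refine ⟨r, hr, ?_⟩
  have hW := tendsto_W_diskPunctured (S := S) h0
  have hev := eventually_eq_of_sq_eq hd (tendsto_diffC_diskPunctured h0 h1 σ)
    (by have := hr.continuousAt.tendsto.comp hW; rwa [hr0] at this) (by
      filter_upwards [eventually_mem_diskPunctured ω₀, eventually_ne_zero_diskPunctured h0]
        with ω h2 h3
      rw [Function.comp_apply, hr2, S.diffC_sq σ h3 h2.1])
  filter_upwards [hev, eventually_mem_diskPunctured ω₀, eventually_ne_zero_diskPunctured h0]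
    with ω h2 h3 h4
  rw [S.theta_eq_half σ h4 h3.1, h2, Function.comp_apply]

include h0 h1 in
-- A band edge is a real value in the closed interval `I`. Inside the disk `W` is real only at real
-- points, where it lies outside the interior of `I`; so the edge would be an end of `I`, which `W`
-- takes only at `±1`.
lemma norm_eq_one_of_diffC_eq_zero (σ : C) (hd : S.diffC σ ω₀ = 0) : ‖ω₀‖ = 1 := by
  obtain ⟨hθ0, -, hW, -⟩ := S.theta_spec σ h0 h1
  have hb := S.b_pos σ
  have hθ : S.theta σ ω₀ = 1 ∨ S.theta σ ω₀ = -1 := by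
    rw [diffC, sub_eq_zero] at hd
    refine mul_self_eq_one_iff.1 ?_
    nth_rw 1 [hd]
    exact inv_mul_cancel₀ hθ0
  by_contra hne
  have hlt : ‖ω₀‖ < 1 := lt_of_le_of_ne h1 hne
  have him : ω₀.im = 0 := by
    by_contra him
    have := S.norm_theta_lt_one_of_W_im_ne_zero σ h0 h1 (S.W_im_ne_zero σ hlt him)
    rcases hθ with h | h <;> simp [h] at this
  obtain ⟨hlo, hhi⟩ := S.band_bounds σ
  have hbσ := S.bLim_pos σ
  have hWre : (S.W ω₀).re = S.aLim σ - 2 * S.bLim σ ∨ (S.W ω₀).re = S.aLim σ + 2 * S.bLim σ := by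
    rw [← hW, Wc]
    rcases hθ with h | h
    · left; rw [h]; simp; ring
    · right; rw [h]; simp; ring
  have hWim : (S.W ω₀).im = 0 := by rw [W_im, him]; simp
  have hb' : (S.b : ℂ) ≠ 0 := by exact_mod_cast hb.ne'
  have key : ∀ s : ℝ, (s = 1 ∨ s = -1) → (S.W ω₀).re = S.a - 2 * s * S.b → False := by
    intro s hs h
    have hWc : S.W ω₀ = S.a - S.b * (2 * s) := by
      apply Complex.ext
      · rw [h]; simp; ring
      · rw [hWim]; simp
    have h2 : ω₀ + ω₀⁻¹ = 2 * s := by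
      rw [W] at hWc
      exact mul_left_cancel₀ hb' (sub_right_injective hWc)
    have h3 : (ω₀ - s) ^ 2 = 0 := by
      have hs2 : (s : ℂ) ^ 2 = 1 := by rcases hs with h | h <;> simp [h]
      field_simp at h2
      linear_combination h2 + hs2
    have h4 : ω₀ = s := sub_eq_zero.1 (pow_eq_zero_iff two_ne_zero |>.1 h3)
    apply hne
    rw [h4]
    rcases hs with h | h <;> simp [h]
  rcases S.not_mem_interior_of_im_eq_zero h0 him hb with h | h
  · refine key 1 (Or.inl rfl) ?_
    rcases hWre with h' | h' <;> linarith
  · refine key (-1) (Or.inr rfl) ?_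
    rcases hWre with h' | h' <;> linarith

include h0 h1 in
/-- If two channels have a band edge at the same point, then `θ_σ` is an analytic function of the
difference `θ_τ - θ_τ⁻¹`. -/
lemma exists_analytic_theta_of_diffC_eq_zero (σ τ : C) (hσ : S.diffC σ ω₀ = 0)
    (hτ : S.diffC τ ω₀ = 0) :
    ∃ r : ℂ → ℂ, AnalyticAt ℂ r (S.W ω₀) ∧ ∀ᶠ ω in diskPunctured ω₀,
      S.theta σ ω = (S.trC σ (S.W ω) + r (S.W ω) * S.diffC τ ω) / 2 := by
  have hn := norm_eq_one_of_diffC_eq_zero h0 h1 σ hσ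
  have hbσ := S.bLim_ne_zero σ
  have hbτ := S.bLim_ne_zero τ
  have hb : S.b ≠ 0 := (S.b_pos σ).ne'
  set z₀ := S.W ω₀ with hz₀
  have hsqσ : S.trC σ z₀ ^ 2 = 4 := by
    have := S.diffC_sq σ h0 h1; rw [hσ] at this; linear_combination -this
  have hsqτ : S.trC τ z₀ ^ 2 = 4 := by
    have := S.diffC_sq τ h0 h1; rw [hτ] at this; linear_combination -this
  have hneσ : S.trC σ z₀ ≠ 0 := by intro h; rw [h] at hsqσ; norm_num at hsqσ
  have hneτ : S.trC τ z₀ ≠ 0 := by intro h; rw [h] at hsqτ; norm_num at hsqτ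
  set A : C → ℂ → ℂ := fun ν z => S.trC ν z + S.trC ν z₀ with hA
  have hAan : ∀ ν, AnalyticAt ℂ (A ν) z₀ := fun ν => (S.analyticAt_trC ν z₀).add analyticAt_const
  have hAσ : A σ z₀ ≠ 0 := by simp only [hA, ← two_mul]; exact mul_ne_zero two_ne_zero hneσ
  have hAτ : A τ z₀ ≠ 0 := by simp only [hA, ← two_mul]; exact mul_ne_zero two_ne_zero hneτ
  -- Both squares `(θ_ν - θ_ν⁻¹)²` contain the factor `W(ω₀) - W(ω)`. It cancels in their quotient,
  -- and `g` is the remaining quotient, analytic and nonzero at `W(ω₀)`.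
  set g : ℂ → ℂ := fun z => S.bLim τ * A σ z / (S.bLim σ * A τ z) with hg
  have hgan : AnalyticAt ℂ g z₀ := (analyticAt_const.mul (hAan σ)).div
    (analyticAt_const.mul (hAan τ)) (mul_ne_zero hbσ hAτ)
  have hg0 : g z₀ ≠ 0 := div_ne_zero (mul_ne_zero hbτ hAσ) (mul_ne_zero hbσ hAτ)
  obtain ⟨c, hc⟩ := IsAlgClosed.exists_pow_nat_eq (g z₀) two_pos
  obtain ⟨r, hr, -, hr2⟩ := exists_analytic_sqrt hgan hc hg0
  -- a small neighbourhood on which everything is controlled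
  have hW : Tendsto S.W (𝓝 ω₀) (𝓝 z₀) := S.continuousAt_W h0
  have hnear : ∀ᶠ ω in 𝓝 ω₀, ω ≠ 0 ∧ AnalyticAt ℂ r (S.W ω) ∧ A τ (S.W ω) ≠ 0 ∧
      A σ (S.W ω) ≠ 0 :=
    (tendsto_id.eventually_ne h0).and
      ((hW.eventually hr.eventually_analyticAt).and
        ((((hAan τ).continuousAt.tendsto.comp hW).eventually_ne hAτ).and
          (((hAan σ).continuousAt.tendsto.comp hW).eventually_ne hAσ)))
  have hWne := eventually_W_ne (S := S) h0 hb
  rw [diskPunctured, eventually_nhdsWithin_iff] at hWne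
  obtain ⟨δ, hδ, hball⟩ := Metric.eventually_nhds_iff_ball.1 (hnear.and hWne)
  set N : Set ℂ := (Metric.closedBall 0 1 \ {ω₀}) ∩ Metric.ball ω₀ δ with hN
  -- Removing a boundary point from a disk keeps it convex, as the point is extreme. Connectedness
  -- of `N` then makes the sign between the two square roots constant.
  have hconv : Convex ℝ N := by
    refine Convex.inter ?_ (convex_ball _ _)
    refine ((convex_closedBall (0 : ℂ) 1).mem_extremePoints_iff_convex_sdiff.1 ?_).2
    refine (strictConvex_closedBall ℝ (0 : ℂ) 1).sdiff_interior_subset_extremePoints ?_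
    rw [interior_closedBall _ one_ne_zero]
    simp [hn]
  have hN1 : ∀ ω ∈ N, ‖ω‖ ≤ 1 := fun ω hω => by simpa using hω.1.1
  have hN0 : ∀ ω ∈ N, ω ≠ 0 := fun ω hω => (hball ω hω.2).1.1
  have hsub : N ⊆ Metric.closedBall 0 1 \ {0} := fun ω hω => ⟨hω.1.1, hN0 ω hω⟩
  have hdiff : ∀ ν, S.diffC ν ω₀ = 0 → ∀ ω ∈ N,
      S.diffC ν ω ^ 2 = (z₀ - S.W ω) / S.bLim ν * A ν (S.W ω) := by
    intro ν hν ω hω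
    have h := S.diffC_sq ν h0 h1
    rw [hν] at h
    have e : (z₀ - S.W ω) / S.bLim ν = S.trC ν (S.W ω) - S.trC ν z₀ := by
      simp only [trC]; ring
    rw [S.diffC_sq ν (hN0 ω hω) (hN1 ω hω), e, hA]
    linear_combination -h
  have hτne : ∀ ω ∈ N, S.diffC τ ω ≠ 0 := by
    intro ω hω h
    have h' := hdiff τ hτ ω hω
    rw [h] at h'
    have h2 := (hball ω hω.2).2 hω.1
    have h3 := (hball ω hω.2).1.2.2.1
    have : z₀ - S.W ω ≠ 0 := sub_ne_zero.2 (Ne.symm h2)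
    exact (mul_ne_zero (div_ne_zero this hbτ) h3) (by rw [← h']; simp)
  have hrne : ∀ ω ∈ N, r (S.W ω) ≠ 0 := by
    intro ω hω h
    have h3 := (hball ω hω.2).1.2.2
    have h2 := hr2 (S.W ω)
    rw [h] at h2
    exact (div_ne_zero (mul_ne_zero hbτ h3.2) (mul_ne_zero hbσ h3.1)) (by
      change g (S.W ω) = 0
      rw [← h2]; simp)
  have halt := hconv.isPreconnected.eq_or_eq_neg_of_sq_eq (f := S.diffC σ)
    (g := fun ω => r (S.W ω) * S.diffC τ ω) ((S.continuousOn_diffC σ).mono hsub)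
    (by
      refine ContinuousOn.mul (fun ω hω => ?_) ((S.continuousOn_diffC τ).mono hsub)
      exact (ContinuousAt.comp (hball ω hω.2).1.2.1.continuousAt
        (S.continuousAt_W (hN0 ω hω))).continuousWithinAt)
    (by
      intro ω hω
      have h3 := (hball ω hω.2).1.2.2
      simp only [Pi.pow_apply, mul_pow]
      rw [hr2, hdiff σ hσ ω hω, hdiff τ hτ ω hω, hg]
      have := h3.1
      field_simp)
    (fun {ω} hω => mul_ne_zero (hrne ω hω) (hτne ω hω))
  have hNmem : ∀ᶠ ω in diskPunctured ω₀, ω ∈ N := by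
    rw [diskPunctured]
    exact inter_mem_nhdsWithin _ (Metric.ball_mem_nhds ω₀ hδ)
  rcases halt with h | h
  · refine ⟨r, hr, ?_⟩
    filter_upwards [hNmem] with ω hω
    rw [S.theta_eq_half σ (hN0 ω hω) (hN1 ω hω), h hω]
  · refine ⟨fun z => -r z, hr.neg, ?_⟩
    filter_upwards [hNmem] with ω hω
    rw [S.theta_eq_half σ (hN0 ω hω) (hN1 ω hω), h hω]
    simp

variable (S) in
include h0 h1 in
/-- A local uniformizer: near each point of the punctured closed disk all the functions `θ_σ` and
`W` are analytic functions of one local parameter. -/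
theorem exists_uniformizer [Finite C] [Nonempty C] :
    ∃ (ζ Λ : ℂ → ℂ) (Θ : C → ℂ → ℂ), Tendsto ζ (diskPunctured ω₀) (𝓝[≠] 0) ∧
      AnalyticAt ℂ Λ 0 ∧ (∀ σ, AnalyticAt ℂ (Θ σ) 0) ∧ (∀ σ, Θ σ 0 = S.theta σ ω₀) ∧
      ∀ᶠ ω in diskPunctured ω₀, S.W ω = Λ (ζ ω) ∧ ∀ σ, S.theta σ ω = Θ σ (ζ ω) := by
  have hb : S.b ≠ 0 := (S.b_pos (Classical.arbitrary C)).ne'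
  have := diskPunctured_neBot h1
  suffices h : ∃ (ζ Λ : ℂ → ℂ), Tendsto ζ (diskPunctured ω₀) (𝓝[≠] 0) ∧
      AnalyticAt ℂ Λ 0 ∧ Λ 0 = S.W ω₀ ∧ (∀ᶠ ω in diskPunctured ω₀, S.W ω = Λ (ζ ω)) ∧
      ∀ σ, ∃ Θ : ℂ → ℂ, AnalyticAt ℂ Θ 0 ∧
        ∀ᶠ ω in diskPunctured ω₀, S.theta σ ω = Θ (ζ ω) by
    obtain ⟨ζ, Λ, hζ, hΛ, -, hW, hθ⟩ := h
    choose Θ hΘ hΘe using hθ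
    refine ⟨ζ, Λ, Θ, hζ, hΛ, hΘ, fun σ => ?_, hW.and (eventually_all.2 hΘe)⟩
    have h2 := (hΘ σ).continuousAt.tendsto.comp (hζ.mono_right nhdsWithin_le_nhds)
    exact tendsto_nhds_unique_of_eventuallyEq h2 (tendsto_theta_diskPunctured h1 σ)
      ((hΘe σ).mono fun _ h => h.symm)
  by_cases hedge : ∃ τ, S.diffC τ ω₀ = 0
  · obtain ⟨τ, hτ⟩ := hedge
    have hsq : S.trC τ (S.W ω₀) ^ 2 = 4 := by
      have := S.diffC_sq τ h0 h1; rw [hτ] at this; linear_combination -this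
    -- With `ζ = θ_τ - θ_τ⁻¹` one has `(θ_τ + θ_τ⁻¹)² = ζ² + 4`. The right side is nonzero at `ζ =
    -- 0`, so an analytic root recovers the spectral parameter from `ζ`.
    obtain ⟨r, hr, hr0, hr2⟩ := exists_analytic_sqrt (g := fun z : ℂ => z ^ 2 + 4) (z₀ := 0)
      (c := S.trC τ (S.W ω₀)) (by fun_prop) (by simpa using hsq) (by norm_num)
    have hne : S.trC τ (S.W ω₀) ≠ 0 := by intro h; rw [h] at hsq; norm_num at hsq
    have hζ : Tendsto (S.diffC τ) (diskPunctured ω₀) (𝓝 0) := by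
      have := tendsto_diffC_diskPunctured (S := S) h0 h1 τ; rwa [hτ] at this
    have htr : Tendsto (fun ω => S.trC τ (S.W ω)) (diskPunctured ω₀) (𝓝 (S.trC τ (S.W ω₀))) :=
      (S.analyticAt_trC τ _).continuousAt.tendsto.comp (tendsto_W_diskPunctured h0)
    have htre : ∀ᶠ ω in diskPunctured ω₀, S.trC τ (S.W ω) = r (S.diffC τ ω) := by
      refine eventually_eq_of_sq_eq hne htr ?_ ?_
      · have := hr.continuousAt.tendsto.comp hζ; rwa [hr0] at this
      · filter_upwards [eventually_mem_diskPunctured ω₀, eventually_ne_zero_diskPunctured h0]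
          with ω h2 h3
        rw [hr2, S.diffC_sq τ h3 h2.1]; ring
    set Λ : ℂ → ℂ := fun z => S.aLim τ - S.bLim τ * r z with hΛ
    have hΛan : AnalyticAt ℂ Λ 0 := analyticAt_const.sub (analyticAt_const.mul hr)
    have hΛ0 : Λ 0 = S.W ω₀ := by
      rw [hΛ]; simp only; rw [hr0, ← S.W_eq_of_trC]
    have hWe : ∀ᶠ ω in diskPunctured ω₀, S.W ω = Λ (S.diffC τ ω) := by
      filter_upwards [htre] with ω h
      rw [hΛ]; simp only; rw [← h, ← S.W_eq_of_trC]
    have hζne : ∀ᶠ ω in diskPunctured ω₀, S.diffC τ ω ≠ 0 := by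
      filter_upwards [hWe, eventually_W_ne h0 hb] with ω h2 h3 h4
      rw [h4, hΛ0] at h2
      exact h3 h2
    refine ⟨S.diffC τ, Λ, tendsto_nhdsWithin_iff.2 ⟨hζ, hζne⟩, hΛan, hΛ0, hWe, fun σ => ?_⟩
    have htrΛ : AnalyticAt ℂ (fun z => S.trC σ (Λ z)) 0 := (S.analyticAt_trC σ _).comp hΛan
    by_cases hσ : S.diffC σ ω₀ = 0
    · obtain ⟨q, hq, hqe⟩ := exists_analytic_theta_of_diffC_eq_zero h0 h1 σ τ hσ hτ
      rw [← hΛ0] at hq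
      refine ⟨fun z => (S.trC σ (Λ z) + q (Λ z) * z) / 2,
        (htrΛ.add ((hq.comp hΛan).mul analyticAt_id)).div_const, ?_⟩
      filter_upwards [hqe, hWe] with ω h2 h3
      rw [h2, ← h3]
    · obtain ⟨q, hq, hqe⟩ := exists_analytic_theta_of_diffC_ne_zero h0 h1 σ hσ
      rw [← hΛ0] at hq
      refine ⟨fun z => (S.trC σ (Λ z) + q (Λ z)) / 2,
        (htrΛ.add (hq.comp hΛan)).div_const, ?_⟩
      filter_upwards [hqe, hWe] with ω h2 h3
      rw [h2, ← h3]
  · push Not at hedge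
    set Λ : ℂ → ℂ := fun z => S.W (ω₀ + z) with hΛ
    have hΛ0 : Λ 0 = S.W ω₀ := by simp [hΛ]
    have hΛan : AnalyticAt ℂ Λ 0 := by
      have : AnalyticAt ℂ S.W (ω₀ + 0) := by rw [add_zero]; exact S.analyticAt_W h0
      exact this.comp (analyticAt_const.add analyticAt_id)
    have hWe : ∀ ω, S.W ω = Λ (ω - ω₀) := fun ω => by simp [hΛ]
    refine ⟨fun ω => ω - ω₀, Λ, tendsto_nhdsWithin_iff.2 ⟨?_, ?_⟩, hΛan, hΛ0,
      Eventually.of_forall hWe, fun σ => ?_⟩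
    · have : Tendsto (fun ω => ω - ω₀) (𝓝 ω₀) (𝓝 (ω₀ - ω₀)) := tendsto_id.sub_const ω₀
      rw [sub_self] at this
      exact this.mono_left (diskPunctured_le_nhds ω₀)
    · filter_upwards [eventually_mem_diskPunctured ω₀] with ω h2
      exact sub_ne_zero.2 h2.2
    · have htrΛ : AnalyticAt ℂ (fun z => S.trC σ (Λ z)) 0 := (S.analyticAt_trC σ _).comp hΛan
      obtain ⟨q, hq, hqe⟩ := exists_analytic_theta_of_diffC_ne_zero h0 h1 σ (hedge σ)
      rw [← hΛ0] at hq
      refine ⟨fun z => (S.trC σ (Λ z) + q (Λ z)) / 2,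
        (htrΛ.add (hq.comp hΛan)).div_const, ?_⟩
      filter_upwards [hqe] with ω h2
      rw [h2, ← hWe]

end local_uniformizer

end WebSystem

/-! ### Meromorphic matrix functions along a local parameter. -/

/-- Entrywise meromorphy of a matrix function. -/
def MatrixMeromorphicAt {m n : Type*} (A : ℂ → Matrix m n ℂ) (z : ℂ) : Prop :=
  ∀ i j, MeromorphicAt (fun w => A w i j) z

namespace MatrixMeromorphicAt

variable {l m n : Type*} {z : ℂ}

lemma const (A : Matrix m n ℂ) : MatrixMeromorphicAt (fun _ => A) z :=
  fun _ _ => MeromorphicAt.const _ _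

lemma add {A B : ℂ → Matrix m n ℂ} (hA : MatrixMeromorphicAt A z)
    (hB : MatrixMeromorphicAt B z) : MatrixMeromorphicAt (fun w => A w + B w) z :=
  fun i j => (hA i j).add (hB i j)

lemma neg {A : ℂ → Matrix m n ℂ} (hA : MatrixMeromorphicAt A z) :
    MatrixMeromorphicAt (fun w => -A w) z :=
  fun i j => (hA i j).neg

lemma sub {A B : ℂ → Matrix m n ℂ} (hA : MatrixMeromorphicAt A z)
    (hB : MatrixMeromorphicAt B z) : MatrixMeromorphicAt (fun w => A w - B w) z :=
  fun i j => (hA i j).sub (hB i j)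

lemma mul [Fintype m] {A : ℂ → Matrix l m ℂ} {B : ℂ → Matrix m n ℂ}
    (hA : MatrixMeromorphicAt A z) (hB : MatrixMeromorphicAt B z) :
    MatrixMeromorphicAt (fun w => A w * B w) z := fun i j => by
  simp only [Matrix.mul_apply]
  exact MeromorphicAt.fun_sum fun k _ => (hA i k).mul (hB k j)

lemma diagonal [DecidableEq n] {v : ℂ → n → ℂ} (hv : ∀ i, MeromorphicAt (fun w => v w i) z) :
    MatrixMeromorphicAt (fun w => Matrix.diagonal (v w)) z := fun i j => by
  by_cases h : i = j
  · subst h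
    simpa using hv i
  · simp [h]

lemma det [Fintype n] [DecidableEq n] {A : ℂ → Matrix n n ℂ} (hA : MatrixMeromorphicAt A z) :
    MeromorphicAt (fun w => (A w).det) z := by
  simp only [Matrix.det_apply']
  exact MeromorphicAt.fun_sum fun σ _ =>
    (MeromorphicAt.const _ _).mul (MeromorphicAt.fun_prod fun i _ => hA (σ i) i)

/-- Cramer's formula holds pointwise with the convention that the inverse of a singular matrix is
zero, so the determinant need not be assumed nonvanishing. -/
lemma inv [Fintype n] [DecidableEq n] {A : ℂ → Matrix n n ℂ} (hA : MatrixMeromorphicAt A z) :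
    MatrixMeromorphicAt (fun w => (A w)⁻¹) z := fun i j => by
  simp only [Matrix.inv_def, Matrix.smul_apply, Ring.inverse_eq_inv', smul_eq_mul,
    Matrix.adjugate_apply]
  refine hA.det.inv.mul (det fun k l => ?_)
  simp only [Matrix.updateRow_apply]
  split_ifs
  · exact MeromorphicAt.const _ _
  · exact hA k l

end MatrixMeromorphicAt

section composition

variable {X : Type*} {l : Filter X} {ζ : X → ℂ} {f : ℂ → ℂ} (hf : MeromorphicAt f 0)
  (hζ : Tendsto ζ l (𝓝[≠] 0))

include hf hζ

/-- A meromorphic germ is either identically zero or zero-free on a punctured neighbourhood; one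
sequence of nonzero values along `ζ` rules out the former. -/
lemma eventually_ne_zero_of_frequently (h : ∃ᶠ x in l, f (ζ x) ≠ 0) :
    ∀ᶠ x in l, f (ζ x) ≠ 0 := by
  rcases hf.eventually_eq_zero_or_eventually_ne_zero with h' | h'
  · exact absurd ((hζ.eventually h').mono fun x hx => not_not.2 hx) h
  · exact hζ.eventually h'

lemma tendsto_nhds_or_tendsto_norm_atTop :
    (∃ c, Tendsto (fun x => f (ζ x)) l (𝓝 c)) ∨ Tendsto (fun x => ‖f (ζ x)‖) l atTop := by
  rcases lt_or_ge (meromorphicOrderAt f 0) 0 with h | h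
  · right
    have := (tendsto_cobounded_iff_meromorphicOrderAt_neg hf).2 h
    exact (tendsto_norm_atTop_iff_cobounded.2 this).comp hζ
  · left
    obtain ⟨c, hc⟩ := (tendsto_nhds_iff_meromorphicOrderAt_nonneg hf).2 h
    exact ⟨c, hc.comp hζ⟩

end composition

/-! ### Flux balance and genericity at nonreal spectral parameters. -/

namespace WebSystem

variable {𝒜 C : Type*} (S : WebSystem 𝒜 C)

section flux

variable {S} {σ : C} {z : ℂ} {x : ℕ → ℂ}

/-- The flux of a solution through the `k`-th bond of a channel. -/
def flux (S : WebSystem 𝒜 C) (σ : C) (x : ℕ → ℂ) (k : ℕ) : ℝ :=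
  ((starRingEnd ℂ) (x k) * ((S.bC σ k : ℂ) * x (k + 1))).im

/-- The discrete Green identity: the equation is multiplied by the conjugate of its middle value,
and the imaginary part is taken. -/
lemma SolvesChannel.flux_sub (hx : S.SolvesChannel σ z x) (k : ℕ) :
    S.flux σ x k - S.flux σ x (k + 1) = z.im * ‖x (k + 1)‖ ^ 2 := by
  have h := congrArg (fun w => ((starRingEnd ℂ) (x (k + 1)) * w).im) (hx k)
  rw [Complex.sq_norm, Complex.normSq_apply]
  simp only [flux, Complex.mul_im, Complex.mul_re, Complex.conj_re, Complex.conj_im,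
    Complex.add_im, Complex.add_re, Complex.sub_im, Complex.sub_re, Complex.neg_im,
    Complex.neg_re, Complex.ofReal_re, Complex.ofReal_im] at h ⊢
  linear_combination h

lemma SolvesChannel.mul_flux_nonneg (hx : S.SolvesChannel σ z x)
    (hlim : Tendsto x atTop (𝓝 0)) (k : ℕ) : 0 ≤ z.im * S.flux σ x k := by
  have hanti : Antitone fun k => z.im * S.flux σ x k := antitone_nat_of_succ_le fun k => by
    have h : z.im * S.flux σ x k - z.im * S.flux σ x (k + 1) = (z.im * ‖x (k + 1)‖) ^ 2 := by
      linear_combination z.im * hx.flux_sub k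
    linarith [sq_nonneg (z.im * ‖x (k + 1)‖)]
  refine hanti.le_of_tendsto ?_ k
  have h1 : Tendsto (fun k => (starRingEnd ℂ) (x k) * ((S.bC σ k : ℂ) * x (k + 1))) atTop
      (𝓝 0) := by
    have := ((Complex.continuous_conj.tendsto 0).comp hlim).mul
      ((S.tendsto_bC σ).mul (hlim.comp (tendsto_add_atTop_nat 1)))
    simpa using this
  have := ((Complex.continuous_im.tendsto 0).comp h1).const_mul z.im
  rwa [Complex.zero_im, mul_zero] at this

/-- The flux times `z.im` decreases to zero along the channel, so vanishing at the first bond makes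
it vanish at all bonds. Each loss is a multiple of `‖x (k + 1)‖ ^ 2` and must then be zero. -/
lemma SolvesChannel.eq_zero_of_flux (hx : S.SolvesChannel σ z x) (hz : z.im ≠ 0)
    (hlim : Tendsto x atTop (𝓝 0)) (h0 : z.im * S.flux σ x 0 = 0) (k : ℕ) : x k = 0 := by
  have hfl : ∀ k, z.im * S.flux σ x k = 0 ∧ x (k + 1) = 0 := by
    have step : ∀ k, z.im * S.flux σ x k = 0 →
        x (k + 1) = 0 ∧ z.im * S.flux σ x (k + 1) = 0 := by
      intro k hk
      have h1 := hx.flux_sub k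
      have h2 := hx.mul_flux_nonneg hlim (k + 1)
      have h3 : z.im ^ 2 * ‖x (k + 1)‖ ^ 2 = - (z.im * S.flux σ x (k + 1)) := by
        linear_combination hk - z.im * h1
      have h4 : 0 ≤ z.im ^ 2 * ‖x (k + 1)‖ ^ 2 := by positivity
      have h5 : z.im ^ 2 * ‖x (k + 1)‖ ^ 2 = 0 := by linarith
      exact ⟨by simpa [hz] using h5, by linarith⟩
    intro k
    induction k with
    | zero => exact ⟨h0, (step 0 h0).1⟩
    | succ k ih => exact ⟨(step k ih.1).2, (step (k + 1) (step k ih.1).2).1⟩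
  refine hx.eq_zero ?_ (hfl 0).2 k
  have := hx 0
  rw [(hfl 0).2, (hfl 1).2] at this
  simpa [S.bC_ne_zero] using this

lemma tendsto_jost_zero (σ : C) {θ : ℂ} (h0 : θ ≠ 0) (hθ : ‖θ‖ < 1) :
    Tendsto (S.jost σ θ) atTop (𝓝 0) := by
  rw [show S.jost σ θ = _ from funext (S.jost_eq σ h0 hθ.le)]
  simpa using (tendsto_pow_atTop_nhds_zero_of_norm_lt_one hθ).mul
    (S.tendsto_jostU σ (S.mem_ball_jostRadius σ hθ.le))

end flux

section core

open scoped Classical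

lemma attach_injective : Function.Injective S.attach := fun σ ν h => by
  have := @S.chan_injective (σ, 0) (ν, 0) (congrArg Subtype.val h)
  simpa using this

lemma coreMat_apply (z : ℂ) (α β : S.core) :
    S.coreMat z α β = (S.L α β : ℂ) - if α = β then z else 0 := by
  simp [coreMat, Matrix.one_apply]

lemma coreMat_transpose (z : ℂ) : (S.coreMat z)ᵀ = S.coreMat z := by
  ext α β
  rw [Matrix.transpose_apply, coreMat_apply, coreMat_apply, S.L_symm]
  simp only [eq_comm]

lemma coreMat_isHermitian : (S.coreMat 0).IsHermitian := by
  ext α β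
  rw [Matrix.conjTranspose_apply, coreMat_apply, coreMat_apply, S.L_symm]
  simp

lemma coreMat_eq_sub (z : ℂ) : S.coreMat z = S.coreMat 0 - z • 1 := by
  simp [coreMat]

lemma im_star_dotProduct_coreMat (z : ℂ) (v : S.core → ℂ) :
    (star v ⬝ᵥ (S.coreMat z *ᵥ v)).im = -(z.im * ∑ α, ‖v α‖ ^ 2) := by
  have h1 : (star v ⬝ᵥ (S.coreMat 0 *ᵥ v)).im = 0 :=
    S.coreMat_isHermitian.im_star_dotProduct_mulVec_self v
  have h2 : star v ⬝ᵥ v = ((∑ α, ‖v α‖ ^ 2 : ℝ) : ℂ) := by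
    simp only [dotProduct, Pi.star_apply, RCLike.star_def, Complex.conj_mul']
    push_cast
    rfl
  rw [coreMat_eq_sub, Matrix.sub_mulVec, dotProduct_sub, Complex.sub_im, h1, Matrix.smul_mulVec,
    Matrix.one_mulVec, dotProduct_smul, h2, smul_eq_mul, Complex.im_mul_ofReal, zero_sub]

lemma isUnit_det_coreMat {z : ℂ} (hz : z.im ≠ 0) : IsUnit (S.coreMat z).det := by
  rw [isUnit_iff_ne_zero]
  intro h
  obtain ⟨v, hv, h0⟩ := Matrix.exists_mulVec_eq_zero_iff.2 h
  have := S.im_star_dotProduct_coreMat z v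
  rw [h0, dotProduct_zero, Complex.zero_im] at this
  have h1 : ∑ α, ‖v α‖ ^ 2 = 0 := by
    have := mul_eq_zero.1 (neg_eq_zero.1 this.symm)
    exact this.resolve_left hz
  rw [Finset.sum_eq_zero_iff_of_nonneg fun _ _ => by positivity] at h1
  exact hv (funext fun α => by simpa using h1 α (Finset.mem_univ α))

lemma meromorphicAt_coreMat {Λ : ℂ → ℂ} (hΛ : AnalyticAt ℂ Λ 0) :
    MatrixMeromorphicAt (fun w => S.coreMat (Λ w)) 0 := fun α β => by
  simp only [coreMat_apply]
  refine (MeromorphicAt.const _ _).sub ?_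
  split_ifs
  · exact hΛ.meromorphicAt
  · exact MeromorphicAt.const _ _

lemma meromorphicAt_resolvent {Λ : ℂ → ℂ} (hΛ : AnalyticAt ℂ Λ 0) :
    MatrixMeromorphicAt (fun w => S.resolvent (Λ w)) 0 := fun σ ν => by
  exact (S.meromorphicAt_coreMat hΛ).inv (S.attach σ) (S.attach ν)

/-- A plain transpose, without conjugation, so it is valid for every complex `z`; this is the source
of reciprocity. -/
lemma resolvent_transpose (z : ℂ) : (S.resolvent z)ᵀ = S.resolvent z := by
  ext σ ν
  simp only [resolvent, Matrix.transpose_apply, Matrix.of_apply]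
  rw [← Matrix.transpose_apply (S.coreMat z)⁻¹, Matrix.transpose_nonsing_inv, coreMat_transpose]

variable [Fintype C]

/-- The source term on the central part produced by the values of a function at the first
particles of the channels. -/
def source (g : C → ℂ) : S.core → ℂ := fun α =>
  ∑ γ, if S.attach γ = α then (S.bC γ 0 : ℂ) * g γ else 0

lemma dotProduct_source (w : S.core → ℂ) (g : C → ℂ) :
    w ⬝ᵥ S.source g = ∑ γ, w (S.attach γ) * ((S.bC γ 0 : ℂ) * g γ) := by
  simp only [dotProduct, source, Finset.mul_sum]
  rw [Finset.sum_comm]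
  refine Finset.sum_congr rfl fun γ _ => ?_
  simp

end core

variable [DecidableEq C] [Fintype C]

open scoped Classical in
lemma inv_mulVec_source (z : ℂ) (g : C → ℂ) (γ : C) :
    ((S.coreMat z)⁻¹ *ᵥ S.source g) (S.attach γ) = ((S.resolvent z * S.B0) *ᵥ g) γ := by
  rw [Matrix.mulVec, dotProduct_source, ← Matrix.mulVec_mulVec]
  simp only [Matrix.mulVec, dotProduct, B0, resolvent, Matrix.of_apply, Matrix.diagonal_apply,
    ite_mul, zero_mul, Finset.sum_ite_eq, Finset.mem_univ, if_true]

open scoped Classical in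
lemma isUnit_det_T {ω : ℂ} (h0 : ω ≠ 0) (h1 : ‖ω‖ ≤ 1) (hz : (S.W ω).im ≠ 0) :
    IsUnit (S.T ω).det := by
  rw [isUnit_iff_ne_zero]
  intro hdet
  obtain ⟨v, hv, hTv⟩ := Matrix.exists_mulVec_eq_zero_iff.2 hdet
  set z := S.W ω with hzdef
  set x : C → ℕ → ℂ := fun γ k => S.jost γ (S.theta γ ω) k * v γ with hxdef
  have hθ : ∀ γ, S.theta γ ω ≠ 0 ∧ ‖S.theta γ ω‖ < 1 := fun γ =>
    ⟨(S.theta_spec γ h0 h1).1, S.norm_theta_lt_one_of_W_im_ne_zero γ h0 h1 hz⟩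
  have hx : ∀ γ, S.SolvesChannel γ z (x γ) := fun γ k => by
    have := S.jost_solves γ (hθ γ).1 (hθ γ).2.le k
    rw [(S.theta_spec γ h0 h1).2.2.1] at this
    simp only [hxdef]
    linear_combination v γ * this
  have hx0 : ∀ γ, Tendsto (x γ) atTop (𝓝 0) := fun γ => by
    simpa using (tendsto_jost_zero (S := S) γ (hθ γ).1 (hθ γ).2).mul_const (v γ)
  have hE : ∀ k γ, (S.E k ω *ᵥ v) γ = x γ k := fun k γ => by
    rw [E, Matrix.mulVec_diagonal]
  -- The central part is driven by the values at the first bonds. The kernel equation `T v = 0` says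
  -- exactly that this response matches the channel values at the attachment points.
  set φ := (S.coreMat z)⁻¹ *ᵥ S.source (fun γ => x γ 1) with hφ
  have hφa : ∀ γ, φ (S.attach γ) = x γ 0 := fun γ => by
    rw [hφ, inv_mulVec_source, ← hE 0, ← sub_eq_zero]
    have := congrFun hTv γ
    rw [T, Matrix.sub_mulVec, ← Matrix.mulVec_mulVec, Pi.sub_apply, Pi.zero_apply] at this
    rw [show (fun γ => x γ 1) = S.E 1 ω *ᵥ v from funext fun γ => (hE 1 γ).symm]
    linear_combination -this
  have hcφ : S.coreMat z *ᵥ φ = S.source fun γ => x γ 1 := by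
    rw [hφ, Matrix.mulVec_mulVec, Matrix.mul_nonsing_inv _ (S.isUnit_det_coreMat hz),
      Matrix.one_mulVec]
  have him := S.im_star_dotProduct_coreMat z φ
  rw [hcφ, dotProduct_source, Complex.im_sum] at him
  have hfl : ∀ γ, ((star φ) (S.attach γ) * ((S.bC γ 0 : ℂ) * x γ 1)).im = S.flux γ (x γ) 0 :=
    fun γ => by rw [Pi.star_apply, hφa]; rfl
  simp only [hfl] at him
  -- Flux balance for the whole system: the left side is a sum of nonnegative terms and the right
  -- side is nonpositive, so every channel flux vanishes.
  have hsum : ∑ γ, z.im * S.flux γ (x γ) 0 = -(z.im ^ 2 * ∑ α, ‖φ α‖ ^ 2) := by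
    rw [← Finset.mul_sum, him]; ring
  have hnn : ∀ γ ∈ Finset.univ, 0 ≤ z.im * S.flux γ (x γ) 0 :=
    fun γ _ => (hx γ).mul_flux_nonneg (hx0 γ) 0
  have hz0 : ∑ γ, z.im * S.flux γ (x γ) 0 = 0 := by
    refine le_antisymm ?_ (Finset.sum_nonneg hnn)
    rw [hsum, neg_nonpos]
    positivity
  rw [Finset.sum_eq_zero_iff_of_nonneg hnn] at hz0
  refine hv (funext fun γ => ?_)
  have hxz := (hx γ).eq_zero_of_flux hz (hx0 γ) (hz0 γ (Finset.mem_univ γ))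
  rcases S.jost_ne_zero γ (hθ γ).1 (hθ γ).2.le with h | h
  · exact (mul_eq_zero.1 (hxz 0)).resolve_left h
  · exact (mul_eq_zero.1 (hxz 1)).resolve_left h

/-- For the last condition, a Jost solution vanishing at `k = 1` would carry no flux through the
first bond, hence would be zero throughout. -/
lemma mem_generic_of_W_im_ne_zero {ω : ℂ} (h0 : ω ≠ 0) (h1 : ‖ω‖ ≤ 1) (hz : (S.W ω).im ≠ 0) :
    ω ∈ S.generic := by
  refine ⟨h1, h0, S.isUnit_det_coreMat hz, S.isUnit_det_T h0 h1 hz, fun σ h => ?_⟩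
  have hθ0 := (S.theta_spec σ h0 h1).1
  have hθ1 := S.norm_theta_lt_one_of_W_im_ne_zero σ h0 h1 hz
  have hs := S.jost_solves σ hθ0 hθ1.le
  rw [(S.theta_spec σ h0 h1).2.2.1] at hs
  have hf : (S.W ω).im * S.flux σ (S.jost σ (S.theta σ ω)) 0 = 0 := by
    rw [flux, zero_add, h]; simp
  have hall := hs.eq_zero_of_flux hz (tendsto_jost_zero σ hθ0 hθ1) hf
  rcases S.jost_ne_zero σ hθ0 hθ1.le with h | h
  · exact h (hall 0)
  · exact h (hall 1)

/-! ### Poles or limits of the entries of `U`. -/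

/-- The matrix `ℰ(k)` as an analytic function of the parameters `θ`. -/
def modelE (k : ℕ) (θ : C → ℂ) : Matrix C C ℂ :=
  Matrix.diagonal fun σ => θ σ ^ k * S.jostU σ k (θ σ)

/-- The matrix `T` as a function of the spectral parameter and the parameters `θ`. -/
def modelT (z : ℂ) (θ : C → ℂ) : Matrix C C ℂ :=
  S.modelE 0 θ - S.resolvent z * S.B0 * S.modelE 1 θ

/-- The matrix `U(k)` as a function of the spectral parameter and the parameters `θ`. -/
def modelU (k : ℕ) (z : ℂ) (θ : C → ℂ) : Matrix C C ℂ :=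
  (-(Matrix.diagonal fun σ => S.pSol σ z k) + S.modelE k θ * (S.modelT z θ)⁻¹) * S.B * (S.B0)⁻¹ *
    (Matrix.diagonal fun σ => (θ σ)⁻¹ - θ σ) * (S.modelE 1 θ)⁻¹

omit [Fintype C] in
lemma E_eq_modelE {ω : ℂ} (h0 : ω ≠ 0) (h1 : ‖ω‖ ≤ 1) (k : ℕ) :
    S.E k ω = S.modelE k (fun σ => S.theta σ ω) := by
  unfold E modelE
  congr 1
  ext σ
  have := S.theta_spec σ h0 h1
  exact S.jost_eq σ this.1 this.2.1 k

lemma T_eq_modelT {ω : ℂ} (h0 : ω ≠ 0) (h1 : ‖ω‖ ≤ 1) :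
    S.T ω = S.modelT (S.W ω) (fun σ => S.theta σ ω) := by
  rw [T, modelT, S.E_eq_modelE h0 h1, S.E_eq_modelE h0 h1]

lemma Uformula_eq_modelU {ω : ℂ} (h0 : ω ≠ 0) (h1 : ‖ω‖ ≤ 1) (k : ℕ) :
    S.Uformula k ω = S.modelU k (S.W ω) (fun σ => S.theta σ ω) := by
  rw [Uformula, modelU, S.E_eq_modelE h0 h1, S.E_eq_modelE h0 h1, S.T_eq_modelT h0 h1, P, D]

section meromorphic

variable {S} {Λ : ℂ → ℂ} {Θ : C → ℂ → ℂ} (hΛ : AnalyticAt ℂ Λ 0)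
  (hΘ : ∀ σ, AnalyticAt ℂ (Θ σ) 0) (hΘ1 : ∀ σ, ‖Θ σ 0‖ ≤ 1)

omit [DecidableEq C] [Fintype C] in
include hΛ in
lemma analyticAt_pSol (σ : C) (k : ℕ) : AnalyticAt ℂ (fun w => S.pSol σ (Λ w) k) 0 := by
  have : ∀ k, AnalyticAt ℂ (fun w => S.pSol σ (Λ w) k) 0 ∧
      AnalyticAt ℂ (fun w => S.pSol σ (Λ w) (k + 1)) 0 := by
    intro k
    induction k with
    | zero => exact ⟨analyticAt_const, analyticAt_const⟩
    | succ k ih =>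
      refine ⟨ih.2, ?_⟩
      exact (((analyticAt_const.sub hΛ).mul ih.2).sub (analyticAt_const.mul ih.1)).div_const
  exact (this k).1

omit [DecidableEq C] [Fintype C] in
include hΘ hΘ1 in
lemma analyticAt_jostU_comp (σ : C) (k : ℕ) :
    AnalyticAt ℂ (fun w => Θ σ w ^ k * S.jostU σ k (Θ σ w)) 0 :=
  ((hΘ σ).pow k).mul ((S.analyticAt_jostU σ k (hΘ1 σ)).comp (hΘ σ))

omit [Fintype C] in
include hΘ hΘ1 in
lemma meromorphicAt_modelE (k : ℕ) :
    MatrixMeromorphicAt (fun w => S.modelE k fun σ => Θ σ w) 0 :=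
  MatrixMeromorphicAt.diagonal fun σ => (analyticAt_jostU_comp hΘ hΘ1 σ k).meromorphicAt

include hΛ hΘ hΘ1 in
lemma meromorphicAt_modelT :
    MatrixMeromorphicAt (fun w => S.modelT (Λ w) fun σ => Θ σ w) 0 :=
  (meromorphicAt_modelE hΘ hΘ1 0).sub
    (((S.meromorphicAt_resolvent hΛ).mul (MatrixMeromorphicAt.const _)).mul
      (meromorphicAt_modelE hΘ hΘ1 1))

include hΛ hΘ hΘ1 in
lemma meromorphicAt_modelU (k : ℕ) :
    MatrixMeromorphicAt (fun w => S.modelU k (Λ w) fun σ => Θ σ w) 0 := by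
  refine MatrixMeromorphicAt.mul (MatrixMeromorphicAt.mul (MatrixMeromorphicAt.mul
    (MatrixMeromorphicAt.mul (MatrixMeromorphicAt.add (MatrixMeromorphicAt.neg
      (MatrixMeromorphicAt.diagonal fun σ => (analyticAt_pSol hΛ σ k).meromorphicAt))
      ((meromorphicAt_modelE hΘ hΘ1 k).mul (meromorphicAt_modelT hΛ hΘ hΘ1).inv))
      (MatrixMeromorphicAt.const _)) (MatrixMeromorphicAt.const _))
      (MatrixMeromorphicAt.diagonal fun σ => ?_)) (meromorphicAt_modelE hΘ hΘ1 1).inv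
  exact (hΘ σ).meromorphicAt.inv.sub (hΘ σ).meromorphicAt

end meromorphic

variable [Nonempty C] {ω₀ : ℂ} (h0 : ω₀ ≠ 0) (h1 : ‖ω₀‖ ≤ 1)

open scoped Classical in
include h0 h1 in
/-- All points of the closed disk are generic in a punctured neighbourhood of any nonzero
point. -/
theorem eventually_mem_generic : ∀ᶠ ω in diskPunctured ω₀, ω ∈ S.generic := by
  obtain ⟨ζ, Λ, Θ, hζ, hΛ, hΘ, hΘ0, hev⟩ := S.exists_uniformizer h0 h1
  have hΘ1 : ∀ σ, ‖Θ σ 0‖ ≤ 1 := fun σ => by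
    rw [hΘ0]; exact (S.theta_spec σ h0 h1).2.1
  have hne := eventually_ne_zero_diskPunctured h0
  have hle := eventually_mem_diskPunctured ω₀
  -- Points with nonreal `W(ω)` are generic and accumulate at `ω₀`, so none of the three kinds of
  -- meromorphic functions below vanishes identically.
  have hfreq : ∃ᶠ ω in diskPunctured ω₀, ω ∈ S.generic :=
    (frequently_diskPunctured h1).mp (hne.mono fun ω h h' =>
      S.mem_generic_of_W_im_ne_zero h h'.1.le
        (S.W_im_ne_zero (Classical.arbitrary C) h'.1 h'.2))
  have e1 := eventually_ne_zero_of_frequently (S.meromorphicAt_coreMat hΛ).det hζ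
    (hfreq.mp (hev.mono fun ω h h' => by
      rw [← h.1]; exact h'.2.2.1.ne_zero))
  have e2 := eventually_ne_zero_of_frequently (meromorphicAt_modelT (S := S) hΛ hΘ hΘ1).det hζ
    (hfreq.mp ((hev.and (hne.and hle)).mono fun ω h h' => by
      have := h'.2.2.2.1.ne_zero
      rw [S.T_eq_modelT h.2.1 h.2.2.1] at this
      simpa only [← h.1.1, ← h.1.2] using this))
  have e3 : ∀ σ, ∀ᶠ ω in diskPunctured ω₀,
      Θ σ (ζ ω) ^ 1 * S.jostU σ 1 (Θ σ (ζ ω)) ≠ 0 := fun σ =>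
    eventually_ne_zero_of_frequently (analyticAt_jostU_comp (S := S) hΘ hΘ1 σ 1).meromorphicAt hζ
      (hfreq.mp ((hev.and (hne.and hle)).mono fun ω h h' => by
        have := h'.2.2.2.2 σ
        have hθ := S.theta_spec σ h.2.1 h.2.2.1
        rw [S.jost_eq σ hθ.1 hθ.2.1] at this
        rwa [← h.1.2]))
  filter_upwards [e1, e2, eventually_all.2 e3, hev, hne, hle] with ω g1 g2 g3 g4 g5 g6
  refine ⟨g6.1, g5, ?_, ?_, fun σ => ?_⟩
  · rw [g4.1]; exact g1.isUnit
  · rw [S.T_eq_modelT g5 g6.1]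
    simp only [g4.1, g4.2]
    exact g2.isUnit
  · have hθ := S.theta_spec σ g5 g6.1
    rw [S.jost_eq σ hθ.1 hθ.2.1, g4.2]
    exact g3 σ

include h0 h1 in
/-- At each nonzero point of the closed disk an entry of `U` has either a limit or a pole. -/
theorem Uformula_dichotomy (k : ℕ) (γ σ : C) :
    (∃ c, Tendsto (fun ω => S.Uformula k ω γ σ) (diskPunctured ω₀) (𝓝 c)) ∨
      Tendsto (fun ω => ‖S.Uformula k ω γ σ‖) (diskPunctured ω₀) atTop := by
  obtain ⟨ζ, Λ, Θ, hζ, hΛ, hΘ, hΘ0, hev⟩ := S.exists_uniformizer h0 h1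
  have hΘ1 : ∀ σ, ‖Θ σ 0‖ ≤ 1 := fun σ => by
    rw [hΘ0]; exact (S.theta_spec σ h0 h1).2.1
  have heq : (fun ω => S.modelU k (Λ (ζ ω)) (fun σ => Θ σ (ζ ω)) γ σ) =ᶠ[diskPunctured ω₀]
      fun ω => S.Uformula k ω γ σ := by
    filter_upwards [hev, eventually_ne_zero_diskPunctured h0, eventually_mem_diskPunctured ω₀]
      with ω h2 h3 h4
    rw [S.Uformula_eq_modelU h3 h4.1, h2.1]
    simp only [h2.2]
  rcases tendsto_nhds_or_tendsto_norm_atTop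
    (meromorphicAt_modelU (S := S) hΛ hΘ hΘ1 k γ σ) hζ with ⟨c, hc⟩ | h
  · exact Or.inl ⟨c, hc.congr' heq⟩
  · exact Or.inr (h.congr' (heq.fun_comp norm))

end WebSystem

/-! ### Limits of solutions on the central part, and gluing with the channels. -/

namespace WebSystem

variable {𝒜 C : Type*} (S : WebSystem 𝒜 C)

lemma pSol_solves (σ : C) (z : ℂ) : S.SolvesChannel σ z (S.pSol σ z) := fun k => by
  have h := S.bC_ne_zero σ (k + 1)
  rw [pSol]
  field_simp
  ring

lemma continuous_pSol (σ : C) (k : ℕ) : Continuous fun z => S.pSol σ z k := by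
  have : ∀ k, Continuous (fun z => S.pSol σ z k) ∧ Continuous fun z => S.pSol σ z (k + 1) := by
    intro k
    induction k with
    | zero => exact ⟨continuous_const, continuous_const⟩
    | succ k ih =>
      refine ⟨ih.2, ?_⟩
      exact (((continuous_const.sub continuous_id).mul ih.2).sub
        (continuous_const.mul ih.1)).div_const _
  exact (this k).1

/-- The restriction of the Jost solution to the disk is continuous as a function of `ω`. -/
lemma tendsto_jost_theta (σ : C) (k : ℕ) {ω₀ : ℂ} (h0 : ω₀ ≠ 0) (h1 : ‖ω₀‖ ≤ 1) :
    Tendsto (fun ω => S.jost σ (S.theta σ ω) k) (𝓝[Metric.closedBall 0 1] ω₀)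
      (𝓝 (S.jost σ (S.theta σ ω₀) k)) := by
  have hθ := S.continuousOn_theta σ ω₀ (by simpa using h1)
  have hs := S.theta_spec σ h0 h1
  have h2 := (hθ.pow k).mul ((S.analyticAt_jostU σ k hs.2.1).continuousAt.comp_continuousWithinAt hθ)
  rw [S.jost_eq σ hs.1 hs.2.1]
  refine h2.tendsto.congr' ?_
  filter_upwards [self_mem_nhdsWithin, nhdsWithin_le_nhds (isOpen_ne.mem_nhds h0)] with ω h3 h4
  have hs' := S.theta_spec σ h4 (by simpa using h3)
  exact (S.jost_eq σ hs'.1 hs'.2.1 k).symm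

section core_limit

open scoped Classical

lemma coreMat_mulVec_sub (z z' : ℂ) (v : S.core → ℂ) :
    S.coreMat z *ᵥ v = S.coreMat z' *ᵥ v + (z' - z) • v := by
  rw [S.coreMat_eq_sub z, S.coreMat_eq_sub z', Matrix.sub_mulVec, Matrix.sub_mulVec,
    Matrix.smul_mulVec, Matrix.smul_mulVec, Matrix.one_mulVec]
  module

lemma dotProduct_coreMat_mulVec (z : ℂ) (v w : S.core → ℂ) :
    v ⬝ᵥ (S.coreMat z *ᵥ w) = (S.coreMat z *ᵥ v) ⬝ᵥ w := by
  rw [Matrix.dotProduct_mulVec, ← Matrix.mulVec_transpose, coreMat_transpose]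

lemma coreMat_mulVec_star {z : ℂ} (hz : z.im = 0) {v : S.core → ℂ} (hv : S.coreMat z *ᵥ v = 0) :
    S.coreMat z *ᵥ star v = 0 := by
  have hconj : ∀ α β, (starRingEnd ℂ) (S.coreMat z α β) = S.coreMat z α β := by
    intro α β
    rw [Complex.conj_eq_iff_im, coreMat_apply]
    split_ifs <;> simp [hz]
  ext α
  have h := congrArg (starRingEnd ℂ) (congrFun hv α)
  simp only [Matrix.mulVec, dotProduct, map_sum, map_mul, hconj, Pi.zero_apply, map_zero] at h ⊢
  exact h

/-- The functions on the central part orthogonal to the eigenvectors at `z` that are not seen by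
the channels. -/
def visibleSpace (z : ℂ) : Submodule ℂ (S.core → ℂ) where
  carrier := {φ | ∀ v, S.coreMat z *ᵥ v = 0 → (∀ γ, v (S.attach γ) = 0) → v ⬝ᵥ φ = 0}
  add_mem' ha hb v h1 h2 := by rw [dotProduct_add, ha v h1 h2, hb v h1 h2, add_zero]
  zero_mem' v _ _ := dotProduct_zero v
  smul_mem' c φ h v h1 h2 := by rw [dotProduct_smul, h v h1 h2, smul_zero]

/-- The data of a function on the central part which are controlled by the channels. -/
def coreData (z : ℂ) : (S.core → ℂ) →ₗ[ℂ] (S.core → ℂ) × (C → ℂ) :=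
  (S.coreMat z).mulVecLin.prod (LinearMap.funLeft ℂ ℂ S.attach)

open scoped ComplexOrder in
-- For real `z`, a kernel vector `φ` is an invisible eigenvector, and so is its conjugate. Pairing
-- `φ` with that conjugate gives its squared norm, which orthogonality makes zero.
lemma ker_coreData_visibleSpace (z : ℂ) :
    LinearMap.ker ((S.coreData z).comp (S.visibleSpace z).subtype) = ⊥ := by
  rw [LinearMap.ker_eq_bot']
  rintro ⟨φ, hφ⟩ h
  have h1 : S.coreMat z *ᵥ φ = 0 := congrArg Prod.fst h
  have h2 : ∀ γ, φ (S.attach γ) = 0 := fun γ => congrFun (congrArg Prod.snd h) γ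
  rw [Submodule.mk_eq_zero]
  by_cases hz : z.im = 0
  · have h3 := hφ (star φ) (S.coreMat_mulVec_star hz h1) fun γ => by simp [h2 γ]
    exact dotProduct_star_self_eq_zero.1 h3
  · by_contra hne
    exact (S.isUnit_det_coreMat hz).ne_zero (Matrix.exists_mulVec_eq_zero_iff.1 ⟨φ, hne, h1⟩)

variable [Fintype C]

lemma continuous_source : Continuous S.source := by
  refine continuous_pi fun α => ?_
  refine continuous_finsetSum _ fun γ _ => ?_
  split_ifs
  · exact continuous_const.mul (continuous_apply γ)
  · exact continuous_const

/-- Solvability on the central part persists in the limit, also at eigenvalues of the central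
matrix. -/
theorem exists_core_solution_of_tendsto {X : Type*} {l : Filter X} [l.NeBot] {Z : X → ℂ} {z₀ : ℂ}
    (hZ : Tendsto Z l (𝓝 z₀)) (hne : ∀ᶠ x in l, Z x ≠ z₀) {f g : X → C → ℂ} {f₀ g₀ : C → ℂ}
    (hf : Tendsto f l (𝓝 f₀)) (hg : Tendsto g l (𝓝 g₀))
    (h : ∀ᶠ x in l, ∃ φ, S.coreMat (Z x) *ᵥ φ = S.source (f x) ∧
      ∀ γ, φ (S.attach γ) = g x γ) :
    ∃ φ, S.coreMat z₀ *ᵥ φ = S.source f₀ ∧ ∀ γ, φ (S.attach γ) = g₀ γ := by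
  set M := (S.coreData z₀).comp (S.visibleSpace z₀).subtype with hM
  have hker := S.ker_coreData_visibleSpace z₀
  obtain ⟨φ, hφ⟩ : ∃ φ : X → S.visibleSpace z₀, ∀ᶠ x in l,
      S.coreMat (Z x) *ᵥ (φ x : S.core → ℂ) = S.source (f x) ∧
        ∀ γ, (φ x : S.core → ℂ) (S.attach γ) = g x γ := by
    refine Eventually.choice (l := l) (r := fun x (φ : S.visibleSpace z₀) =>
      S.coreMat (Z x) *ᵥ (φ : S.core → ℂ) = S.source (f x) ∧
        ∀ γ, (φ : S.core → ℂ) (S.attach γ) = g x γ) ?_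
    filter_upwards [h, hne] with x hx hxne
    obtain ⟨φ, h1, h2⟩ := hx
    refine ⟨⟨φ, fun v hv hva => ?_⟩, h1, h2⟩
    -- A solution at `Z x ≠ z₀` is automatically orthogonal to the invisible eigenvectors at `z₀`:
    -- the source pairs to zero with them, leaving `(z₀ - Z x)` times the pairing with the solution.
    have h3 := S.dotProduct_coreMat_mulVec (Z x) v φ
    rw [h1, dotProduct_source, S.coreMat_mulVec_sub (Z x) z₀ v, hv, zero_add, smul_dotProduct,
      Finset.sum_eq_zero fun γ _ => by rw [hva γ, zero_mul]] at h3
    exact (smul_eq_zero.1 h3.symm).resolve_left (sub_ne_zero.2 hxne.symm)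
  set F : X → (S.core → ℂ) × (C → ℂ) := fun x => (S.source (f x), g x) with hF
  have hFlim : Tendsto F l (𝓝 (S.source f₀, g₀)) :=
    ((S.continuous_source.tendsto f₀).comp hf).prodMk_nhds hg
  have hMφ : ∀ᶠ x in l, M (φ x) = F x + (Z x - z₀) • ((φ x : S.core → ℂ), (0 : C → ℂ)) := by
    filter_upwards [hφ] with x hx
    refine Prod.ext ?_ ?_
    · change S.coreMat z₀ *ᵥ (φ x : S.core → ℂ) = S.source (f x) + (Z x - z₀) • _
      rw [S.coreMat_mulVec_sub z₀ (Z x), hx.1]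
    · change (fun γ => (φ x : S.core → ℂ) (S.attach γ)) = g x + (Z x - z₀) • 0
      rw [smul_zero, add_zero]
      exact funext hx.2
  -- Injectivity in finite dimension gives a lower bound for `M`. Once `‖Z x - z₀‖ < 1 / (2c)`, the
  -- perturbation term takes up at most half of `‖φ x‖`, so the solutions stay bounded.
  obtain ⟨c, hc0, hc⟩ := M.exists_antilipschitzWith hker
  have hcle : ∀ ψ, ‖ψ‖ ≤ c * ‖M ψ‖ := fun ψ => by
    simpa using hc.le_mul_dist ψ 0
  have hZ0 : Tendsto (fun x => ‖Z x - z₀‖) l (𝓝 0) := by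
    have := (hZ.sub_const z₀).norm
    simpa using this
  have hpair : ∀ ψ : S.visibleSpace z₀, ‖((ψ : S.core → ℂ), (0 : C → ℂ))‖ = ‖ψ‖ := fun ψ => by
    rw [Prod.norm_def, norm_zero, max_eq_left (norm_nonneg _)]
    rfl
  have hc0' : (0 : ℝ) < c := hc0
  have hbd : ∀ᶠ x in l, ‖φ x‖ ≤ 2 * c * (‖(S.source f₀, g₀)‖ + 1) := by
    have hsmall : ∀ᶠ x in l, ‖Z x - z₀‖ < (2 * (c : ℝ))⁻¹ :=
      hZ0.eventually_lt_const (by positivity)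
    have hFb : ∀ᶠ x in l, ‖F x‖ < ‖(S.source f₀, g₀)‖ + 1 :=
      hFlim.norm.eventually_lt_const (lt_add_one _)
    filter_upwards [hMφ, hsmall, hFb] with x h1 h2 h3
    have h4 := hcle (φ x)
    have h5 : ‖M (φ x)‖ ≤ ‖F x‖ + ‖Z x - z₀‖ * ‖φ x‖ := by
      rw [h1]
      refine (norm_add_le _ _).trans ?_
      rw [norm_smul, hpair]
    have h6 : ‖Z x - z₀‖ * ‖φ x‖ ≤ (2 * (c : ℝ))⁻¹ * ‖φ x‖ := by gcongr
    have h7 : ‖φ x‖ ≤ c * (‖F x‖ + (2 * (c : ℝ))⁻¹ * ‖φ x‖) :=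
      h4.trans (by gcongr; exact h5.trans (by gcongr))
    have h8 : (c : ℝ) * ((2 * (c : ℝ))⁻¹ * ‖φ x‖) = ‖φ x‖ / 2 := by field_simp
    rw [mul_add, h8] at h7
    have h9 : (c : ℝ) * ‖F x‖ ≤ c * (‖(S.source f₀, g₀)‖ + 1) := by gcongr
    linarith
  have hzero : Tendsto (fun x => (Z x - z₀) • ((φ x : S.core → ℂ), (0 : C → ℂ))) l (𝓝 0) := by
    rw [tendsto_zero_iff_norm_tendsto_zero]
    have h1 := hZ0.mul_const (2 * c * (‖(S.source f₀, g₀)‖ + 1))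
    rw [zero_mul] at h1
    refine squeeze_zero' (Eventually.of_forall fun _ => norm_nonneg _) ?_ h1
    filter_upwards [hbd] with x hx
    rw [norm_smul, hpair]
    exact mul_le_mul_of_nonneg_left hx (norm_nonneg _)
  have hlim : Tendsto (fun x => M (φ x)) l (𝓝 (S.source f₀, g₀)) := by
    have := hFlim.add hzero
    rw [add_zero] at this
    exact this.congr' (hMφ.mono fun _ h => h.symm)
  -- The solutions themselves need not be shown to converge: closedness of the range of `M` turns
  -- the limit of the data into the data of a solution.
  have hmem := (LinearMap.isClosedEmbedding_of_injective hker).isClosed_range.mem_of_tendsto hlim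
    (Eventually.of_forall fun x => ⟨φ x, rfl⟩)
  obtain ⟨ψ, hψ⟩ := hmem
  exact ⟨ψ, congrArg Prod.fst hψ, fun γ => congrFun (congrArg Prod.snd hψ) γ⟩

end core_limit

section assembly

open scoped Classical

variable {S}

/-- A function on all particles assembled from its values on the central part and on the
channels. -/
def glue (S : WebSystem 𝒜 C) (φ : S.core → ℂ) (u : C → ℕ → ℂ) (α : 𝒜) : ℂ :=
  if h : α ∈ S.core then φ ⟨α, h⟩ else
    Classical.epsilon fun w => ∃ γ k, α = S.chan γ (k + 1) ∧ w = u γ (k + 1)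

variable {φ : S.core → ℂ} {u : C → ℕ → ℂ}

lemma chan_succ_not_mem_core (γ : C) (k : ℕ) : S.chan γ (k + 1) ∉ S.core := fun h => h γ k rfl

lemma glue_core (α : S.core) : S.glue φ u α = φ α := by
  rw [glue, dif_pos α.2]

lemma glue_chan (h : ∀ γ, φ (S.attach γ) = u γ 0) (γ : C) (k : ℕ) :
    S.glue φ u (S.chan γ k) = u γ k := by
  cases k with
  | zero => rw [← h γ]; exact glue_core (S.attach γ)
  | succ k =>
    rw [glue, dif_neg (chan_succ_not_mem_core γ k)]
    have hex : ∃ w, ∃ ν j, S.chan γ (k + 1) = S.chan ν (j + 1) ∧ w = u ν (j + 1) :=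
      ⟨_, γ, k, rfl, rfl⟩
    obtain ⟨ν, j, h1, h2⟩ := Classical.epsilon_spec hex
    rw [h2]
    have := @S.chan_injective (γ, k + 1) (ν, j + 1) h1
    simp only [Prod.mk.injEq] at this
    rw [this.1, this.2]

lemma finsum_chan (ψ : 𝒜 → ℂ) (γ : C) (k : ℕ) :
    ∑ᶠ β, (S.L (S.chan γ (k + 1)) β : ℂ) * ψ β = -(S.bC γ k : ℂ) * ψ (S.chan γ k) +
      (S.aC γ (k + 1) : ℂ) * ψ (S.chan γ (k + 1)) -
        (S.bC γ (k + 1) : ℂ) * ψ (S.chan γ (k + 2)) := by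
  have hne : ∀ i j, i ≠ j → S.chan γ i ≠ S.chan γ j := fun i j hij h => hij (by
    have := @S.chan_injective (γ, i) (γ, j) h
    simpa using this)
  rw [finsum_eq_sum_of_support_subset
    (s := {S.chan γ k, S.chan γ (k + 1), S.chan γ (k + 2)})]
  · rw [Finset.sum_insert, Finset.sum_insert, Finset.sum_singleton]
    · rw [bC, bC, aC, S.L_symm (S.chan γ (k + 1)) (S.chan γ k)]
      push_cast
      ring
    · simpa using hne _ _ (by omega)
    · simpa using ⟨hne _ _ (by omega), hne _ _ (by omega)⟩
  · intro β hβ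
    have hL : S.L (S.chan γ (k + 1)) β ≠ 0 := by
      intro h
      simp [h] at hβ
    simpa using S.chan_interaction γ k β hL

lemma L_core_chan_one (α : S.core) (γ : C) :
    S.L α (S.chan γ 1) = if S.attach γ = α then -S.bC γ 0 else 0 := by
  split_ifs with h
  · rw [← h, bC, neg_neg]; rfl
  · by_contra hL
    rw [S.L_symm] at hL
    rcases S.chan_interaction γ 0 α hL with h' | h' | h'
    · exact h (Subtype.ext h'.symm)
    · exact α.2 γ 0 h'
    · exact α.2 γ 1 h'

variable [Fintype C]

lemma finsum_core (ψ : 𝒜 → ℂ) (α : S.core) :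
    ∑ᶠ β, (S.L α β : ℂ) * ψ β = ∑ β : S.core, (S.L α β : ℂ) * ψ β -
      S.source (fun γ => ψ (S.chan γ 1)) α := by
  have hdisj : Disjoint (Finset.univ.map (Function.Embedding.subtype (· ∈ S.core)))
      (Finset.univ.image fun γ => S.chan γ 1) := by
    rw [Finset.disjoint_left]
    intro β h1 h2
    obtain ⟨β, -, rfl⟩ := Finset.mem_map.1 h1
    obtain ⟨γ, -, h⟩ := Finset.mem_image.1 h2
    exact β.2 γ 0 h.symm
  have hinj : Set.InjOn (fun γ => S.chan γ 1) (Finset.univ : Finset C) := fun γ _ ν _ h => by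
    have := @S.chan_injective (γ, 1) (ν, 1) h
    simpa using this
  rw [finsum_eq_sum_of_support_subset (s := Finset.univ.map
    (Function.Embedding.subtype (· ∈ S.core)) ∪ Finset.univ.image fun γ => S.chan γ 1),
    Finset.sum_union hdisj, Finset.sum_map, Finset.sum_image hinj, sub_eq_add_neg, source,
    ← Finset.sum_neg_distrib]
  · congr 1
    refine Finset.sum_congr rfl fun γ _ => ?_
    rw [L_core_chan_one]
    split_ifs <;> simp
  · intro β hβ
    have hL : S.L α β ≠ 0 := by
      intro h
      simp [h] at hβ
    simp only [Finset.coe_union, Finset.coe_map, Finset.coe_univ, Set.image_univ,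
      Finset.coe_image, Set.mem_union]
    by_cases hc : β ∈ S.core
    · exact Or.inl ⟨⟨β, hc⟩, rfl⟩
    · right
      have : ∃ γ k, β = S.chan γ (k + 1) := by
        by_contra! h
        exact hc h
      obtain ⟨γ, k, rfl⟩ := this
      rw [S.L_symm] at hL
      rcases S.chan_interaction γ k α hL with h' | h' | h'
      · cases k with
        | zero => exact ⟨γ, rfl⟩
        | succ k => exact absurd h' (α.2 γ k)
      · exact absurd h' (α.2 γ k)
      · exact absurd h' (α.2 γ (k + 1))

/-- A solution on the central part and solutions on the channels that match at the attachment
points form a solution on the whole system. -/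
theorem glue_equation {z : ℂ} (hφ : S.coreMat z *ᵥ φ = S.source fun γ => u γ 1)
    (hu : ∀ γ, S.SolvesChannel γ z (u γ)) (h0 : ∀ γ, φ (S.attach γ) = u γ 0) (α : 𝒜) :
    ∑ᶠ β, (S.L α β : ℂ) * S.glue φ u β = z * S.glue φ u α := by
  by_cases hα : α ∈ S.core
  · have h1 := finsum_core (S.glue φ u) ⟨α, hα⟩
    rw [h1]
    simp only [glue_chan h0, glue_core]
    have h2 := congrFun hφ ⟨α, hα⟩
    rw [← h2, coreMat_eq_sub, Matrix.sub_mulVec, Matrix.smul_mulVec, Matrix.one_mulVec,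
      Pi.sub_apply, Pi.smul_apply, smul_eq_mul]
    have h3 : (S.coreMat 0 *ᵥ φ) ⟨α, hα⟩ = ∑ β : S.core, (S.L α β : ℂ) * φ β := by
      rw [Matrix.mulVec, dotProduct]
      refine Finset.sum_congr rfl fun β _ => ?_
      rw [coreMat_apply]; simp
    rw [h3, show S.glue φ u α = φ ⟨α, hα⟩ from glue_core ⟨α, hα⟩]
    ring
  · obtain ⟨γ, k, rfl⟩ : ∃ γ k, α = S.chan γ (k + 1) := by
      by_contra! h
      exact hα h
    rw [finsum_chan, glue_chan h0, glue_chan h0, glue_chan h0]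
    exact hu γ k

end assembly

end WebSystem

/-! ### The matrix `U` at generic points, special solutions off `Ω`, and reciprocity. -/

lemma tendsto_matrix_inv {X n : Type*} [Fintype n] [DecidableEq n] {l : Filter X}
    {A : X → Matrix n n ℂ} {A₀ : Matrix n n ℂ} (hA : Tendsto A l (𝓝 A₀)) (h : IsUnit A₀.det) :
    Tendsto (fun x => (A x)⁻¹) l (𝓝 A₀⁻¹) := by
  refine (continuousAt_matrix_inv A₀ ?_).tendsto.comp hA
  rw [Ring.inverse_eq_inv']
  exact continuousAt_inv₀ h.ne_zero

lemma tendsto_matrix_apply {X m n : Type*} {l : Filter X} {A : X → Matrix m n ℂ}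
    {A₀ : Matrix m n ℂ} (hA : Tendsto A l (𝓝 A₀)) (i : m) (j : n) :
    Tendsto (fun x => A x i j) l (𝓝 (A₀ i j)) :=
  tendsto_pi_nhds.1 (tendsto_pi_nhds.1 hA i) j

lemma tendsto_matrix_diagonal {X n : Type*} [DecidableEq n] {l : Filter X} {v : X → n → ℂ}
    {v₀ : n → ℂ} (hv : ∀ i, Tendsto (fun x => v x i) l (𝓝 (v₀ i))) :
    Tendsto (fun x => Matrix.diagonal (v x)) l (𝓝 (Matrix.diagonal v₀)) :=
  (continuous_id.matrix_diagonal.tendsto v₀).comp (tendsto_pi_nhds.2 hv)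

lemma Matrix.inv_diagonal_of_ne_zero {n : Type*} [Fintype n] [DecidableEq n] {v : n → ℂ}
    (h : ∀ i, v i ≠ 0) : (Matrix.diagonal v)⁻¹ = Matrix.diagonal fun i => (v i)⁻¹ := by
  refine Matrix.inv_eq_right_inv ?_
  rw [Matrix.diagonal_mul_diagonal, ← Matrix.diagonal_one]
  congr 1
  ext i
  exact mul_inv_cancel₀ (h i)

namespace WebSystem

variable {𝒜 C : Type*} (S : WebSystem 𝒜 C)

section

open scoped Classical

lemma tendsto_coreMat {X : Type*} {l : Filter X} {Z : X → ℂ} {z₀ : ℂ} (hZ : Tendsto Z l (𝓝 z₀)) :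
    Tendsto (fun x => S.coreMat (Z x)) l (𝓝 (S.coreMat z₀)) :=
  tendsto_const_nhds.sub (hZ.smul_const _)

lemma tendsto_resolvent {X : Type*} {l : Filter X} {Z : X → ℂ} {z₀ : ℂ}
    (hZ : Tendsto Z l (𝓝 z₀)) (h : IsUnit (S.coreMat z₀).det) :
    Tendsto (fun x => S.resolvent (Z x)) l (𝓝 (S.resolvent z₀)) :=
  tendsto_pi_nhds.2 fun σ => tendsto_pi_nhds.2 fun ν =>
    tendsto_matrix_apply (tendsto_matrix_inv (S.tendsto_coreMat hZ) h) (S.attach σ) (S.attach ν)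

end

variable [DecidableEq C] [Fintype C]

/-- The diagonal entries of `B B(0)⁻¹ D(ω) ℰ(1, ω)⁻¹`. -/
def incoming (ω : ℂ) (σ : C) : ℂ :=
  S.bLim σ * (S.bC σ 0 : ℂ)⁻¹ * ((S.theta σ ω)⁻¹ - S.theta σ ω) * (S.jost σ (S.theta σ ω) 1)⁻¹

variable {S} {ω ω₀ : ℂ}

lemma generic_theta (h : ω ∈ S.generic) (σ : C) :
    S.theta σ ω ≠ 0 ∧ ‖S.theta σ ω‖ ≤ 1 ∧ S.Wc σ (S.theta σ ω) = S.W ω :=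
  have := S.theta_spec σ h.2.1 h.1
  ⟨this.1, this.2.1, this.2.2.1⟩

lemma generic_jost_solves (h : ω ∈ S.generic) (σ : C) :
    S.SolvesChannel σ (S.W ω) (S.jost σ (S.theta σ ω)) := by
  have h' := generic_theta h σ
  rw [← h'.2.2]
  exact S.jost_solves σ h'.1 h'.2.1

lemma Uformula_eq (h : ω ∈ S.generic) (k : ℕ) :
    S.Uformula k ω = (-S.P k ω + S.E k ω * (S.T ω)⁻¹) * Matrix.diagonal (S.incoming ω) := by
  rw [Uformula, B0, E, Matrix.inv_diagonal_of_ne_zero (fun σ => S.bC_ne_zero σ 0), E,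
    Matrix.inv_diagonal_of_ne_zero h.2.2.2.2, B, D]
  simp only [Matrix.mul_assoc, Matrix.diagonal_mul_diagonal]
  rfl

lemma Uformula_apply (h : ω ∈ S.generic) (k : ℕ) (γ σ : C) :
    S.Uformula k ω γ σ = (-(if γ = σ then S.pSol γ (S.W ω) k else 0) +
      S.jost γ (S.theta γ ω) k * (S.T ω)⁻¹ γ σ) * S.incoming ω σ := by
  rw [Uformula_eq h, Matrix.mul_diagonal, Matrix.add_apply, Matrix.neg_apply, E,
    Matrix.diagonal_mul, P, Matrix.diagonal_apply]

lemma Uformula_off_diag (h : ω ∈ S.generic) (k : ℕ) {γ σ : C} (hne : γ ≠ σ) :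
    S.Uformula k ω γ σ = (S.T ω)⁻¹ γ σ * S.incoming ω σ * S.jost γ (S.theta γ ω) k := by
  rw [Uformula_apply h, if_neg hne]
  ring

lemma Uformula_solves (h : ω ∈ S.generic) (γ σ : C) :
    S.SolvesChannel γ (S.W ω) fun k => S.Uformula k ω γ σ := by
  intro k
  have h1 := generic_jost_solves h γ k
  have h2 := S.pSol_solves γ (S.W ω) k
  simp only [Uformula_apply h]
  split_ifs
  · linear_combination (S.incoming ω σ * (S.T ω)⁻¹ γ σ) * h1 - S.incoming ω σ * h2
  · linear_combination (S.incoming ω σ * (S.T ω)⁻¹ γ σ) * h1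

/-- The Jost part of `U` drops out, and `p(0) = 1`, `p(1) = 0` leave `𝔟(0) e(1)` times the incoming
factor. The right factor in the formula for `U` is normalised so that this equals the Wronskian of
the Jost solutions for `θ` and `θ⁻¹`. -/
lemma Uformula_wronskian (h : ω ∈ S.generic) (σ : C) :
    (S.bC σ 0 : ℂ) * (S.jost σ (S.theta σ ω) 0 * S.Uformula 1 ω σ σ -
      S.jost σ (S.theta σ ω) 1 * S.Uformula 0 ω σ σ) =
      S.bLim σ * ((S.theta σ ω)⁻¹ - S.theta σ ω) := by
  have h1 := h.2.2.2.2 σ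
  have h2 := S.bC_ne_zero σ 0
  rw [Uformula_apply h, Uformula_apply h, if_pos rfl, if_pos rfl, pSol, pSol]
  have : S.incoming ω σ * ((S.bC σ 0 : ℂ) * S.jost σ (S.theta σ ω) 1) =
      S.bLim σ * ((S.theta σ ω)⁻¹ - S.theta σ ω) := by
    rw [incoming]
    field_simp
  linear_combination this

/-- The matching condition is `U(0) = ℛ B(0) U(1)`. It follows from `P(0) = 1`, `P(1) = 0` and `ℛ
B(0) ℰ(1) = ℰ(0) - T`; the latter is why `T` has its form. -/
lemma exists_core_solution_generic (h : ω ∈ S.generic) (σ : C) :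
    ∃ φ, S.coreMat (S.W ω) *ᵥ φ = S.source (fun γ => S.Uformula 1 ω γ σ) ∧
      ∀ γ, φ (S.attach γ) = S.Uformula 0 ω γ σ := by
  classical
  refine ⟨(S.coreMat (S.W ω))⁻¹ *ᵥ S.source (fun γ => S.Uformula 1 ω γ σ), ?_, fun γ => ?_⟩
  · rw [Matrix.mulVec_mulVec, Matrix.mul_nonsing_inv, Matrix.one_mulVec]
    convert h.2.2.1
  · have h1 : S.Uformula 0 ω = S.resolvent (S.W ω) * S.B0 * S.Uformula 1 ω := by
      have hP0 : S.P 0 ω = 1 := by rw [P, ← Matrix.diagonal_one]; rfl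
      have hP1 : S.P 1 ω = 0 := by rw [P, ← Matrix.diagonal_zero]; rfl
      rw [Uformula_eq h, Uformula_eq h, hP0, hP1, neg_zero, zero_add, ← Matrix.mul_assoc,
        ← Matrix.mul_assoc]
      congr 1
      have h2 : S.resolvent (S.W ω) * S.B0 * S.E 1 ω = S.E 0 ω - S.T ω := by
        rw [T, sub_sub_cancel]
      rw [h2, Matrix.sub_mul, Matrix.mul_nonsing_inv _ h.2.2.2.1, neg_add_eq_sub]
    have h3 := S.inv_mulVec_source (S.W ω) (fun γ => S.Uformula 1 ω γ σ) γ
    rw [h1]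
    convert h3
    rfl

section continuity

variable (h : ω₀ ∈ S.generic)

include h

lemma tendsto_theta_generic (σ : C) :
    Tendsto (S.theta σ) (𝓝[S.generic] ω₀) (𝓝 (S.theta σ ω₀)) :=
  (S.continuousOn_theta σ ω₀ (by simpa using h.1)).mono_left
    (nhdsWithin_mono _ fun ω hω => by simpa using hω.1)

lemma tendsto_W_generic : Tendsto S.W (𝓝[S.generic] ω₀) (𝓝 (S.W ω₀)) :=
  (S.continuousAt_W h.2.1).tendsto.mono_left nhdsWithin_le_nhds

lemma tendsto_jost_generic (σ : C) (k : ℕ) :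
    Tendsto (fun ω => S.jost σ (S.theta σ ω) k) (𝓝[S.generic] ω₀)
      (𝓝 (S.jost σ (S.theta σ ω₀) k)) :=
  (S.tendsto_jost_theta σ k h.2.1 h.1).mono_left
    (nhdsWithin_mono _ fun ω hω => by simpa using hω.1)

lemma tendsto_T_generic : Tendsto S.T (𝓝[S.generic] ω₀) (𝓝 (S.T ω₀)) :=
  (tendsto_matrix_diagonal fun σ => tendsto_jost_generic h σ 0).sub
    (((S.tendsto_resolvent (tendsto_W_generic h) (by convert h.2.2.1)).mul_const _).mul
      (tendsto_matrix_diagonal fun σ => tendsto_jost_generic h σ 1))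

lemma tendsto_incoming_generic (σ : C) :
    Tendsto (fun ω => S.incoming ω σ) (𝓝[S.generic] ω₀) (𝓝 (S.incoming ω₀ σ)) :=
  (((tendsto_theta_generic h σ).inv₀ (generic_theta h σ).1).sub
    (tendsto_theta_generic h σ)).const_mul _ |>.mul
      ((tendsto_jost_generic h σ 1).inv₀ (h.2.2.2.2 σ))

lemma tendsto_Uformula_generic (k : ℕ) (γ σ : C) :
    Tendsto (fun ω => S.Uformula k ω γ σ) (𝓝[S.generic] ω₀) (𝓝 (S.Uformula k ω₀ γ σ)) := by
  have hT := tendsto_matrix_apply (tendsto_matrix_inv (tendsto_T_generic h) h.2.2.2.1) γ σ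
  have hp := ((S.continuous_pSol γ k).tendsto (S.W ω₀)).comp (tendsto_W_generic h)
  have hp' : Tendsto (fun ω => if γ = σ then S.pSol γ (S.W ω) k else 0) (𝓝[S.generic] ω₀)
      (𝓝 (if γ = σ then S.pSol γ (S.W ω₀) k else 0)) := by
    split_ifs
    · exact hp
    · exact tendsto_const_nhds
  rw [Uformula_apply h]
  refine ((hp'.neg.add ((tendsto_jost_generic h γ k).mul hT)).mul
    (tendsto_incoming_generic h σ)).congr' ?_
  filter_upwards [self_mem_nhdsWithin] with ω hω
  exact (Uformula_apply hω k γ σ).symm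

end continuity

variable [Nonempty C]

section limit

variable (h0 : ω₀ ≠ 0) (h1 : ‖ω₀‖ ≤ 1) (hΩ : ω₀ ∉ S.Omega)

include h0 h1

lemma diskPunctured_le_generic : diskPunctured ω₀ ≤ 𝓝[S.generic] ω₀ :=
  le_inf nhdsWithin_le_nhds (le_principal_iff.2 (S.eventually_mem_generic h0 h1))

lemma generic_neBot : (𝓝[S.generic] ω₀).NeBot :=
  (diskPunctured_neBot h1).mono (diskPunctured_le_generic h0 h1)

include hΩ

/-- Outside `Ω` the matrix function `U` has limits. -/
lemma exists_tendsto_Uformula (k : ℕ) (γ σ : C) :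
    ∃ c, Tendsto (fun ω => S.Uformula k ω γ σ) (𝓝[S.generic] ω₀) (𝓝 c) := by
  -- If `ω₀` is generic, the filter includes the point itself, so the dichotomy on the punctured
  -- disk is not enough and continuity of the formula is used.
  by_cases hg : ω₀ ∈ S.generic
  · exact ⟨_, tendsto_Uformula_generic hg k γ σ⟩
  · have hle : 𝓝[S.generic] ω₀ ≤ diskPunctured ω₀ := nhdsWithin_mono _ fun ω hω =>
      ⟨by simpa using hω.1, fun h => hg (by rwa [← Set.mem_singleton_iff.1 h])⟩
    rcases S.Uformula_dichotomy h0 h1 k γ σ with ⟨c, hc⟩ | h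
    · exact ⟨c, hc.mono_left hle⟩
    · exact absurd ⟨h1, h0, k, γ, σ, h.mono_left hle⟩ hΩ

lemma tendsto_U (k : ℕ) (γ σ : C) :
    Tendsto (fun ω => S.Uformula k ω γ σ) (𝓝[S.generic] ω₀) (𝓝 (S.U k ω₀ γ σ)) :=
  tendsto_nhds_limUnder (exists_tendsto_Uformula h0 h1 hΩ k γ σ)

lemma tendsto_U_diskPunctured (k : ℕ) (γ σ : C) :
    Tendsto (fun ω => S.Uformula k ω γ σ) (diskPunctured ω₀) (𝓝 (S.U k ω₀ γ σ)) :=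
  (tendsto_U h0 h1 hΩ k γ σ).mono_left (diskPunctured_le_generic h0 h1)

omit [DecidableEq C] [Fintype C] [Nonempty C] hΩ in
lemma tendsto_jost_diskPunctured (σ : C) (k : ℕ) :
    Tendsto (fun ω => S.jost σ (S.theta σ ω) k) (diskPunctured ω₀)
      (𝓝 (S.jost σ (S.theta σ ω₀) k)) :=
  (S.tendsto_jost_theta σ k h0 h1).mono_left (nhdsWithin_mono _ Set.sdiff_subset)

lemma U_solves (γ σ : C) : S.SolvesChannel γ (S.W ω₀) fun k => S.U k ω₀ γ σ := by
  have := diskPunctured_neBot h1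
  refine SolvesChannel.tendsto_of_eventually (l := diskPunctured ω₀) (Z := S.W)
    (X := fun ω k => S.Uformula k ω γ σ) ?_ (tendsto_W_diskPunctured h0)
    (fun k => tendsto_U_diskPunctured h0 h1 hΩ k γ σ)
  filter_upwards [S.eventually_mem_generic h0 h1] with ω hω using Uformula_solves hω γ σ

lemma U_wronskian (σ : C) :
    (S.bC σ 0 : ℂ) * (S.jost σ (S.theta σ ω₀) 0 * S.U 1 ω₀ σ σ -
      S.jost σ (S.theta σ ω₀) 1 * S.U 0 ω₀ σ σ) =
      S.bLim σ * ((S.theta σ ω₀)⁻¹ - S.theta σ ω₀) := by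
  have := diskPunctured_neBot h1
  have hθ := tendsto_theta_diskPunctured (S := S) h1 σ
  refine tendsto_nhds_unique_of_eventuallyEq (l := diskPunctured ω₀)
    ((((tendsto_jost_diskPunctured h0 h1 σ 0).mul
      (tendsto_U_diskPunctured h0 h1 hΩ 1 σ σ)).sub ((tendsto_jost_diskPunctured h0 h1 σ 1).mul
      (tendsto_U_diskPunctured h0 h1 hΩ 0 σ σ))).const_mul _)
    (((hθ.inv₀ (S.theta_spec σ h0 h1).1).sub hθ).const_mul _) ?_
  filter_upwards [S.eventually_mem_generic h0 h1] with ω hω using Uformula_wronskian hω σ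

/-- At generic points the column is a multiple of the Jost solution. The vanishing Wronskian passes
to the limit, and the limiting Jost solution is still nontrivial, so proportionality persists
without controlling the coefficient. -/
lemma exists_U_eq_mul_jost {γ σ : C} (hne : γ ≠ σ) :
    ∃ s, ∀ k, S.U k ω₀ γ σ = s * S.jost γ (S.theta γ ω₀) k := by
  have := diskPunctured_neBot h1
  have hs := S.theta_spec γ h0 h1
  have hj := S.jost_solves γ hs.1 hs.2.1
  rw [hs.2.2.1] at hj
  refine hj.exists_eq_mul (U_solves h0 h1 hΩ γ σ) (S.jost_ne_zero γ hs.1 hs.2.1) ?_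
  refine tendsto_nhds_unique_of_eventuallyEq (l := diskPunctured ω₀)
    (((tendsto_jost_diskPunctured h0 h1 γ 0).mul
      (tendsto_U_diskPunctured h0 h1 hΩ 1 γ σ)).sub ((tendsto_jost_diskPunctured h0 h1 γ 1).mul
      (tendsto_U_diskPunctured h0 h1 hΩ 0 γ σ))) tendsto_const_nhds ?_
  filter_upwards [S.eventually_mem_generic h0 h1] with ω hω
  rw [Uformula_off_diag hω 1 hne, Uformula_off_diag hω 0 hne]
  ring

lemma exists_core_solution (σ : C) :
    ∃ φ, S.coreMat (S.W ω₀) *ᵥ φ = S.source (fun γ => S.U 1 ω₀ γ σ) ∧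
      ∀ γ, φ (S.attach γ) = S.U 0 ω₀ γ σ := by
  have := diskPunctured_neBot h1
  refine S.exists_core_solution_of_tendsto (l := diskPunctured ω₀) (Z := S.W)
    (f := fun ω γ => S.Uformula 1 ω γ σ) (g := fun ω γ => S.Uformula 0 ω γ σ)
    (tendsto_W_diskPunctured h0) (eventually_W_ne h0 (S.b_pos σ).ne')
    (tendsto_pi_nhds.2 fun γ => tendsto_U_diskPunctured h0 h1 hΩ 1 γ σ)
    (tendsto_pi_nhds.2 fun γ => tendsto_U_diskPunctured h0 h1 hΩ 0 γ σ) ?_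
  filter_upwards [S.eventually_mem_generic h0 h1] with ω hω
  exact exists_core_solution_generic hω σ

/-- Existence of the special solutions outside `Ω`. -/
theorem exists_hasScattering (σ : C) : ∃ s, S.HasScattering σ ω₀ s := by
  obtain ⟨φ, hφ1, hφ0⟩ := exists_core_solution h0 h1 hΩ σ
  have htr : ∀ γ, ∃ s, γ ≠ σ → ∀ k, S.U k ω₀ γ σ = s * S.jost γ (S.theta γ ω₀) k := fun γ => by
    by_cases hne : γ = σ
    · exact ⟨0, fun h => absurd hne h⟩
    · obtain ⟨s, hs⟩ := exists_U_eq_mul_jost h0 h1 hΩ hne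
      exact ⟨s, fun _ => hs⟩
  choose s hs using htr
  obtain ⟨hθ0, hθ1, hW, -⟩ := S.theta_spec σ h0 h1
  have hsol := U_solves h0 h1 hΩ σ σ
  rw [← hW] at hsol
  have hwr := U_wronskian h0 h1 hΩ σ
  obtain ⟨r, hr⟩ : ∃ r, ‖S.theta σ ω₀‖ = 1 → ∀ k, S.U k ω₀ σ σ =
      S.jost σ (S.theta σ ω₀)⁻¹ k + r * S.jost σ (S.theta σ ω₀) k := by
    by_cases hn : ‖S.theta σ ω₀‖ = 1
    · obtain ⟨r, hr⟩ := S.exists_eq_jost_inv_add hn hsol hwr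
      exact ⟨r, fun _ => hr⟩
    · exact ⟨0, fun h => absurd h hn⟩
  have hchan := glue_chan (S := S) (u := fun γ k => S.U k ω₀ γ σ) hφ0
  refine ⟨Function.update s σ r, S.glue φ fun γ k => S.U k ω₀ γ σ, ⟨?_, ?_, ?_, ?_⟩, hchan⟩
  · exact glue_equation hφ1 (fun γ => U_solves h0 h1 hΩ γ σ) hφ0
  · intro γ hne k
    rw [hchan, Function.update_of_ne hne, hs γ hne]
  · intro hn k
    rw [hchan, Function.update_self, hr hn]
  · intro hn
    simp only [hchan]
    exact S.tendsto_div_of_wronskian hθ0 hn hsol hwr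

theorem hasScattering_scat (σ : C) : S.HasScattering σ ω₀ fun γ => S.scat γ σ ω₀ :=
  Classical.epsilon_spec (exists_hasScattering h0 h1 hΩ σ)

/-- Whatever vector the choice in `scat` picked, its entries off `σ` are determined by `U`, because
a Jost solution does not vanish at both `k = 0` and `k = 1`. -/
lemma scat_mul_jost {γ σ : C} (hne : γ ≠ σ) (k : ℕ) :
    S.scat γ σ ω₀ * S.jost γ (S.theta γ ω₀) k = S.U k ω₀ γ σ := by
  obtain ⟨ψ, hψ, hU⟩ := hasScattering_scat h0 h1 hΩ σ
  rw [← hU, hψ.transmitted γ hne]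

/-- Outside `Ω` the scattering coefficients are limits of an explicit expression. -/
lemma tendsto_scat {γ σ : C} (hne : γ ≠ σ) :
    Tendsto (fun ω => (S.T ω)⁻¹ γ σ * S.incoming ω σ) (diskPunctured ω₀)
      (𝓝 (S.scat γ σ ω₀)) := by
  have hs := S.theta_spec γ h0 h1
  obtain ⟨k, hk⟩ : ∃ k, S.jost γ (S.theta γ ω₀) k ≠ 0 :=
    (S.jost_ne_zero γ hs.1 hs.2.1).elim (fun h => ⟨0, h⟩) fun h => ⟨1, h⟩
  have hj := tendsto_jost_diskPunctured (S := S) h0 h1 γ k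
  have h2 := (tendsto_U_diskPunctured h0 h1 hΩ k γ σ).div hj hk
  rw [← scat_mul_jost h0 h1 hΩ hne, mul_div_cancel_right₀ _ hk] at h2
  refine h2.congr' ?_
  filter_upwards [S.eventually_mem_generic h0 h1, hj.eventually_ne hk] with ω hω hne'
  rw [Pi.div_apply, Uformula_off_diag hω k hne, mul_div_cancel_right₀ _ hne']

end limit

omit [Nonempty C] in
lemma not_mem_Omega_of_generic (h : ω₀ ∈ S.generic) : ω₀ ∉ S.Omega := by
  rintro ⟨-, -, k, γ, σ, hlim⟩
  have : (𝓝[S.generic] ω₀).NeBot := mem_closure_iff_nhdsWithin_neBot.1 (subset_closure h)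
  exact not_tendsto_atTop_of_tendsto_nhds (tendsto_Uformula_generic h k γ σ).norm hlim

lemma scat_eq_of_generic (h : ω ∈ S.generic) {γ σ : C} (hne : γ ≠ σ) :
    S.scat γ σ ω = (S.T ω)⁻¹ γ σ * S.incoming ω σ := by
  have := diskPunctured_neBot h.1
  have hT := tendsto_matrix_apply (tendsto_matrix_inv (tendsto_T_generic h) h.2.2.2.1) γ σ
  refine tendsto_nhds_unique (tendsto_scat h.2.1 h.1 (not_mem_Omega_of_generic h) hne) ?_
  exact (hT.mul (tendsto_incoming_generic h σ)).mono_left (diskPunctured_le_generic h.2.1 h.1)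

omit [Nonempty C] in
/-- Symmetry of the explicit expression for the scattering coefficients. -/
lemma symmetry_generic (h : ω ∈ S.generic) (γ σ : C) :
    (S.bLim γ : ℂ) * ((S.theta γ ω)⁻¹ - S.theta γ ω) * ((S.T ω)⁻¹ γ σ * S.incoming ω σ) =
      (S.bLim σ : ℂ) * ((S.theta σ ω)⁻¹ - S.theta σ ω) * ((S.T ω)⁻¹ σ γ * S.incoming ω γ) := by
  set v : C → ℂ := fun ν => S.jost ν (S.theta ν ω) 1 * S.bC ν 0 with hv
  have hv0 : ∀ ν, v ν ≠ 0 := fun ν => mul_ne_zero (h.2.2.2.2 ν) (S.bC_ne_zero ν 0)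
  -- With `V = B(0) ℰ(1)` the product is `V ℰ(0) - V ℛ V`, which is symmetric since `ℛ` is.
  have hQ : (Matrix.diagonal v * S.T ω)ᵀ = Matrix.diagonal v * S.T ω := by
    have hBE : S.B0 * S.E 1 ω = Matrix.diagonal v := by
      rw [B0, E, Matrix.diagonal_mul_diagonal]
      congr 1
      ext ν
      exact mul_comm _ _
    rw [T, Matrix.mul_assoc, hBE, E, Matrix.mul_sub, Matrix.transpose_sub, Matrix.transpose_mul,
      Matrix.transpose_mul, Matrix.transpose_mul, resolvent_transpose]
    simp only [Matrix.diagonal_transpose, Matrix.mul_assoc, Matrix.diagonal_mul_diagonal, mul_comm]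
  have hinv : (S.T ω)⁻¹ * Matrix.diagonal (fun ν => (v ν)⁻¹) =
      (Matrix.diagonal v * S.T ω)⁻¹ := by
    rw [Matrix.mul_inv_rev, Matrix.inv_diagonal_of_ne_zero hv0]
  have hsymm : (S.T ω)⁻¹ γ σ * (v σ)⁻¹ = (S.T ω)⁻¹ σ γ * (v γ)⁻¹ := by
    have hkey : ∀ α β, (S.T ω)⁻¹ α β * (v β)⁻¹ = (Matrix.diagonal v * S.T ω)⁻¹ α β := fun α β => by
      rw [← hinv, Matrix.mul_diagonal]
    have hQi := Matrix.transpose_nonsing_inv (Matrix.diagonal v * S.T ω)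
    rw [hQ] at hQi
    rw [hkey, hkey]
    exact congrFun (congrFun hQi σ) γ
  -- Once `v⁻¹` is split off the incoming factor, each side of the claim is the same product of two
  -- weights times an entry of the symmetric matrix `(V T)⁻¹`.
  have hinc : ∀ ν, S.incoming ω ν =
      (v ν)⁻¹ * (S.bLim ν * ((S.theta ν ω)⁻¹ - S.theta ν ω)) := fun ν => by
    simp only [incoming, hv, mul_inv]
    ring
  rw [hinc, hinc]
  linear_combination (S.bLim γ : ℂ) * ((S.theta γ ω)⁻¹ - S.theta γ ω) *
    ((S.bLim σ : ℂ) * ((S.theta σ ω)⁻¹ - S.theta σ ω)) * hsymm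

/-- Symmetry of the scattering coefficients. -/
theorem symmetry_scat (h0 : ω₀ ≠ 0) (h1 : ‖ω₀‖ ≤ 1) (hΩ : ω₀ ∉ S.Omega) {γ σ : C}
    (hne : γ ≠ σ) :
    (S.bLim γ : ℂ) * ((S.theta γ ω₀)⁻¹ - S.theta γ ω₀) * S.scat γ σ ω₀ =
      (S.bLim σ : ℂ) * ((S.theta σ ω₀)⁻¹ - S.theta σ ω₀) * S.scat σ γ ω₀ := by
  have := diskPunctured_neBot h1
  have hθ : ∀ ν, Tendsto (fun ω => (S.bLim ν : ℂ) * ((S.theta ν ω)⁻¹ - S.theta ν ω))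
      (diskPunctured ω₀) (𝓝 (S.bLim ν * ((S.theta ν ω₀)⁻¹ - S.theta ν ω₀))) := fun ν => by
    have := tendsto_theta_diskPunctured (S := S) h1 ν
    exact ((this.inv₀ (S.theta_spec ν h0 h1).1).sub this).const_mul _
  refine tendsto_nhds_unique_of_eventuallyEq ((hθ γ).mul (tendsto_scat h0 h1 hΩ hne))
    ((hθ σ).mul (tendsto_scat h0 h1 hΩ hne.symm)) ?_
  filter_upwards [S.eventually_mem_generic h0 h1] with ω hω using symmetry_generic hω γ σ

/-- Continuity of the scattering coefficients outside `Ω`. -/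
theorem continuousOn_scat {γ σ : C} (hne : γ ≠ σ) :
    ContinuousOn (S.scat γ σ) (Metric.closedBall (0 : ℂ) 1 \ (S.Omega ∪ {0})) := by
  set A := Metric.closedBall (0 : ℂ) 1 \ (S.Omega ∪ {0}) with hA
  have hmem : ∀ ω ∈ A, ω ≠ 0 ∧ ‖ω‖ ≤ 1 ∧ ω ∉ S.Omega := fun ω hω =>
    ⟨fun h => hω.2 (Or.inr h), by simpa using hω.1, fun h => hω.2 (Or.inl h)⟩
  intro ω₀ hω₀
  obtain ⟨h0, h1, hΩ⟩ := hmem ω₀ hω₀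
  have hs := S.theta_spec γ h0 h1
  obtain ⟨k, hk⟩ : ∃ k, S.jost γ (S.theta γ ω₀) k ≠ 0 :=
    (S.jost_ne_zero γ hs.1 hs.2.1).elim (fun h => ⟨0, h⟩) fun h => ⟨1, h⟩
  have hU : ContinuousOn (fun ω => S.U k ω γ σ) A := by
    -- By definition `U` extends its formula by limits from the generic set, so existence of the
    -- limits at all points of `A` already gives continuity.
    refine continuousOn_extendFrom (f := fun ω => S.Uformula k ω γ σ) (fun ω hω => ?_)
      fun ω hω => ?_
    · obtain ⟨h0, h1, -⟩ := hmem ω hω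
      exact mem_closure_iff_nhdsWithin_neBot.2 (generic_neBot h0 h1)
    · obtain ⟨h0, h1, hΩ⟩ := hmem ω hω
      exact exists_tendsto_Uformula h0 h1 hΩ k γ σ
  have hj : Tendsto (fun ω => S.jost γ (S.theta γ ω) k) (𝓝[A] ω₀)
      (𝓝 (S.jost γ (S.theta γ ω₀) k)) :=
    (S.tendsto_jost_theta γ k h0 h1).mono_left (nhdsWithin_mono _ Set.sdiff_subset)
  have h2 := (hU ω₀ hω₀).tendsto.div hj hk
  have heq : ∀ᶠ ω in 𝓝[A] ω₀, S.U k ω γ σ / S.jost γ (S.theta γ ω) k = S.scat γ σ ω := by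
    filter_upwards [hj.eventually_ne hk, self_mem_nhdsWithin] with ω h3 h4
    obtain ⟨h0, h1, hΩ⟩ := hmem ω h4
    rw [← scat_mul_jost h0 h1 hΩ hne, mul_div_cancel_right₀ _ h3]
  rw [← scat_mul_jost h0 h1 hΩ hne, mul_div_cancel_right₀ _ hk] at h2
  exact h2.congr' heq

end WebSystem

/-! ### Asymptotics at the origin. -/

namespace WebSystem

variable {𝒜 C : Type*} (S : WebSystem 𝒜 C)

lemma eventually_ne_zero_norm_le : ∀ᶠ ω in 𝓝[≠] (0 : ℂ), ω ≠ 0 ∧ ‖ω‖ ≤ 1 := by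
  filter_upwards [self_mem_nhdsWithin,
    nhdsWithin_le_nhds (Metric.closedBall_mem_nhds (0 : ℂ) one_pos)] with ω h1 h2
  exact ⟨h1, by simpa using h2⟩

lemma tendsto_theta_zero (σ : C) : Tendsto (S.theta σ) (𝓝[≠] 0) (𝓝 0) := by
  have h := (S.continuousOn_theta σ).continuousAt (Metric.closedBall_mem_nhds (0 : ℂ) one_pos)
  have h' := h.tendsto
  rw [theta_zero] at h'
  exact h'.mono_left nhdsWithin_le_nhds

lemma tendsto_id_zero : Tendsto (fun ω : ℂ => ω) (𝓝[≠] 0) (𝓝 0) :=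
  tendsto_id.mono_left nhdsWithin_le_nhds

/-- The derivative of `θ_σ` at the origin. -/
lemma tendsto_theta_div (σ : C) :
    Tendsto (fun ω => S.theta σ ω / ω) (𝓝[≠] 0) (𝓝 (S.bLim σ / S.b)) := by
  have hb : (S.b : ℂ) ≠ 0 := by exact_mod_cast (S.b_pos σ).ne'
  have hθ := S.tendsto_theta_zero σ
  have hden : Tendsto (fun ω : ℂ => (S.b : ℂ) * (ω ^ 2 + 1) + ((S.aLim σ : ℂ) - S.a) * ω) (𝓝[≠] 0)
      (𝓝 (S.b : ℂ)) := by
    have := (((tendsto_id_zero.pow 2).add_const 1).const_mul (S.b : ℂ)).add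
      (tendsto_id_zero.const_mul ((S.aLim σ : ℂ) - S.a))
    simpa using this
  have hnum : Tendsto (fun ω => (S.bLim σ : ℂ) * (S.theta σ ω ^ 2 + 1)) (𝓝[≠] 0)
      (𝓝 (S.bLim σ : ℂ)) := by
    have := ((hθ.pow 2).add_const 1).const_mul (S.bLim σ : ℂ)
    simpa using this
  refine (hnum.div hden hb).congr' ?_
  filter_upwards [eventually_ne_zero_norm_le, hden.eventually_ne hb] with ω h1 h2
  have hp := S.theta_poly σ h1.2
  rw [Pi.div_apply, div_eq_div_iff h2 h1.1]
  linear_combination -hp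

lemma tendsto_jostU_theta (σ : C) (k : ℕ) :
    Tendsto (fun ω => S.jostU σ k (S.theta σ ω)) (𝓝[≠] 0) (𝓝 (S.jostU σ k 0)) :=
  (S.analyticAt_jostU σ k (by simp)).continuousAt.tendsto.comp (S.tendsto_theta_zero σ)

section core

open scoped Classical

lemma tendsto_mul_W : Tendsto (fun ω => ω * S.W ω) (𝓝[≠] 0) (𝓝 (-(S.b : ℂ))) := by
  have h : Tendsto (fun ω : ℂ => (S.a : ℂ) * ω - S.b * (ω ^ 2 + 1)) (𝓝[≠] 0)
      (𝓝 (-(S.b : ℂ))) := by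
    have := (tendsto_id_zero.const_mul (S.a : ℂ)).sub
      (((tendsto_id_zero.pow 2).add_const 1).const_mul (S.b : ℂ))
    simpa using this
  refine h.congr' ?_
  filter_upwards [eventually_ne_zero_norm_le] with ω hω
  have := hω.1
  rw [W]
  field_simp

/-- `W` has a simple pole at the origin with residue `-b`, so after multiplication by `ω` the matrix
`ℒ₁ - W` has an invertible scalar limit. The resolvent is therefore of first order in `ω`. -/
lemma tendsto_smul_coreMat : Tendsto (fun ω => ω • S.coreMat (S.W ω)) (𝓝[≠] 0)
    (𝓝 ((S.b : ℂ) • 1)) := by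
  have h := (tendsto_id_zero.smul_const (S.coreMat 0)).sub
    (S.tendsto_mul_W.smul_const (1 : Matrix S.core S.core ℂ))
  rw [zero_smul, neg_smul, sub_neg_eq_add, zero_add] at h
  refine h.congr fun ω => ?_
  rw [S.coreMat_eq_sub (S.W ω), smul_sub, smul_smul]

variable (hb : S.b ≠ 0)

include hb

lemma isUnit_det_smul_one : IsUnit ((S.b : ℂ) • (1 : Matrix S.core S.core ℂ)).det := by
  rw [Matrix.det_smul, Matrix.det_one, mul_one]
  exact (pow_ne_zero _ (by exact_mod_cast hb)).isUnit

lemma eventually_isUnit_smul_coreMat :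
    ∀ᶠ ω in 𝓝[≠] (0 : ℂ), IsUnit (ω • S.coreMat (S.W ω)).det := by
  have h := (continuous_id.matrix_det.tendsto _).comp S.tendsto_smul_coreMat
  filter_upwards [h.eventually_ne (S.isUnit_det_smul_one hb).ne_zero] with ω hω
  exact isUnit_iff_ne_zero.2 hω

lemma eventually_isUnit_coreMat : ∀ᶠ ω in 𝓝[≠] (0 : ℂ), IsUnit (S.coreMat (S.W ω)).det := by
  filter_upwards [S.eventually_isUnit_smul_coreMat hb] with ω hω
  rw [Matrix.det_smul] at hω
  exact isUnit_of_mul_isUnit_right hω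

lemma tendsto_inv_smul_coreMat : Tendsto (fun ω => (ω • S.coreMat (S.W ω))⁻¹) (𝓝[≠] 0)
    (𝓝 ((S.b : ℂ) • (1 : Matrix S.core S.core ℂ))⁻¹) :=
  tendsto_matrix_inv S.tendsto_smul_coreMat (S.isUnit_det_smul_one hb)

lemma eventually_resolvent_eq (γ σ : C) : ∀ᶠ ω in 𝓝[≠] (0 : ℂ), S.resolvent (S.W ω) γ σ =
    ω * (ω • S.coreMat (S.W ω))⁻¹ (S.attach γ) (S.attach σ) := by
  filter_upwards [S.eventually_isUnit_smul_coreMat hb] with ω hω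
  have : (S.coreMat (S.W ω))⁻¹ = ω • (ω • S.coreMat (S.W ω))⁻¹ := by
    refine Matrix.inv_eq_right_inv ?_
    rw [Matrix.mul_smul, ← Matrix.smul_mul, Matrix.mul_nonsing_inv _ hω]
  rw [resolvent, Matrix.of_apply]
  exact congrFun (congrFun this _) _

lemma tendsto_resolvent_zero (γ σ : C) :
    Tendsto (fun ω => S.resolvent (S.W ω) γ σ) (𝓝[≠] 0) (𝓝 0) := by
  have h := tendsto_id_zero.mul
    (tendsto_matrix_apply (S.tendsto_inv_smul_coreMat hb) (S.attach γ) (S.attach σ))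
  rw [zero_mul] at h
  exact h.congr' ((S.eventually_resolvent_eq hb γ σ).mono fun _ h => h.symm)

/-- Off the diagonal the resolvent matrix vanishes to second order at the origin. -/
lemma exists_resolvent_off_diag {γ σ : C} (hne : γ ≠ σ) :
    ∃ (y : ℂ → ℂ) (c : ℂ), Tendsto y (𝓝[≠] 0) (𝓝 c) ∧
      ∀ᶠ ω in 𝓝[≠] (0 : ℂ), S.resolvent (S.W ω) γ σ = ω ^ 2 * y ω := by
  have hb' : -(S.b : ℂ) ≠ 0 := neg_ne_zero.2 (by exact_mod_cast hb)
  have hY := S.tendsto_inv_smul_coreMat hb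
  -- With `Y = (ω (ℒ₁ - W))⁻¹`, the off-diagonal entry of `ω (ℒ₁ - W) Y = 1` reads `ω (ℒ₁ Y) = ω W
  -- Y`. As `ω W` tends to `-b`, this gives `Y` a further factor `ω`; distinct attachment points
  -- make the entry off-diagonal.
  refine ⟨fun ω => (S.coreMat 0 * (ω • S.coreMat (S.W ω))⁻¹) (S.attach γ) (S.attach σ) /
    (ω * S.W ω), _, (tendsto_matrix_apply (hY.const_mul (S.coreMat 0)) _ _).div
      S.tendsto_mul_W hb', ?_⟩
  filter_upwards [S.eventually_resolvent_eq hb γ σ, S.eventually_isUnit_smul_coreMat hb,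
    S.tendsto_mul_W.eventually_ne hb'] with ω h1 h2 h3
  rw [h1]
  set Y := (ω • S.coreMat (S.W ω))⁻¹ with hYdef
  have h4 : (ω • S.coreMat (S.W ω)) * Y = 1 := Matrix.mul_nonsing_inv _ h2
  rw [S.coreMat_eq_sub (S.W ω), smul_sub, smul_smul, Matrix.sub_mul, Matrix.smul_mul,
    Matrix.smul_mul, Matrix.one_mul] at h4
  have h5 := congrFun (congrFun h4 (S.attach γ)) (S.attach σ)
  rw [Matrix.one_apply_ne fun h => hne (S.attach_injective h), Matrix.sub_apply,
    Matrix.smul_apply, Matrix.smul_apply, smul_eq_mul, smul_eq_mul] at h5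
  rw [← mul_div_assoc, eq_div_iff h3]
  linear_combination -ω * h5

end core

variable {S}

lemma tendsto_jost_zero_zero (σ : C) :
    Tendsto (fun ω => S.jost σ (S.theta σ ω) 0) (𝓝[≠] 0) (𝓝 (S.jostU σ 0 0)) := by
  refine (S.tendsto_jostU_theta σ 0).congr' ?_
  filter_upwards [eventually_ne_zero_norm_le] with ω hω
  have hs := S.theta_spec σ hω.1 hω.2
  rw [S.jost_eq σ hs.1 hs.2.1, pow_zero, one_mul]

lemma eventually_jost_one (σ : C) : ∀ᶠ ω in 𝓝[≠] (0 : ℂ), S.jost σ (S.theta σ ω) 1 =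
    S.theta σ ω * S.jostU σ 1 (S.theta σ ω) := by
  filter_upwards [eventually_ne_zero_norm_le] with ω hω
  have hs := S.theta_spec σ hω.1 hω.2
  rw [S.jost_eq σ hs.1 hs.2.1, pow_one]

lemma tendsto_jost_one_zero (σ : C) :
    Tendsto (fun ω => S.jost σ (S.theta σ ω) 1) (𝓝[≠] 0) (𝓝 0) := by
  have h := (S.tendsto_theta_zero σ).mul (S.tendsto_jostU_theta σ 1)
  rw [zero_mul] at h
  exact h.congr' ((eventually_jost_one σ).mono fun _ h => h.symm)

variable [Nonempty C]

lemma b_ne_zero : S.b ≠ 0 := (S.b_pos (Classical.arbitrary C)).ne'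

variable [DecidableEq C] [Fintype C]

lemma tendsto_T_zero :
    Tendsto S.T (𝓝[≠] 0) (𝓝 (Matrix.diagonal fun σ => S.jostU σ 0 0)) := by
  have hR : Tendsto (fun ω => S.resolvent (S.W ω)) (𝓝[≠] 0) (𝓝 0) :=
    tendsto_pi_nhds.2 fun γ => tendsto_pi_nhds.2 fun σ => S.tendsto_resolvent_zero b_ne_zero γ σ
  have h := (tendsto_matrix_diagonal fun σ => tendsto_jost_zero_zero (S := S) σ).sub
    ((hR.mul_const S.B0).mul (tendsto_matrix_diagonal fun σ => tendsto_jost_one_zero (S := S) σ))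
  rw [zero_mul, zero_mul, sub_zero] at h
  exact h

omit [Nonempty C] in
lemma isUnit_det_diagonal_jostU : IsUnit (Matrix.diagonal fun σ => S.jostU σ 0 0).det := by
  rw [Matrix.det_diagonal]
  exact (Finset.prod_ne_zero_iff.2 fun σ _ => S.jostU_zero_ne_zero σ 0).isUnit

variable (S) in
/-- All points near the origin are generic. -/
lemma eventually_mem_generic_zero : ∀ᶠ ω in 𝓝[≠] (0 : ℂ), ω ∈ S.generic := by
  have hT := (continuous_id.matrix_det.tendsto _).comp (tendsto_T_zero (S := S))
  have hU : ∀ σ, ∀ᶠ ω in 𝓝[≠] (0 : ℂ), S.jostU σ 1 (S.theta σ ω) ≠ 0 := fun σ =>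
    (S.tendsto_jostU_theta σ 1).eventually_ne (S.jostU_zero_ne_zero σ 1)
  filter_upwards [eventually_ne_zero_norm_le, S.eventually_isUnit_coreMat b_ne_zero,
    hT.eventually_ne isUnit_det_diagonal_jostU.ne_zero, eventually_all.2 hU,
    eventually_all.2 fun σ => eventually_jost_one (S := S) σ] with ω h1 h2 h3 h4 h5
  refine ⟨h1.2, h1.1, h2, isUnit_iff_ne_zero.2 h3, fun σ => ?_⟩
  rw [h5 σ]
  exact mul_ne_zero (S.theta_spec σ h1.1 h1.2).1 (h4 σ)

/-- Off the diagonal the matrix `T` vanishes to third order at the origin. -/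
lemma exists_T_off_diag {γ σ : C} (hne : γ ≠ σ) :
    ∃ (y : ℂ → ℂ) (c : ℂ), Tendsto y (𝓝[≠] 0) (𝓝 c) ∧
      ∀ᶠ ω in 𝓝[≠] (0 : ℂ), S.T ω γ σ = ω ^ 3 * y ω := by
  obtain ⟨y, c, hy, hR⟩ := S.exists_resolvent_off_diag b_ne_zero hne
  -- Two orders come from the resolvent and one from `e_σ(1) = θ_σ u_1(θ_σ)`.
  refine ⟨fun ω => -(y ω * S.bC σ 0 * ((S.theta σ ω / ω) * S.jostU σ 1 (S.theta σ ω))), _,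
    ((hy.mul_const _).mul ((S.tendsto_theta_div σ).mul (S.tendsto_jostU_theta σ 1))).neg, ?_⟩
  filter_upwards [hR, eventually_jost_one (S := S) σ, eventually_ne_zero_norm_le]
    with ω h1 h2 h3
  have := h3.1
  rw [T, Matrix.sub_apply, E, E, Matrix.diagonal_apply_ne _ hne, Matrix.mul_diagonal, B0,
    Matrix.mul_diagonal, h1, h2]
  field_simp
  ring

/-- Off the diagonal the matrix `T⁻¹` vanishes to third order at the origin. -/
lemma exists_T_inv_off_diag {γ σ : C} (hne : γ ≠ σ) :
    ∃ (y : ℂ → ℂ) (c : ℂ), Tendsto y (𝓝[≠] 0) (𝓝 c) ∧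
      ∀ᶠ ω in 𝓝[≠] (0 : ℂ), (S.T ω)⁻¹ γ σ = ω ^ 3 * y ω := by
  have hex : ∀ ν, ∃ (y : ℂ → ℂ) (c : ℂ), Tendsto y (𝓝[≠] 0) (𝓝 c) ∧
      (γ ≠ ν → ∀ᶠ ω in 𝓝[≠] (0 : ℂ), S.T ω γ ν = ω ^ 3 * y ω) := fun ν => by
    by_cases h : γ = ν
    · exact ⟨0, 0, tendsto_const_nhds, fun h' => absurd h h'⟩
    · obtain ⟨y, c, h1, h2⟩ := exists_T_off_diag (S := S) h
      exact ⟨y, c, h1, fun _ => h2⟩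
  choose y c hy hT using hex
  have hTi := tendsto_matrix_inv (tendsto_T_zero (S := S)) isUnit_det_diagonal_jostU
  have hTγ := tendsto_matrix_apply (tendsto_T_zero (S := S)) γ γ
  have hγ0 : (Matrix.diagonal fun σ => S.jostU σ 0 0) γ γ ≠ 0 := by
    rw [Matrix.diagonal_apply_eq]; exact S.jostU_zero_ne_zero γ 0
  -- The entry is solved from the `(γ, σ)` entry of `T T⁻¹ = 1`: the diagonal entry of `T` stays
  -- away from zero, and every other term contains an off-diagonal entry of row `γ` of `T`.
  refine ⟨fun ω => -(∑ ν ∈ Finset.univ.erase γ, y ν ω * (S.T ω)⁻¹ ν σ) / S.T ω γ γ, _,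
    ((tendsto_finsetSum _ fun ν _ => (hy ν).mul (tendsto_matrix_apply hTi ν σ)).neg.div hTγ
      hγ0), ?_⟩
  have hall : ∀ᶠ ω in 𝓝[≠] (0 : ℂ), ∀ ν, γ ≠ ν → S.T ω γ ν = ω ^ 3 * y ν ω :=
    eventually_all.2 fun ν => by
      by_cases h : γ = ν
      · exact Eventually.of_forall fun _ h' => absurd h h'
      · exact (hT ν h).mono fun _ h _ => h
  filter_upwards [hall, S.eventually_mem_generic_zero, hTγ.eventually_ne hγ0] with ω h1 h2 h3
  have h4 := congrFun (congrFun (Matrix.mul_nonsing_inv _ h2.2.2.2.1) γ) σ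
  rw [Matrix.one_apply_ne hne, Matrix.mul_apply, ← Finset.add_sum_erase _ _ (Finset.mem_univ γ)]
    at h4
  have h5 : ∑ ν ∈ Finset.univ.erase γ, S.T ω γ ν * (S.T ω)⁻¹ ν σ =
      ω ^ 3 * ∑ ν ∈ Finset.univ.erase γ, y ν ω * (S.T ω)⁻¹ ν σ := by
    rw [Finset.mul_sum]
    refine Finset.sum_congr rfl fun ν hν => ?_
    rw [h1 ν (Finset.ne_of_mem_erase hν).symm, mul_assoc]
  rw [h5] at h4
  field_simp
  linear_combination h4

/-- The scattering coefficients vanish at the origin. -/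
lemma exists_scat_eq_mul {γ σ : C} (hne : γ ≠ σ) :
    ∃ (y : ℂ → ℂ) (c : ℂ), Tendsto y (𝓝[≠] 0) (𝓝 c) ∧
      ∀ᶠ ω in 𝓝[≠] (0 : ℂ), S.scat γ σ ω = ω * y ω := by
  obtain ⟨y, c, hy, hT⟩ := exists_T_inv_off_diag (S := S) hne
  have hb : (S.b : ℂ) ≠ 0 := by exact_mod_cast b_ne_zero (S := S)
  have hlim : (S.bLim σ / S.b : ℂ) ^ 2 * S.jostU σ 1 0 ≠ 0 :=
    mul_ne_zero (pow_ne_zero 2 (div_ne_zero (S.bLim_ne_zero σ) hb)) (S.jostU_zero_ne_zero σ 1)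
  have hθ := S.tendsto_theta_zero σ
  have hden := ((S.tendsto_theta_div σ).pow 2).mul (S.tendsto_jostU_theta σ 1)
  -- Here `(θ⁻¹ - θ) / e_σ(1) = (1 - θ²) / (θ² u_1(θ))` loses two of the three orders.
  refine ⟨fun ω => y ω * (S.bLim σ * (S.bC σ 0 : ℂ)⁻¹ * ((1 - S.theta σ ω ^ 2) /
    ((S.theta σ ω / ω) ^ 2 * S.jostU σ 1 (S.theta σ ω)))), _,
    hy.mul ((((hθ.pow 2).const_sub 1).div hden hlim).const_mul _), ?_⟩
  filter_upwards [S.eventually_mem_generic_zero, hT, eventually_jost_one (S := S) σ]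
    with ω h1 h2 h3
  have hθ0 := (generic_theta h1 σ).1
  have hω := h1.2.1
  have hU : S.jostU σ 1 (S.theta σ ω) ≠ 0 := by
    have := h1.2.2.2.2 σ
    rw [h3] at this
    exact right_ne_zero_of_mul this
  have hbC := S.bC_ne_zero σ 0
  rw [scat_eq_of_generic h1 hne, h2, incoming, h3]
  field_simp

lemma tendsto_scat_zero {γ σ : C} (hne : γ ≠ σ) :
    Tendsto (S.scat γ σ) (𝓝[≠] 0) (𝓝 0) := by
  obtain ⟨y, c, hy, h⟩ := exists_scat_eq_mul (S := S) hne
  have := tendsto_id_zero.mul hy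
  rw [zero_mul] at this
  exact this.congr' (h.mono fun _ h => h.symm)

lemma exists_tendsto_weighted_scat {γ σ : C} (hne : γ ≠ σ) :
    ∃ l : ℂ, Tendsto
      (fun ω => (S.bLim γ : ℂ) * ((S.theta γ ω)⁻¹ - S.theta γ ω) * S.scat γ σ ω)
      (𝓝[≠] 0) (𝓝 l) := by
  obtain ⟨y, c, hy, h⟩ := exists_scat_eq_mul (S := S) hne
  have hb : (S.b : ℂ) ≠ 0 := by exact_mod_cast b_ne_zero (S := S)
  have hθ := S.tendsto_theta_zero γ
  have hlim := ((((hθ.pow 2).const_sub 1).div (S.tendsto_theta_div γ)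
    (div_ne_zero (S.bLim_ne_zero γ) hb)).const_mul (S.bLim γ : ℂ)).mul hy
  refine ⟨_, hlim.congr' ?_⟩
  filter_upwards [h, eventually_ne_zero_norm_le] with ω h1 h2
  have hθ0 := (S.theta_spec γ h2.1 h2.2).1
  have := h2.1
  rw [h1, Pi.div_apply]
  field_simp

end WebSystem

end

theorem mainTheorem4 {𝒜 C : Type*} [Fintype C] [DecidableEq C] (S : WebSystem 𝒜 C) :
    -- the scattering coefficients are well defined
    (∀ σ : C, ∀ ω ∈ Metric.closedBall (0 : ℂ) 1 \ (S.Omega ∪ {0}),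
      S.HasScattering σ ω (fun γ => S.scat γ σ ω)) ∧
    ∀ σ γ : C, σ ≠ γ →
      -- symmetry off the origin
      (∀ ω ∈ Metric.closedBall (0 : ℂ) 1 \ (S.Omega ∪ {0}),
        (S.bLim γ : ℂ) * ((S.theta γ ω)⁻¹ - S.theta γ ω) * S.scat γ σ ω =
          (S.bLim σ : ℂ) * ((S.theta σ ω)⁻¹ - S.theta σ ω) * S.scat σ γ ω) ∧
      -- symmetry at the origin, where both sides are understood as limits
      (∃ l : ℂ,
        Tendsto (fun ω => (S.bLim γ : ℂ) * ((S.theta γ ω)⁻¹ - S.theta γ ω) * S.scat γ σ ω)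
          (𝓝[≠] 0) (𝓝 l) ∧
        Tendsto (fun ω => (S.bLim σ : ℂ) * ((S.theta σ ω)⁻¹ - S.theta σ ω) * S.scat σ γ ω)
          (𝓝[≠] 0) (𝓝 l)) ∧
      -- continuity up to the boundary, and at the origin after continuous extension
      ContinuousOn (S.scat γ σ) (Metric.closedBall (0 : ℂ) 1 \ (S.Omega ∪ {0})) ∧
      ContinuousOn (S.scat σ γ) (Metric.closedBall (0 : ℂ) 1 \ (S.Omega ∪ {0})) ∧
      (∃ l : ℂ, Tendsto (S.scat γ σ) (𝓝[≠] 0) (𝓝 l)) ∧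
      (∃ l : ℂ, Tendsto (S.scat σ γ) (𝓝[≠] 0) (𝓝 l)) := by
  have hmem : ∀ ω ∈ Metric.closedBall (0 : ℂ) 1 \ (S.Omega ∪ {0}),
      ω ≠ 0 ∧ ‖ω‖ ≤ 1 ∧ ω ∉ S.Omega := fun ω hω =>
    ⟨fun h => hω.2 (Or.inr h), by simpa using hω.1, fun h => hω.2 (Or.inl h)⟩
  refine ⟨fun σ ω hω => ?_, fun σ γ hne => ?_⟩
  · have : Nonempty C := ⟨σ⟩
    obtain ⟨h0, h1, hΩ⟩ := hmem ω hω
    exact WebSystem.hasScattering_scat h0 h1 hΩ σ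
  · have : Nonempty C := ⟨σ⟩
    refine ⟨fun ω hω => ?_, ?_, WebSystem.continuousOn_scat hne.symm,
      WebSystem.continuousOn_scat hne, ⟨0, WebSystem.tendsto_scat_zero hne.symm⟩,
      ⟨0, WebSystem.tendsto_scat_zero hne⟩⟩
    · obtain ⟨h0, h1, hΩ⟩ := hmem ω hω
      exact WebSystem.symmetry_scat h0 h1 hΩ hne.symm
    · obtain ⟨l, hl⟩ := WebSystem.exists_tendsto_weighted_scat (S := S) hne.symm
      -- Near the origin every point is generic, hence outside `Ω`, and symmetry there makes the
      -- second weighted function equal to the first.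
      refine ⟨l, hl, hl.congr' ?_⟩
      filter_upwards [S.eventually_mem_generic_zero] with ω hω
      exact WebSystem.symmetry_scat hω.2.1 hω.1 (WebSystem.not_mem_Omega_of_generic hω) hne.symm
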